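/- Let $K\subset\mathbb R^2$ be a bounded convex set, let $X$ be a Poisson point process in $K$ whose intensity is the Lebesgue measure (so $X$ is a random finite set of points of $K$), and let $\Pi_K$ be the convex hull of $X$. For $\theta\in\mathbb R/2\pi$ let $W_K(\theta)$ be the vertex of $\Pi_K$ at which $\Pi_K$ has an oriented tangent line of direction $(\cos\theta,\sin\theta)$, with $\Pi_K$ on its left; if the tangent line contains an edge of $\Pi_K$ (which for fixed $\theta$ has probability $0$), $W_K(\theta)$ is the end point of that edge farthest in the direction $(\cos\theta,\sin\theta)$, and if $X=\emptyset$ it takes an extra value "none". For $S\subseteq\mathbb R/2\pi$ let $\mathcal F_S$ be the $\sigma$-algebra generated by the random variables $W_K(\theta)$, $\theta\in S$. If $\operatorname{Area}(K)>1$, then for each $\theta$ there is a unique half-plane $H_\theta$, lying to the right of an oriented line $\partial H_\theta$ of direction $(\cos\theta,\sin\theta)$, such that $H_\theta\cap K$ has area $1$; let $f_K(e^{-1},\theta)$ be the length of $\partial H_\theta\cap K$. If $\operatorname{Area}(K)\le 1$, put $f_K(e^{-1},\theta)=0$. The affine invariant measure of $K$ is the measure $\mu_K=f_K(e^{-1},\theta)^2\,d\theta$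 on $\mathbb R/2\pi$. For $\alpha,\beta\in\mathbb R/2\pi$ put $\mathfrak d_K(\alpha,\beta)=\mu_K([\alpha,\beta])$ if $\alpha\le\beta\le\alpha+\pi$, and $\mathfrak d_K(\alpha,\beta)=\mu_K([\beta,\alpha])$ if instead $\beta\le\alpha\le\beta+\pi$ (for suitable real lifts of the angles; $[\alpha,\beta]$ is the counterclockwise arc from $\alpha$ to $\beta$). **Proposition.** There exist absolute constants $\delta>0$ and $C$, independent of $K$ and of everything below, such that for every bounded convex set $K\subset\mathbb R^2$, every two disjoint closed intervals $[\theta_1,\theta_2]$ and $[\psi_1,\psi_2]$ in $\mathbb R/2\pi$, and all events $A\in\mathcal F_{[\theta_1,\theta_2]}$ and $B\in\mathcal F_{[\psi_1,\psi_2]}$, $$|P(A\cap B)-P(A)P(B)|\le C\sum_{i,j\in\{1,2\}}\exp\bigl(-\delta\,\mathfrak d_K(\theta_i,\psi_j)\bigr).$$ -/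

import Mathlib

noncomputable section

namespace RandomPolygon

open Real MeasureTheory ProbabilityTheory Set

/-- The Euclidean plane, with its Lebesgue measure `volume`. -/
abbrev Plane : Type := EuclideanSpace ℝ (Fin 2)

/-! ### Angles: the circle `ℝ / 2π` -/

instance instMeasurableSpaceAngle : MeasurableSpace Real.Angle := borel Real.Angle

instance instBorelSpaceAngle : BorelSpace Real.Angle := ⟨rfl⟩

/-- The Lebesgue measure `dθ` on `ℝ / 2π`, of total mass `2π`. -/
def angleMeasure : Measure Real.Angle :=
  (volume.restrict (Ioc 0 (2 * π))).map (fun t : ℝ => (t : Real.Angle))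

/-- The interval `[a, b]` of `ℝ / 2π`: the image of a closed interval of real lifts,
run through counterclockwise from `a` to `b`. -/
def arc (a b : ℝ) : Set Real.Angle := (fun t : ℝ => (t : Real.Angle)) '' Icc a b

/-- The unit vector at angle `θ`. -/
def direction (θ : Real.Angle) : Plane := !₂[θ.cos, θ.sin]

/-- The left unit normal of an oriented line at angle `θ`. -/
def leftNormal (θ : Real.Angle) : Plane := !₂[-θ.sin, θ.cos]

/-! ### Caps and the affine invariant measure -/

/-- The half-plane to the right of the oriented line at angle `θ` and signed height `t`. -/
def halfPlane (θ : Real.Angle) (t : ℝ) : Set Plane := {p | inner ℝ p (leftNormal θ) ≤ t}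

/-- The cap of `K` at angle `θ` cut off at height `t`. -/
def cap (K : Set Plane) (θ : Real.Angle) (t : ℝ) : Set Plane := K ∩ halfPlane θ t

/-- The height `t` at which the cap of `K` at angle `θ` has area `r`
(it exists and is unique for bounded convex `K` and `0 < r < Area K`). -/
def capHeight (K : Set Plane) (r : ℝ) (θ : Real.Angle) : ℝ :=
  sSup {t : ℝ | volume.real (cap K θ t) ≤ r}

/-- The length of the chord in which `K` meets the oriented line at angle `θ` and height `t`;
the line is parametrized by arc length. -/
def chordLength (K : Set Plane) (θ : Real.Angle) (t : ℝ) : ℝ :=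
  volume.real {s : ℝ | t • leftNormal θ + s • direction θ ∈ K}

open scoped Classical in
/-- The function `f_K(x, θ)`: the length of the chord bounding the cap of `K` at angle `θ`
of area `log (1 / x)` if `x > exp (-Area K)`, and `0` otherwise. -/
def capChord (K : Set Plane) (x : ℝ) (θ : Real.Angle) : ℝ :=
  if exp (-volume.real K) < x then chordLength K θ (capHeight K (log (1 / x)) θ) else 0

/-- The affine invariant measure `μ_K = f_K(e⁻¹, θ)² dθ` on `ℝ / 2π`. -/
def affineMeasure (K : Set Plane) : Measure Real.Angle :=
  angleMeasure.withDensity (fun θ => ENNReal.ofReal (capChord K (exp (-1)) θ ^ 2))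

open scoped Classical in
/-- `𝔡_K(α, β)` is `μ_K [α, β]` if `α ≤ β ≤ α + π`, and `μ_K [β, α]` if instead
`β ≤ α ≤ β + π`. Here `(β - α).toReal` is the representative in `(-π, π]`. -/
def affineGap (K : Set Plane) (α β : Real.Angle) : ℝ :=
  if 0 ≤ (β - α).toReal then
    (affineMeasure K).real (arc α.toReal (α.toReal + (β - α).toReal))
  else
    (affineMeasure K).real (arc β.toReal (β.toReal - (β - α).toReal))

/-! ### The random polygon -/

/-- `X` is a Poisson point process in `K` whose intensity is the Lebesgue measure: a random
finite set of points of `K` such that the number of points in a Borel set `s` is a Poisson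
random variable of parameter `Area (K ∩ s)`, and the numbers of points in finitely many
pairwise disjoint Borel sets are independent. -/
structure IsPoissonProcess {Ω : Type*} [MeasurableSpace Ω] (P : Measure Ω) (K : Set Plane)
    (X : Ω → Finset Plane) : Prop where
  subset : ∀ ω, (X ω : Set Plane) ⊆ K
  measurable_count : ∀ s : Set Plane, MeasurableSet s →
    Measurable (fun ω => ((X ω : Set Plane) ∩ s).ncard)
  law_count : ∀ s : Set Plane, MeasurableSet s →
    P.map (fun ω => ((X ω : Set Plane) ∩ s).ncard) = poissonMeasure (volume (K ∩ s)).toNNReal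
  indep_count : ∀ (n : ℕ) (s : Fin n → Set Plane), (∀ i, MeasurableSet (s i)) →
    (∀ i j, i ≠ j → Disjoint (s i) (s j)) →
    iIndepFun (fun (i : Fin n) (ω : Ω) => ((X ω : Set Plane) ∩ s i).ncard) P

/-- The convex hull `Π_K` of the points of a finite configuration. -/
def polygon (X : Finset Plane) : Set Plane := convexHull ℝ (X : Set Plane)

/-- `p` is the vertex of the convex set `Q` having an oriented tangent line at angle `θ`, that is,
with `Q` to its left. If the tangent line contains a whole edge, then `p` is
the end point of that edge. -/
structure IsSupportVertex (Q : Set Plane) (θ : Real.Angle) (p : Plane) : Prop where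
  vertex : p ∈ Q.extremePoints ℝ
  tangent : ∀ q ∈ Q, inner ℝ p (leftNormal θ) ≤ inner ℝ q (leftNormal θ)
  last : ∀ q ∈ Q, inner ℝ q (leftNormal θ) = inner ℝ p (leftNormal θ) →
    inner ℝ q (direction θ) ≤ inner ℝ p (direction θ)

theorem IsSupportVertex.unique {Q : Set Plane} {θ : Real.Angle} {p q : Plane}
    (hp : IsSupportVertex Q θ p) (hq : IsSupportVertex Q θ q) : p = q := by
  have h1 := le_antisymm (hp.tangent q hq.vertex.1) (hq.tangent p hp.vertex.1)
  have h2 := le_antisymm (hq.last p hp.vertex.1 h1) (hp.last q hq.vertex.1 h1.symm)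
  simp only [leftNormal, direction, PiLp.inner_apply, Fin.sum_univ_two] at h1 h2
  simp at h1 h2
  have h3 := Real.Angle.cos_sq_add_sin_sq θ
  ext i
  fin_cases i
  · simp only [Fin.zero_eta]
    linear_combination (-θ.sin) * h1 + θ.cos * h2 - (p 0 - q 0) * h3
  · simp only [Fin.mk_one]
    linear_combination θ.cos * h1 + θ.sin * h2 - (p 1 - q 1) * h3

theorem exists_isSupportVertex {X : Finset Plane} (hX : X.Nonempty) (θ : Real.Angle) :
    ∃ p, IsSupportVertex (polygon X) θ p := by
  obtain ⟨p, hpX, hp⟩ := X.exists_min_image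
    (fun q => toLex (inner ℝ q (leftNormal θ), -inner ℝ q (direction θ))) hX
  set N := leftNormal θ
  set D := direction θ
  have hconv : Convex ℝ {q : Plane | inner ℝ p N < inner ℝ q N ∨
      (inner ℝ p N = inner ℝ q N ∧ inner ℝ q D ≤ inner ℝ p D)} := by
    intro x hx y hy a b ha hb hab
    simp only [mem_ofPred_eq, inner_add_left, real_inner_smul_left] at hx hy ⊢
    have hx' : inner ℝ p N ≤ inner ℝ x N := by rcases hx with h | h <;> linarith
    have hy' : inner ℝ p N ≤ inner ℝ y N := by rcases hy with h | h <;> linarith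
    rcases ha.eq_or_lt with rfl | ha
    · obtain rfl : b = 1 := by linarith
      simpa using hy
    rcases hb.eq_or_lt with rfl | hb
    · obtain rfl : a = 1 := by linarith
      simpa using hx
    obtain rfl : b = 1 - a := by linarith
    rcases hx with hx | ⟨hx1, hx2⟩
    · left; nlinarith
    · rcases hy with hy | ⟨hy1, hy2⟩
      · left; nlinarith
      · right; constructor <;> nlinarith
  have hsub : polygon X ⊆ {q : Plane | inner ℝ p N < inner ℝ q N ∨
      (inner ℝ p N = inner ℝ q N ∧ inner ℝ q D ≤ inner ℝ p D)} := by
    refine convexHull_min (fun q hq => ?_) hconv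
    have h := hp q hq
    rw [Prod.Lex.toLex_le_toLex] at h
    simpa using h
  have htan : ∀ q ∈ polygon X, inner ℝ p N ≤ inner ℝ q N := fun q hq => by
    rcases hsub hq with h | h <;> linarith
  have hlast : ∀ q ∈ polygon X, inner ℝ q N = inner ℝ p N → inner ℝ q D ≤ inner ℝ p D :=
    fun q hq h => by
      rcases hsub hq with h' | h'
      · linarith
      · exact h'.2
  have key : ∀ q : Plane, inner ℝ q N = inner ℝ p N → inner ℝ q D = inner ℝ p D → q = p := by
    intro q h1 h2
    simp only [N, D, leftNormal, direction, PiLp.inner_apply, Fin.sum_univ_two] at h1 h2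
    simp at h1 h2
    have h3 := Real.Angle.cos_sq_add_sin_sq θ
    ext i
    fin_cases i
    · simp only [Fin.zero_eta]
      linear_combination (-θ.sin) * h1 + θ.cos * h2 - (q 0 - p 0) * h3
    · simp only [Fin.mk_one]
      linear_combination θ.cos * h1 + θ.sin * h2 - (q 1 - p 1) * h3
  refine ⟨p, ⟨subset_convexHull ℝ _ hpX, fun x hx y hy hxy => ?_⟩, htan, hlast⟩
  obtain ⟨a, b, ha, hb, hab, rfl⟩ := hxy
  have e1 := htan x hx
  have e2 := htan y hy
  have l1 := hlast x hx
  have l2 := hlast y hy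
  simp only [inner_add_left, real_inner_smul_left] at e1 e2 l1 l2 key
  obtain rfl : b = 1 - a := by linarith
  have hxyN : inner ℝ x N = inner ℝ y N := by nlinarith
  have l1' := l1 (by rw [hxyN]; ring)
  have l2' := l2 (by rw [hxyN]; ring)
  refine key x (by rw [hxyN]; ring) ?_
  nlinarith

open scoped Classical in
/-- The vertex of `Q` which has an oriented tangent line at angle `θ`; for a polygon spanned by a
finite configuration, the value is `none` exactly if the configuration is empty. -/
def supportVertex (Q : Set Plane) (θ : Real.Angle) : Option Plane :=
  if h : ∃ p, IsSupportVertex Q θ p then some h.choose else none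

/-- The random variable `W_K(θ)`. -/
def W {Ω : Type*} (X : Ω → Finset Plane) (θ : Real.Angle) (ω : Ω) : Option Plane :=
  supportVertex (polygon (X ω)) θ

/-- The `σ`-algebra generated by the random variables `W_K(θ)` for `θ ∈ S`; a subset of
`Option Plane` counts as measurable if its part in the plane is Borel. -/
@[reducible] def supportSigmaAlgebra {Ω : Type*} (X : Ω → Finset Plane) (S : Set Real.Angle) :
    MeasurableSpace Ω :=
  ⨆ θ ∈ S, (MeasurableSpace.map (some : Plane → Option Plane) inferInstance).comap (W X θ)

end RandomPolygon

end

/-!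
Let the two intervals of lifts be `[θ₀, θ₁]` and `[ψ₀, ψ₁]`, with `θ₁ < ψ₀` and `ψ₁ < θ₀ + 2π`. The
support vertex at an angle `θ` is the lowest point of the configuration in the direction of the
left normal at `θ`. So if every point outside of a region `S` lies higher than some point of the
configuration in `S`, for each `θ` in the first interval, then the vertices at these angles depend
only on the points in `S`. If the same is true of the second interval and the complement of `S`, up
to an event `bad`, the independence of the Poisson process in disjoint regions gives
`|P(A ∩ B) - P(A) P(B)| ≤ 3 P(bad)` (`abs_measureReal_inter_sub_le`).

Such an `S` is a half-plane. Let `γ` be an angle in the gap `(θ₁, ψ₀)` and `b` a point such that no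
point of the configuration lies to the right of the line at angle `γ` through `b`, but some points
lie in each of the two sectors between this line and the lines through `b` at the angles `θ₁` and
`ψ₀`. If both intervals lie in a half-circle, one such pair is enough: `S` is bounded by the line
through `b` at angle `ψ₁` (`decorrelation_of_one_point`). If they do not, both gaps are used,
and `S` is bounded by the line through the two points (`decorrelation_of_two_points`). As the
configuration is Poisson, the pair fails with exponentially small probability as soon as
the area of `K` to the right of the line is exponentially small and the areas of both sectors are
large.

It remains to find `γ` and `b` if the gap has large affine invariant measure `m`
(`exists_separating_point`). Let `γ` be the median of the measure on the gap, and `b` the midpoint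
of the chord at angle `γ` which cuts off a cap of area `ε = exp (-c m)`. Turn the chord around `b`
by an angle `t`, let `ρ` be the length of the half of it which sweeps over points outside of the
cap, and let `g = (∫ ρ²) / 2` be the area swept so far. The opposite half is at most three times as
long (`neg_third_mem`), so the line at time `t` cuts off an area comparable with `ε + g`. Since the
quotient of the squared length of a chord and the area below it is essentially decreasing in the
height (`areaBelow_mul_width_sq_le`), the chord which has the same direction and cuts off area `1`
has squared length at most a constant times `ρ² (1 / (ε + g) + 1)`, as long as the chord through `b`
cuts off at most half of `K`. The right-hand side is the derivative of a multiple of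
`log (ε + g) + g`. Integration gives `m / 2 ≤ C (log (1 + g / ε) + g) ≤ C (c m + 2 g)`, which forces
`g` to be at least a multiple of `m` (`lintegral_sq_le`). If the chord through `b` comes to cut off
more than half of `K`, then `g` is comparable with the area of `K`, and so is the whole affine
invariant measure of a half-circle, by a weak form of the Rogers-Shephard inequality
(`volume_sub_self_le`).
-/

noncomputable section

namespace RandomPolygon

open Real MeasureTheory ProbabilityTheory Set
open scoped ENNReal

/-! ### Horizontal slices of planar convex bodies -/

/-- The length of the horizontal slice of `M` at height `h`. -/
def width (M : Set (ℝ × ℝ)) (h : ℝ) : ℝ := volume.real {x : ℝ | (x, h) ∈ M}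

/-- The area of the part of `M` at height at most `h`. -/
def areaBelow (M : Set (ℝ × ℝ)) (h : ℝ) : ℝ := volume.real (M ∩ {p | p.2 ≤ h})

lemma width_nonneg (M : Set (ℝ × ℝ)) (h : ℝ) : 0 ≤ width M h := measureReal_nonneg

lemma areaBelow_nonneg (M : Set (ℝ × ℝ)) (h : ℝ) : 0 ≤ areaBelow M h := measureReal_nonneg

lemma isCompact_slice {M : Set (ℝ × ℝ)} (hM : IsCompact M) (h : ℝ) :
    IsCompact {x : ℝ | (x, h) ∈ M} := by
  have : {x : ℝ | (x, h) ∈ M} = Prod.fst '' (M ∩ {p | p.2 = h}) := by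
    ext x
    constructor
    · intro hx
      exact ⟨(x, h), ⟨hx, rfl⟩, rfl⟩
    · rintro ⟨⟨a, b⟩, ⟨hp, hb⟩, rfl⟩
      have : b = h := hb
      subst this
      exact hp
  rw [this]
  exact (hM.inter_right (isClosed_eq continuous_snd continuous_const)).image continuous_fst

lemma exists_slice_eq_Icc {M : Set (ℝ × ℝ)} (hM : IsCompact M) (hc : Convex ℝ M) {h x : ℝ}
    (hx : (x, h) ∈ M) :
    ∃ l r : ℝ, l ≤ r ∧ {x : ℝ | (x, h) ∈ M} = Icc l r ∧ width M h = r - l := by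
  have hK := isCompact_slice hM h
  have hconv : Convex ℝ {x : ℝ | (x, h) ∈ M} := by
    intro a ha b hb s t hs ht hst
    have := hc ha hb hs ht hst
    have e : s • (a, h) + t • (b, h) = (s • a + t • b, h) := by
      ext
      · simp
      · simp only [Prod.smul_mk, Prod.mk_add_mk, smul_eq_mul]
        rw [← add_mul, hst, one_mul]
    rw [e] at this
    exact this
  have hne : {x : ℝ | (x, h) ∈ M}.Nonempty := ⟨x, hx⟩
  have heq := eq_Icc_of_connected_compact ⟨hne, hconv.isPreconnected⟩ hK
  have hle : sInf {x : ℝ | (x, h) ∈ M} ≤ sSup {x : ℝ | (x, h) ∈ M} :=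
    csInf_le_csSup hne hK.bddBelow hK.bddAbove
  refine ⟨_, _, hle, heq, ?_⟩
  rw [width, heq, Real.volume_real_Icc_of_le hle, ← heq]

/-- The width of a convex body is a concave function of the height. -/
lemma width_concave {M : Set (ℝ × ℝ)} (hM : IsCompact M) (hc : Convex ℝ M) {s t u x y : ℝ}
    (hs : (x, s) ∈ M) (hu : (y, u) ∈ M) (hst : s ≤ t) (htu : t ≤ u) :
    (u - t) * width M s + (t - s) * width M u ≤ (u - s) * width M t := by
  rcases hst.eq_or_lt with rfl | hst
  · simp
  have hsu : 0 < u - s := by linarith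
  obtain ⟨l, r, hlr, h1, w1⟩ := exists_slice_eq_Icc hM hc hs
  obtain ⟨l', r', hlr', h2, w2⟩ := exists_slice_eq_Icc hM hc hu
  have key : ∀ a b : ℝ, (a, s) ∈ M → (b, u) ∈ M →
      (((u - t) * a + (t - s) * b) / (u - s), t) ∈ M := by
    intro a b ha hb
    have := hc ha hb (a := (u - t) / (u - s)) (b := (t - s) / (u - s))
      (div_nonneg (by linarith) hsu.le) (div_nonneg (by linarith) hsu.le)
      (by field_simp; ring)
    convert this using 1
    ext
    · simp; field_simp
    · simp; field_simp; ring
  have hl : (l, s) ∈ M := by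
    have : l ∈ Icc l r := ⟨le_rfl, by assumption⟩
    rw [← h1] at this; exact this
  have hr : (r, s) ∈ M := by
    have : r ∈ Icc l r := ⟨by assumption, le_rfl⟩
    rw [← h1] at this; exact this
  have hl' : (l', u) ∈ M := by
    have : l' ∈ Icc l' r' := ⟨le_rfl, by assumption⟩
    rw [← h2] at this; exact this
  have hr' : (r', u) ∈ M := by
    have : r' ∈ Icc l' r' := ⟨by assumption, le_rfl⟩
    rw [← h2] at this; exact this
  obtain ⟨l₀, r₀, -, h3, w3⟩ := exists_slice_eq_Icc hM hc (key _ _ hl hl')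
  have m1 : ((u - t) * l + (t - s) * l') / (u - s) ∈ Icc l₀ r₀ := by
    rw [← h3]; exact key _ _ hl hl'
  have m2 : ((u - t) * r + (t - s) * r') / (u - s) ∈ Icc l₀ r₀ := by
    rw [← h3]; exact key _ _ hr hr'
  have e1 := (le_div_iff₀ hsu).1 m1.1
  have e2 := (div_le_iff₀ hsu).1 m2.2
  rw [w1, w2, w3]
  nlinarith

lemma exists_mem_slice_of_mem {M : Set (ℝ × ℝ)} (hc : Convex ℝ M) {s t u x y : ℝ}
    (hs : (x, s) ∈ M) (hu : (y, u) ∈ M) (hst : s ≤ t) (htu : t ≤ u) : ∃ z, (z, t) ∈ M := by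
  rcases hst.eq_or_lt with rfl | hst
  · exact ⟨x, hs⟩
  have hsu : 0 < u - s := by linarith
  refine ⟨((u - t) * x + (t - s) * y) / (u - s), ?_⟩
  have := hc hs hu (a := (u - t) / (u - s)) (b := (t - s) / (u - s))
      (div_nonneg (by linarith) hsu.le) (div_nonneg (by linarith) hsu.le)
      (by field_simp; ring)
  convert this using 1
  ext
  · simp; field_simp
  · simp; field_simp; ring

lemma volume_eq_lintegral_slice {S : Set (ℝ × ℝ)} (hS : MeasurableSet S) :
    volume S = ∫⁻ h, volume {x : ℝ | (x, h) ∈ S} := by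
  rw [Measure.volume_eq_prod, Measure.prod_apply_symm hS]
  rfl

/-- A planar set of height `w` and width at most `c` has area at most `c * w`. -/
lemma volume_real_le_of_width_le {S : Set (ℝ × ℝ)} (hS : IsCompact S) {c a b : ℝ} (hab : a ≤ b)
    (hc : 0 ≤ c)
    (hsub : ∀ p ∈ S, p.2 ∈ Icc a b) (hw : ∀ h ∈ Icc a b, width S h ≤ c) :
    volume.real S ≤ c * (b - a) := by
  rw [measureReal_def]
  refine ENNReal.toReal_le_of_le_ofReal (mul_nonneg hc (by linarith)) ?_
  rw [volume_eq_lintegral_slice hS.measurableSet]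
  calc ∫⁻ h, volume {x : ℝ | (x, h) ∈ S}
      ≤ ∫⁻ h, (Icc a b).indicator (fun _ => ENNReal.ofReal c) h := by
        refine lintegral_mono fun h => ?_
        by_cases hh : h ∈ Icc a b
        · rw [indicator_of_mem hh]
          have h1 := hw h hh
          rw [width, measureReal_def] at h1
          exact (ENNReal.le_ofReal_iff_toReal_le (isCompact_slice hS h).measure_lt_top.ne hc).2 h1
        · rw [indicator_of_notMem hh]
          have : {x : ℝ | (x, h) ∈ S} = ∅ := by
            ext x
            simp only [mem_ofPred_eq, mem_empty_iff_false, iff_false]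
            exact fun hx => hh (hsub _ hx)
          simp [this]
    _ = ENNReal.ofReal (c * (b - a)) := by
        rw [lintegral_indicator measurableSet_Icc, setLIntegral_const, Real.volume_Icc,
          ENNReal.ofReal_mul hc]

lemma le_volume_real_of_le_width {S : Set (ℝ × ℝ)} (hS : IsCompact S) {c a b : ℝ}
    (hc : 0 ≤ c) (hw : ∀ h ∈ Icc a b, c ≤ width S h) :
    c * (b - a) ≤ volume.real S := by
  rw [measureReal_def, ← ENNReal.ofReal_le_iff_le_toReal hS.measure_lt_top.ne,
    volume_eq_lintegral_slice hS.measurableSet]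
  calc ENNReal.ofReal (c * (b - a)) = ∫⁻ h, (Icc a b).indicator (fun _ => ENNReal.ofReal c) h := by
        rw [lintegral_indicator measurableSet_Icc, setLIntegral_const, Real.volume_Icc,
          ENNReal.ofReal_mul hc]
    _ ≤ _ := by
        refine lintegral_mono fun h => ?_
        by_cases hh : h ∈ Icc a b
        · rw [indicator_of_mem hh]
          have h1 := hw h hh
          rw [width, measureReal_def] at h1
          exact (ENNReal.ofReal_le_iff_le_toReal (isCompact_slice hS h).measure_lt_top.ne).2 h1
        · rw [indicator_of_notMem hh]
          exact zero_le

lemma isCompact_inter_le {M : Set (ℝ × ℝ)} (hM : IsCompact M) (h : ℝ) :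
    IsCompact (M ∩ {p | p.2 ≤ h}) :=
  hM.inter_right (isClosed_le continuous_snd continuous_const)

lemma width_inter_le {M : Set (ℝ × ℝ)} {s h : ℝ} (hs : s ≤ h) :
    width (M ∩ {p | p.2 ≤ h}) s = width M s := by
  unfold width
  congr 1
  ext x
  simp [hs]

lemma areaBelow_mono {M : Set (ℝ × ℝ)} (hM : IsCompact M) {s t : ℝ} (h : s ≤ t) :
    areaBelow M s ≤ areaBelow M t :=
  measureReal_mono (fun _ hp => ⟨hp.1, le_trans hp.2 h⟩) (isCompact_inter_le hM t).measure_lt_top.ne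

/-- Up to a constant, `width² / areaBelow` is a nonincreasing function of the height: it is constant
for an angle, and a convex body spreads at most as fast as an angle. -/
lemma areaBelow_mul_width_sq_le {M : Set (ℝ × ℝ)} (hM : IsCompact M) (hc : Convex ℝ M) {t u : ℝ}
    (htu : t ≤ u) : areaBelow M t * width M u ^ 2 ≤ 8 * width M t ^ 2 * areaBelow M u := by
  have hA := areaBelow_nonneg M t
  have hAA := areaBelow_mono hM htu
  have hw := width_nonneg M t
  have hw' := width_nonneg M u
  by_cases hcase : width M u ≤ 2 * width M t
  · have : width M u ^ 2 ≤ 4 * width M t ^ 2 := by nlinarith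
    nlinarith [mul_le_mul_of_nonneg_left this hA,
      mul_le_mul_of_nonneg_left hAA (sq_nonneg (width M t))]
  push Not at hcase
  have hupos : 0 < width M u := by linarith
  obtain ⟨y, hy⟩ : ∃ y, (y, u) ∈ M := by
    by_contra hne
    push Not at hne
    have : {x : ℝ | (x, u) ∈ M} = ∅ := by ext x; simp [hne x]
    rw [width, this] at hupos
    simp at hupos
  by_cases hne : ∃ p ∈ M, p.2 ≤ t
  swap
  · push Not at hne
    have : M ∩ {p | p.2 ≤ t} = ∅ := by
      ext p
      simp only [mem_inter_iff, mem_ofPred_eq, mem_empty_iff_false, iff_false, not_and, not_le]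
      exact hne p
    have h0 : areaBelow M t = 0 := by rw [areaBelow, this]; simp
    rw [h0, zero_mul]
    have := areaBelow_nonneg M u
    positivity
  obtain ⟨⟨x, s⟩, hxs, hst⟩ := hne
  have htu' : t < u := by
    rcases htu.eq_or_lt with rfl | h
    · linarith
    · exact h
  obtain ⟨z, hz⟩ := exists_mem_slice_of_mem hc hxs hy hst htu
  have hd : 0 < width M u - width M t := by linarith
  -- As the widths at the heights `t` and `u` differ by a factor of two or more, concavity of the
  -- width makes the body below height `t` so short that it lies in a small rectangle.
  have low : ∀ s ≤ t, ∀ x, (x, s) ∈ M →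
      width M s ≤ width M t ∧ (t - s) * width M u ≤ 2 * (u - t) * width M t := by
    intro s hs x hx
    have h := width_concave hM hc hx hy hs htu
    have h1 : 0 ≤ (t - s) * (width M u - width M t) := mul_nonneg (by linarith) hd.le
    have h2 : (t - s) * (width M u - width M t) ≤ (u - t) * (width M t - width M s) := by
      nlinarith
    have h3 : 0 ≤ width M t - width M s := by
      by_contra hneg
      push Not at hneg
      nlinarith [mul_pos (sub_pos.2 htu') (neg_pos.2 hneg)]
    refine ⟨by linarith, ?_⟩
    have h4 : (u - t) * (width M t - width M s) ≤ (u - t) * width M t :=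
      mul_le_mul_of_nonneg_left (by linarith [width_nonneg M s]) (by linarith)
    nlinarith
  set r := 2 * (u - t) * width M t / width M u with hr
  have hr0 : 0 ≤ r := by
    have : 0 ≤ u - t := by linarith
    positivity
  have a1 : areaBelow M t ≤ width M t * (t - (t - r)) := by
    refine volume_real_le_of_width_le (isCompact_inter_le hM t) (by linarith) hw ?_ ?_
    · rintro ⟨x, s⟩ ⟨hx, hs⟩
      have := (low s hs x hx).2
      rw [← le_div_iff₀ hupos] at this
      exact ⟨by linarith, hs⟩
    · intro h hh
      rw [width_inter_le hh.2]
      by_cases hx : ∃ x, (x, h) ∈ M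
      · obtain ⟨x, hx⟩ := hx
        exact (low h hh.2 x hx).1
      · push Not at hx
        have : {x : ℝ | (x, h) ∈ M} = ∅ := by ext x; simp [hx x]
        rw [width, this]
        simpa using hw
  have a2 : width M u / 2 * (u - (t + u) / 2) ≤ areaBelow M u := by
    refine le_volume_real_of_le_width (isCompact_inter_le hM u) (by linarith) ?_
    intro h hh
    rw [width_inter_le hh.2]
    have := width_concave hM hc hz hy (by linarith [hh.1]) hh.2
    have h1 : 0 ≤ (u - h) * width M t := mul_nonneg (by linarith [hh.2]) hw
    have h2 : (u - t) / 2 * width M u ≤ (h - t) * width M u :=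
      mul_le_mul_of_nonneg_right (by linarith [hh.1]) hupos.le
    have h3 : (u - t) * (width M u / 2) ≤ (u - t) * width M h := by linarith
    exact le_of_mul_le_mul_left h3 (by linarith)
  have e1 : areaBelow M t * width M u ^ 2 ≤ 2 * (u - t) * width M t ^ 2 * width M u := by
    have h1 : t - (t - r) = r := by ring
    rw [h1] at a1
    have h2 : width M t * r * width M u ^ 2 = 2 * (u - t) * width M t ^ 2 * width M u := by
      rw [hr]; field_simp
    rw [← h2]
    exact mul_le_mul_of_nonneg_right a1 (sq_nonneg _)
  nlinarith [mul_le_mul_of_nonneg_left a2 (sq_nonneg (width M t))]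

/-! ### Isometries and polar coordinates of the plane -/

/-- The linear map of `ℝ × ℝ` with matrix `!![a, b; c, d]`. -/
def planeMap (a b c d : ℝ) (p : ℝ × ℝ) : ℝ × ℝ := (a * p.1 + b * p.2, c * p.1 + d * p.2)

lemma continuous_planeMap (a b c d : ℝ) : Continuous (planeMap a b c d) := by
  unfold planeMap; fun_prop

lemma measurePreserving_planeMap {a b c d : ℝ} (h : |a * d - b * c| = 1) :
    MeasurePreserving (planeMap a b c d) := by
  refine ⟨(continuous_planeMap a b c d).measurable, ?_⟩
  have e : planeMap a b c d =
      Matrix.toLin (.finTwoProd ℝ) (.finTwoProd ℝ) !![a, b; c, d] := by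
    ext p <;> simp [planeMap]
  have hdet : LinearMap.det (Matrix.toLin (.finTwoProd ℝ) (.finTwoProd ℝ) !![a, b; c, d]) =
      a * d - b * c := by
    rw [LinearMap.det_toLin, Matrix.det_fin_two_of]
  rw [e, Measure.map_linearMap_addHaar_eq_smul_addHaar, hdet, abs_inv, h]
  · simp
  · rw [hdet]
    intro h0
    rw [h0] at h
    simp at h

lemma volume_real_preimage_planeMap {a b c d : ℝ} (h : |a * d - b * c| = 1) {S : Set (ℝ × ℝ)}
    (hS : MeasurableSet S) : volume.real (planeMap a b c d ⁻¹' S) = volume.real S := by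
  rw [measureReal_def, (measurePreserving_planeMap h).measure_preimage hS.nullMeasurableSet,
    measureReal_def]

lemma convex_preimage_planeMap {M : Set (ℝ × ℝ)} (hM : Convex ℝ M) (a b c d : ℝ) :
    Convex ℝ (planeMap a b c d ⁻¹' M) := by
  intro x hx y hy s t hs ht hst
  have := hM hx hy hs ht hst
  rw [mem_preimage]
  convert this using 1
  ext <;> simp [planeMap] <;> ring

lemma isCompact_preimage_planeMap {M : Set (ℝ × ℝ)} (hM : IsCompact M) {a b c d : ℝ}
    (h : a * d - b * c ≠ 0) : IsCompact (planeMap a b c d ⁻¹' M) := by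
  set D := a * d - b * c
  have : planeMap a b c d ⁻¹' M = planeMap (d / D) (-b / D) (-c / D) (a / D) '' M := by
    ext p
    constructor
    · intro hp
      refine ⟨_, hp, ?_⟩
      ext <;> simp only [planeMap] <;> field_simp <;> simp only [D] <;> ring
    · rintro ⟨q, hq, rfl⟩
      rw [mem_preimage]
      convert hq
      ext <;> simp only [planeMap] <;> field_simp <;> simp only [D] <;> ring
  rw [this]
  exact hM.image (continuous_planeMap _ _ _ _)

lemma volume_real_horizontal_line {M : Set (ℝ × ℝ)} (hM : IsCompact M) (h : ℝ) :
    volume.real (M ∩ {p | p.2 = h}) = 0 := by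
  refine le_antisymm ?_ measureReal_nonneg
  have := volume_real_le_of_width_le (c := width M h) (a := h) (b := h)
    (hM.inter_right (isClosed_eq continuous_snd continuous_const)) le_rfl (width_nonneg _ _)
    (S := M ∩ {p | p.2 = h}) (fun p hp => by simpa using hp.2) ?_
  · simpa using this
  · intro s hs
    obtain rfl : s = h := le_antisymm hs.2 hs.1
    apply le_of_eq
    unfold width
    congr 1
    ext x
    simp

lemma volume_real_inter_ge {M : Set (ℝ × ℝ)} (hM : IsCompact M) (h : ℝ) :
    volume.real (M ∩ {p | h ≤ p.2}) = volume.real M - areaBelow M h := by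
  have hfin := hM.measure_lt_top (μ := volume)
  have hclosed : IsClosed {p : ℝ × ℝ | p.2 ≤ h} := isClosed_le continuous_snd continuous_const
  have h1 := measureReal_inter_add_sdiff (μ := volume) (s := M) hclosed.measurableSet hfin.ne
  have h2 : volume.real (M ∩ {p | h ≤ p.2}) = volume.real (M \ {p | p.2 ≤ h}) := by
    apply le_antisymm
    · have hsub : M ∩ {p | h ≤ p.2} ⊆ (M \ {p | p.2 ≤ h}) ∪ (M ∩ {p | p.2 = h}) := by
        intro p hp
        rcases (show h ≤ p.2 from hp.2).eq_or_lt with e | e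
        · exact Or.inr ⟨hp.1, e.symm⟩
        · exact Or.inl ⟨hp.1, not_le.2 e⟩
      have hfin' : volume ((M \ {p | p.2 ≤ h}) ∪ (M ∩ {p | p.2 = h})) ≠ ∞ :=
        ((measure_mono (union_subset sdiff_subset inter_subset_left)).trans_lt hfin).ne
      refine (measureReal_mono hsub hfin').trans ((measureReal_union_le _ _).trans ?_)
      rw [volume_real_horizontal_line hM, add_zero]
    · refine measureReal_mono (fun p hp => ⟨hp.1, (not_le.1 (show ¬ p.2 ≤ h from hp.2)).le⟩) ?_
      exact ((measure_mono inter_subset_left).trans_lt hfin).ne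
  rw [h2, ← h1, areaBelow]
  ring

/-- The mirror image of `areaBelow_mul_width_sq_le`. -/
lemma areaAbove_mul_width_sq_le {M : Set (ℝ × ℝ)} (hM : IsCompact M) (hc : Convex ℝ M) {s t : ℝ}
    (hst : s ≤ t) : (volume.real M - areaBelow M t) * width M s ^ 2 ≤
      8 * width M t ^ 2 * (volume.real M - areaBelow M s) := by
  have hw : ∀ h, width (planeMap 1 0 0 (-1) ⁻¹' M) (-h) = width M h := by
    intro h
    unfold width
    congr 1
    ext x
    simp [planeMap]
  have ha : ∀ h, areaBelow (planeMap 1 0 0 (-1) ⁻¹' M) (-h) = volume.real M - areaBelow M h := by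
    intro h
    rw [← volume_real_inter_ge hM, areaBelow]
    have hcl : IsClosed {p : ℝ × ℝ | h ≤ p.2} := isClosed_le continuous_const continuous_snd
    rw [← volume_real_preimage_planeMap (a := 1) (b := 0) (c := 0) (d := -1) (by simp)
      (hM.measurableSet.inter hcl.measurableSet)]
    congr 1
    ext p
    simp [planeMap]
    intro _
    constructor <;> intro h' <;> linarith
  have := areaBelow_mul_width_sq_le
    (isCompact_preimage_planeMap hM (a := 1) (b := 0) (c := 0) (d := -1) (by simp))
    (convex_preimage_planeMap hc 1 0 0 (-1)) (neg_le_neg hst)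
  simpa only [hw, ha] using this

/-- The radial function of a planar convex body `L` around the origin, as a function of the
angle. -/
def radial (L : Set (ℝ × ℝ)) (t : ℝ) : ℝ := (gauge L (cos t, sin t))⁻¹

lemma cos_sin_ne_zero (t : ℝ) : ((cos t, sin t) : ℝ × ℝ) ≠ 0 := by
  intro h
  have h1 : cos t = 0 := congrArg Prod.fst h
  have h2 : sin t = 0 := congrArg Prod.snd h
  have := sin_sq_add_cos_sq t
  rw [h1, h2] at this
  norm_num at this

section radial

variable {L : Set (ℝ × ℝ)} (hL : IsCompact L) (hc : Convex ℝ L) (h0 : (0 : ℝ × ℝ) ∈ interior L)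

include hL h0

lemma gauge_cos_sin_pos (t : ℝ) : 0 < gauge L (cos t, sin t) :=
  (gauge_pos (absorbent_nhds_zero (mem_interior_iff_mem_nhds.1 h0))
    ((NormedSpace.isVonNBounded_iff ℝ).2 hL.isBounded)).2 (cos_sin_ne_zero t)

lemma radial_pos (t : ℝ) : 0 < radial L t := inv_pos.2 (gauge_cos_sin_pos hL h0 t)

include hc

lemma continuous_radial : Continuous (radial L) := by
  have := continuous_gauge hc (mem_interior_iff_mem_nhds.1 h0)
  exact (this.comp (by fun_prop : Continuous fun t : ℝ => (cos t, sin t))).inv₀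
    fun t => (gauge_cos_sin_pos hL h0 t).ne'

lemma polar_mem_iff {r : ℝ} (hr : 0 ≤ r) (t : ℝ) :
    (r * cos t, r * sin t) ∈ L ↔ r ≤ radial L t := by
  have h := gauge_le_one_iff_mem_closure (x := (r * cos t, r * sin t)) hc
    (mem_interior_iff_mem_nhds.1 h0)
  rw [hL.isClosed.closure_eq] at h
  have e : ((r * cos t, r * sin t) : ℝ × ℝ) = r • (cos t, sin t) := rfl
  rw [← h, e, gauge_smul_of_nonneg hr, smul_eq_mul, radial, ← one_div,
    le_div_iff₀ (gauge_cos_sin_pos hL h0 t)]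

/-- The area of a sector of a convex body in polar coordinates. The set `C` is the cone over the
set `J` of angles. -/
lemma volume_inter_sector {C : Set (ℝ × ℝ)} {J : Set ℝ} (hC : MeasurableSet C)
    (hJ : J ⊆ Ioo (-π) π) (hJm : MeasurableSet J)
    (h : ∀ r > 0, ∀ φ ∈ Ioo (-π) π, (r * cos φ, r * sin φ) ∈ C ↔ φ ∈ J) :
    volume (L ∩ C) = ∫⁻ φ in J, ENNReal.ofReal (radial L φ ^ 2 / 2) := by
  have hLC : MeasurableSet (L ∩ C) := hL.measurableSet.inter hC
  rw [← lintegral_indicator_one hLC, ← lintegral_comp_polarCoord_symm]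
  have htarget : polarCoord.target = Ioi (0 : ℝ) ×ˢ Ioo (-π) π := rfl
  have hmeas : Measurable fun p : ℝ × ℝ =>
      ENNReal.ofReal p.1 • (L ∩ C).indicator (1 : ℝ × ℝ → ℝ≥0∞) (polarCoord.symm p) := by
    exact (ENNReal.measurable_ofReal.comp measurable_fst).smul
      ((measurable_one.indicator hLC).comp continuous_polarCoord_symm.measurable)
  rw [htarget, Measure.volume_eq_prod, ← Measure.prod_restrict, lintegral_prod_symm' _ hmeas]
  have hinner : ∀ φ ∈ Ioo (-π) π, ∫⁻ r in Ioi (0 : ℝ),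
      ENNReal.ofReal r • (L ∩ C).indicator (1 : ℝ × ℝ → ℝ≥0∞) (polarCoord.symm (r, φ)) =
      J.indicator (fun φ => ENNReal.ofReal (radial L φ ^ 2 / 2)) φ := by
    intro φ hφ
    have hρ := radial_pos hL h0 φ
    by_cases hφJ : φ ∈ J
    · rw [indicator_of_mem hφJ]
      have e : ∀ r ∈ Ioi (0 : ℝ),
          ENNReal.ofReal r • (L ∩ C).indicator (1 : ℝ × ℝ → ℝ≥0∞) (polarCoord.symm (r, φ)) =
          (Iic (radial L φ)).indicator (fun r => ENNReal.ofReal r) r := by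
        intro r hr
        have hmem : polarCoord.symm (r, φ) ∈ L ∩ C ↔ r ∈ Iic (radial L φ) := by
          rw [polarCoord_symm_apply]
          simp only [mem_inter_iff, polar_mem_iff hL hc h0 (le_of_lt hr), h r hr φ hφ, hφJ,
            and_true, mem_Iic]
        by_cases hm : r ∈ Iic (radial L φ)
        · rw [indicator_of_mem hm, indicator_of_mem (hmem.2 hm)]
          simp
        · rw [indicator_of_notMem hm, indicator_of_notMem (fun h' => hm (hmem.1 h'))]
          simp
      rw [setLIntegral_congr_fun measurableSet_Ioi e, lintegral_indicator measurableSet_Iic,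
        Measure.restrict_restrict measurableSet_Iic]
      have : Iic (radial L φ) ∩ Ioi 0 = Ioc 0 (radial L φ) := by
        ext; simp [and_comm]
      rw [this, ← ofReal_integral_eq_lintegral_ofReal]
      · rw [← intervalIntegral.integral_of_le hρ.le, integral_id]
        simp
      · exact (continuous_id.integrableOn_Icc (a := 0) (b := radial L φ)).mono_set
          Ioc_subset_Icc_self
      · refine (ae_restrict_iff' measurableSet_Ioc).2 (Filter.Eventually.of_forall fun r hr => ?_)
        exact hr.1.le
    · rw [indicator_of_notMem hφJ]
      have e : ∀ r ∈ Ioi (0 : ℝ),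
          ENNReal.ofReal r • (L ∩ C).indicator (1 : ℝ × ℝ → ℝ≥0∞) (polarCoord.symm (r, φ)) = 0 := by
        intro r hr
        rw [indicator_of_notMem]
        · simp
        · rw [polarCoord_symm_apply]
          exact fun h' => hφJ ((h r hr φ hφ).1 h'.2)
      rw [setLIntegral_congr_fun measurableSet_Ioi e]
      simp
  rw [setLIntegral_congr_fun measurableSet_Ioo hinner, lintegral_indicator hJm,
    Measure.restrict_restrict hJm, inter_eq_self_of_subset_left hJ]

lemma volume_real_inter_sector {C : Set (ℝ × ℝ)} {J : Set ℝ} {α β : ℝ} (hC : MeasurableSet C)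
    (hαβ : α ≤ β) (hJ : J = Ioc α β ∨ J = Ioo α β) (hsub : J ⊆ Ioo (-π) π)
    (h : ∀ r > 0, ∀ φ ∈ Ioo (-π) π, (r * cos φ, r * sin φ) ∈ C ↔ φ ∈ J) :
    volume.real (L ∩ C) = (∫ φ in α..β, radial L φ ^ 2) / 2 := by
  have hJm : MeasurableSet J := by
    rcases hJ with rfl | rfl
    · exact measurableSet_Ioc
    · exact measurableSet_Ioo
  have hcont := continuous_radial hL hc h0
  rw [measureReal_def, volume_inter_sector hL hc h0 hC hsub hJm h]
  have e : ∫⁻ φ in J, ENNReal.ofReal (radial L φ ^ 2 / 2) =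
      ∫⁻ φ in Ioc α β, ENNReal.ofReal (radial L φ ^ 2 / 2) := by
    rcases hJ with rfl | rfl
    · rfl
    · exact setLIntegral_congr Ioo_ae_eq_Ioc
  rw [e, ← ofReal_integral_eq_lintegral_ofReal, ← intervalIntegral.integral_of_le hαβ,
    intervalIntegral.integral_div, ENNReal.toReal_ofReal]
  · exact div_nonneg (intervalIntegral.integral_nonneg hαβ fun _ _ => sq_nonneg _) (by norm_num)
  · exact (((hcont.pow 2).div_const 2).integrableOn_Icc (a := α) (b := β)).mono_set
      Ioc_subset_Icc_self
  · exact Filter.Eventually.of_forall fun φ => by positivity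

end radial

/-! ### Rotating a chord around its midpoint -/

/-- Counterclockwise rotation of the plane by the angle `t`. -/
def rot (t : ℝ) : ℝ × ℝ → ℝ × ℝ := planeMap (cos t) (-sin t) (sin t) (cos t)

lemma rot_det (t : ℝ) : cos t * cos t - -sin t * sin t = 1 := by
  nlinarith [sin_sq_add_cos_sq t]

lemma isCompact_preimage_rot {L : Set (ℝ × ℝ)} (hL : IsCompact L) (t : ℝ) :
    IsCompact (rot t ⁻¹' L) :=
  isCompact_preimage_planeMap hL (by rw [rot_det]; norm_num)

lemma convex_preimage_rot {L : Set (ℝ × ℝ)} (hc : Convex ℝ L) (t : ℝ) :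
    Convex ℝ (rot t ⁻¹' L) := convex_preimage_planeMap hc _ _ _ _

lemma volume_real_preimage_rot {S : Set (ℝ × ℝ)} (hS : MeasurableSet S) (t : ℝ) :
    volume.real (rot t ⁻¹' S) = volume.real S :=
  volume_real_preimage_planeMap (by rw [rot_det]; norm_num) hS

lemma measurableSet_halfSpace_le (t h : ℝ) :
    MeasurableSet {p : ℝ × ℝ | -sin t * p.1 + cos t * p.2 ≤ h} :=
  (isClosed_le (by fun_prop) continuous_const).measurableSet

lemma measurableSet_halfSpace_lt (t h : ℝ) :
    MeasurableSet {p : ℝ × ℝ | -sin t * p.1 + cos t * p.2 < h} :=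
  (isOpen_lt (by fun_prop) continuous_const).measurableSet

lemma areaBelow_preimage_rot {L : Set (ℝ × ℝ)} (hL : IsCompact L) (t h : ℝ) :
    areaBelow (rot t ⁻¹' L) h = volume.real (L ∩ {p | -sin t * p.1 + cos t * p.2 ≤ h}) := by
  rw [← volume_real_preimage_rot (hL.measurableSet.inter (measurableSet_halfSpace_le t h)) t,
    areaBelow]
  congr 1
  ext p
  have : -sin t * (cos t * p.1 + -sin t * p.2) + cos t * (sin t * p.1 + cos t * p.2) = p.2 := by
    linear_combination p.2 * sin_sq_add_cos_sq t
  simp only [mem_inter_iff, mem_preimage, mem_ofPred_eq, rot, planeMap, this]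

section chord

variable {L : Set (ℝ × ℝ)} (hL : IsCompact L) (hc : Convex ℝ L) (h0 : (0 : ℝ × ℝ) ∈ interior L)

include hL hc h0

/-- The area of the sector of `L` swept by the rays with angles in `[0, t]`. -/
lemma volume_real_sector_le {t : ℝ} (ht : 0 < t) (htπ : t < π) :
    volume.real (L ∩ {p | 0 < p.2 ∧ -sin t * p.1 + cos t * p.2 ≤ 0}) =
      (∫ φ in 0..t, radial L φ ^ 2) / 2 := by
  refine volume_real_inter_sector hL hc h0 ?_ ht.le (Or.inl rfl) ?_ ?_
  · exact (isOpen_lt continuous_const continuous_snd).measurableSet.inter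
      (measurableSet_halfSpace_le t 0)
  · exact fun φ hφ => ⟨by linarith [hφ.1, pi_pos], by linarith [hφ.2]⟩
  · intro r hr φ hφ
    have e : -sin t * (r * cos φ) + cos t * (r * sin φ) = r * sin (φ - t) := by
      rw [sin_sub]; ring
    simp only [mem_ofPred_eq, e, mem_Ioc]
    constructor
    · rintro ⟨h1, h2⟩
      have h1' : 0 < sin φ := pos_of_mul_pos_right h1 hr.le
      have h2' : sin (φ - t) ≤ 0 := by
        by_contra hcon
        push Not at hcon
        linarith [mul_pos hr hcon]
      have hφ0 : 0 < φ := by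
        by_contra hcon
        push Not at hcon
        linarith [sin_nonpos_of_nonpos_of_neg_pi_le hcon hφ.1.le]
      refine ⟨hφ0, ?_⟩
      by_contra hcon
      push Not at hcon
      linarith [sin_pos_of_pos_of_lt_pi (x := φ - t) (by linarith) (by linarith [hφ.2])]
    · rintro ⟨h1, h2⟩
      refine ⟨mul_pos hr (sin_pos_of_pos_of_lt_pi h1 hφ.2), ?_⟩
      exact mul_nonpos_of_nonneg_of_nonpos hr.le
        (sin_nonpos_of_nonpos_of_neg_pi_le (by linarith) (by linarith))

lemma volume_real_sector_lt {t : ℝ} (ht : 0 < t) (htπ : t ≤ π) :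
    volume.real (L ∩ {p | 0 < p.2 ∧ -sin t * p.1 + cos t * p.2 < 0}) =
      (∫ φ in 0..t, radial L φ ^ 2) / 2 := by
  refine volume_real_inter_sector hL hc h0 ?_ ht.le (Or.inr rfl) ?_ ?_
  · exact (isOpen_lt continuous_const continuous_snd).measurableSet.inter
      (measurableSet_halfSpace_lt t 0)
  · exact fun φ hφ => ⟨by linarith [hφ.1, pi_pos], by linarith [hφ.2]⟩
  · intro r hr φ hφ
    have e : -sin t * (r * cos φ) + cos t * (r * sin φ) = r * sin (φ - t) := by
      rw [sin_sub]; ring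
    simp only [mem_ofPred_eq, e, mem_Ioo]
    constructor
    · rintro ⟨h1, h2⟩
      have h1' : 0 < sin φ := pos_of_mul_pos_right h1 hr.le
      have h2' : sin (φ - t) < 0 := by
        by_contra hcon
        push Not at hcon
        linarith [mul_nonneg hr.le hcon]
      have hφ0 : 0 < φ := by
        by_contra hcon
        push Not at hcon
        linarith [sin_nonpos_of_nonpos_of_neg_pi_le hcon hφ.1.le]
      refine ⟨hφ0, ?_⟩
      by_contra hcon
      push Not at hcon
      linarith [sin_nonneg_of_nonneg_of_le_pi (x := φ - t) (by linarith) (by linarith [hφ.2])]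
    · rintro ⟨h1, h2⟩
      refine ⟨mul_pos hr (sin_pos_of_pos_of_lt_pi h1 hφ.2), ?_⟩
      exact mul_neg_of_pos_of_neg hr
        (sin_neg_of_neg_of_neg_pi_lt (by linarith) (by linarith))

/-- The area of the opposite sector, swept by the rays with angles in `[-π, t - π]`. -/
lemma volume_real_opposite_sector {t : ℝ} (ht : 0 < t) (htπ : t < π) :
    volume.real (L ∩ {p | p.2 ≤ 0 ∧ 0 < -sin t * p.1 + cos t * p.2}) =
      (∫ φ in 0..t, radial L (φ - π) ^ 2) / 2 := by
  rw [intervalIntegral.integral_comp_sub_right (fun φ => radial L φ ^ 2) π, zero_sub]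
  refine volume_real_inter_sector hL hc h0 ?_ (by linarith) (Or.inr rfl) ?_ ?_
  · refine (isClosed_le continuous_snd continuous_const).measurableSet.inter
      (isOpen_lt continuous_const (by fun_prop :
        Continuous fun p : ℝ × ℝ => -sin t * p.1 + cos t * p.2)).measurableSet
  · exact fun φ hφ => ⟨by linarith [hφ.1], by linarith [hφ.2]⟩
  · intro r hr φ hφ
    have e : -sin t * (r * cos φ) + cos t * (r * sin φ) = r * sin (φ - t) := by
      rw [sin_sub]; ring
    simp only [mem_ofPred_eq, e, mem_Ioo]
    constructor
    · rintro ⟨h1, h2⟩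
      have h2' : 0 < sin (φ - t) := pos_of_mul_pos_right h2 hr.le
      have h1' : sin φ ≤ 0 := by
        by_contra hcon
        push Not at hcon
        linarith [mul_pos hr hcon]
      have hφ0 : φ ≤ 0 := by
        by_contra hcon
        push Not at hcon
        linarith [sin_pos_of_pos_of_lt_pi hcon hφ.2]
      refine ⟨hφ.1, ?_⟩
      by_contra hcon
      push Not at hcon
      linarith [sin_nonpos_of_nonpos_of_neg_pi_le (x := φ - t) (by linarith) (by linarith)]
    · rintro ⟨h1, h2⟩
      refine ⟨mul_nonpos_of_nonneg_of_nonpos hr.le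
        (sin_nonpos_of_nonpos_of_neg_pi_le (by linarith) h1.le), ?_⟩
      have : sin (φ - t + 2 * π) = sin (φ - t) := sin_add_two_pi _
      rw [← this]
      exact mul_pos hr (sin_pos_of_pos_of_lt_pi (by linarith) (by linarith))

/-- The length of the chord of `L` through the origin at angle `t`. -/
lemma width_preimage_rot_zero (t : ℝ) :
    width (rot t ⁻¹' L) 0 = radial L t + radial L (t - π) := by
  have h1 := radial_pos hL h0 t
  have h2 := radial_pos hL h0 (t - π)
  have : {x : ℝ | (x, (0 : ℝ)) ∈ rot t ⁻¹' L} = Icc (-radial L (t - π)) (radial L t) := by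
    ext x
    have e : rot t (x, 0) = (x * cos t, x * sin t) := by
      ext <;> simp [rot, planeMap, mul_comm]
    simp only [mem_ofPred_eq, mem_preimage, e, mem_Icc]
    rcases le_total 0 x with hx | hx
    · rw [polar_mem_iff hL hc h0 hx]
      exact ⟨fun h => ⟨by linarith, h⟩, fun h => h.2⟩
    · have e' : ((x * cos t, x * sin t) : ℝ × ℝ) = (-x * cos (t - π), -x * sin (t - π)) := by
        rw [cos_sub_pi, sin_sub_pi]; simp
      rw [e', polar_mem_iff hL hc h0 (by linarith : 0 ≤ -x)]
      exact ⟨fun h => ⟨by linarith, by linarith⟩, fun h => by linarith [h.1]⟩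
  rw [width, this, Real.volume_real_Icc_of_le (by linarith)]
  ring

end chord

/-- Let `[-c, c] × {0}` be a chord of `L` which cuts off a small part below. If a point below the
chord belongs to `L`, then so does its image under the homothety with centre at the midpoint `0` of
the chord and ratio `-1/3`: the body continues above the chord, almost as wide as it is there. -/
lemma neg_third_mem {L : Set (ℝ × ℝ)} (hL : IsCompact L) (hc : Convex ℝ L) {c : ℝ} (hcpos : 0 < c)
    (hslice : {x : ℝ | (x, (0 : ℝ)) ∈ L} = Icc (-c) c)
    (hsmall : 9 * areaBelow L 0 < volume.real L) {x y : ℝ} (hy : 0 ≤ y) (hp : (x, -y) ∈ L) :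
    (-x / 3, y / 3) ∈ L := by
  have hsl : ∀ x, (x, (0 : ℝ)) ∈ L ↔ -c ≤ x ∧ x ≤ c := fun x => by
    rw [← mem_Icc, ← hslice]; rfl
  rcases hy.eq_or_lt with rfl | hy
  · rw [neg_zero, hsl] at hp
    rw [zero_div, hsl]
    constructor <;> linarith [hp.1, hp.2]
  have hw0 : width L 0 = 2 * c := by
    rw [width, hslice, Real.volume_real_Icc_of_le (by linarith)]; ring
  have hu : (-c, (0 : ℝ)) ∈ L := (hsl _).2 ⟨le_rfl, by linarith⟩
  have hv : (c, (0 : ℝ)) ∈ L := (hsl _).2 ⟨by linarith, le_rfl⟩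
  -- Otherwise the part above the chord would be too small.
  obtain ⟨z, w, hz, hyw⟩ : ∃ z w, (z, w) ∈ L ∧ y ≤ w := by
    by_contra hcon
    push Not at hcon
    have hbelow : c * (0 - -(y / 2)) ≤ areaBelow L 0 := by
      refine le_volume_real_of_le_width (isCompact_inter_le hL 0) hcpos.le ?_
      intro h hh
      rw [width_inter_le hh.2]
      have := width_concave hL hc hp hv (by linarith [hh.1]) hh.2
      rw [hw0] at this
      have h1 : 0 ≤ (0 - h) * width L (-y) := mul_nonneg (by linarith [hh.2]) (width_nonneg _ _)
      have h2 : y * c ≤ (h - -y) * (2 * c) := by nlinarith [hh.1]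
      have h3 : y * c ≤ y * width L h := by linarith
      exact le_of_mul_le_mul_left h3 hy
    have habove : volume.real (L ∩ {p | 0 ≤ p.2}) ≤ 4 * c * (y - 0) := by
      refine volume_real_le_of_width_le
        (hL.inter_right (isClosed_le continuous_const continuous_snd)) hy.le (by linarith) ?_ ?_
      · rintro ⟨a, b⟩ ⟨hab, hb⟩
        exact ⟨hb, (hcon a b hab).le⟩
      · intro h hh
        have e : width (L ∩ {p | 0 ≤ p.2}) h = width L h := by
          unfold width; congr 1; ext x; simp [hh.1]
        rw [e]
        by_cases hne : ∃ x, (x, h) ∈ L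
        · obtain ⟨x', hx'⟩ := hne
          have := width_concave hL hc hp hx' (t := 0) (by linarith) hh.1
          rw [hw0] at this
          have h1 : 0 ≤ (h - 0) * width L (-y) := mul_nonneg (by linarith [hh.1]) (width_nonneg _ _)
          have h2 : (h - -y) * (2 * c) ≤ y * (4 * c) := by nlinarith [hh.2]
          have h3 : y * width L h ≤ y * (4 * c) := by linarith
          exact le_of_mul_le_mul_left h3 hy
        · push Not at hne
          have : {x : ℝ | (x, h) ∈ L} = ∅ := by ext x; simp [hne x]
          rw [width, this]
          simp; linarith
    rw [volume_real_inter_ge hL] at habove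
    linarith
  have hw : 0 < w := by linarith
  -- The segment between the two points crosses the chord.
  have hcross : ((w * x + y * z) / (y + w), (0 : ℝ)) ∈ L := by
    have := hc hp hz (a := w / (y + w)) (b := y / (y + w)) (by positivity) (by positivity)
      (by field_simp; ring)
    convert this using 1
    ext
    · simp; field_simp
    · simp; field_simp; ring
  rw [hsl, le_div_iff₀ (by linarith), div_le_iff₀ (by linarith)] at hcross
  obtain ⟨hz1, hz2⟩ := hcross
  -- The image lies in the triangle spanned by the chord and the point `(z, w)`.
  set μ := y / (3 * w) with hμ
  have hμ0 : 0 ≤ μ := by positivity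
  have hμw : μ * w = y / 3 := by rw [hμ]; field_simp
  have hμ1 : μ ≤ 1 / 3 := by rw [hμ, div_le_iff₀ (by positivity)]; linarith
  have hμz1 : -c * (μ + 1 / 3) ≤ x / 3 + μ * z := by
    rw [hμ]
    have : x / 3 + y / (3 * w) * z = (w * x + y * z) / (3 * w) := by field_simp
    rw [this, le_div_iff₀ (by positivity)]
    have : -c * (y / (3 * w) + 1 / 3) * (3 * w) = -c * (y + w) := by field_simp
    linarith
  have hμz2 : x / 3 + μ * z ≤ c * (μ + 1 / 3) := by
    rw [hμ]
    have : x / 3 + y / (3 * w) * z = (w * x + y * z) / (3 * w) := by field_simp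
    rw [this, div_le_iff₀ (by positivity)]
    have : c * (y / (3 * w) + 1 / 3) * (3 * w) = c * (y + w) := by field_simp
    linarith
  set q := (-x / 3 - μ * z) / (1 - μ) with hq
  have hqmem : (q, (0 : ℝ)) ∈ L := by
    rw [hsl, hq, le_div_iff₀ (by linarith), div_le_iff₀ (by linarith)]
    constructor <;> nlinarith
  have := hc hqmem hz (a := 1 - μ) (b := μ) (by linarith) hμ0 (by ring)
  convert this using 1
  have h1μ : (1 - μ) ≠ 0 := by linarith
  ext
  · simp [hq]; field_simp; ring
  · simp [hμw]

/-! ### The difference body and the area swept by a rotating chord -/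

section

open scoped Pointwise

/-- A weak form of the Rogers-Shephard inequality, whose optimal constant for planar bodies is `6`.
Integrate over `x` the area of the overlap of `L` and its translate by `x`: for `x` in half of the
difference body, the overlap contains a homothetic copy of `L` with ratio `1 / 2`. -/
lemma volume_sub_self_le {L : Set (ℝ × ℝ)} (hL : IsCompact L) (hc : Convex ℝ L)
    (hpos : 0 < volume.real L) : volume.real (L - L) ≤ 16 * volume.real L := by
  have hLm := hL.measurableSet
  have hDc : IsCompact (L - L) := by
    rw [sub_eq_add_neg]; exact hL.add hL.neg
  set V := volume L
  have hV : V ≠ ∞ := hL.measure_lt_top.ne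
  have hhalf : ∀ S : Set (ℝ × ℝ), volume ((2⁻¹ : ℝ) • S) = 4⁻¹ * volume S := by
    intro S
    rw [Measure.addHaar_smul]
    congr 1
    simp only [Module.finrank_prod, Module.finrank_self]
    rw [abs_of_nonneg (by positivity)]
    norm_num
    rw [ENNReal.ofReal_div_of_pos (by norm_num)]
    simp
  -- The overlaps of `L` with its translates have total measure `V ^ 2`.
  have htotal : ∫⁻ x : ℝ × ℝ, volume (L ∩ {y | y - x ∈ L}) = V * V := by
    have hmeas : ∀ x : ℝ × ℝ, MeasurableSet {y : ℝ × ℝ | y - x ∈ L} := fun x =>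
      (measurable_id.sub_const x) hLm
    have e1 : ∀ x : ℝ × ℝ, volume (L ∩ {y | y - x ∈ L}) =
        ∫⁻ y, L.indicator 1 y * L.indicator 1 (y - x) := by
      intro x
      rw [← lintegral_indicator_one (hLm.inter (hmeas x))]
      refine lintegral_congr fun y => ?_
      by_cases h1 : y ∈ L <;> by_cases h2 : y - x ∈ L <;> simp [indicator, h1, h2]
    simp_rw [e1]
    have hind : Measurable (L.indicator (1 : ℝ × ℝ → ℝ≥0∞)) := measurable_one.indicator hLm
    rw [lintegral_lintegral_swap]
    · have e2 : ∀ y : ℝ × ℝ, ∫⁻ x : ℝ × ℝ, L.indicator (1 : ℝ × ℝ → ℝ≥0∞) y *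
          L.indicator 1 (y - x) = L.indicator 1 y * V := by
        intro y
        rw [lintegral_const_mul (f := fun x => L.indicator (1 : ℝ × ℝ → ℝ≥0∞) (y - x)) _
            (hind.comp (measurable_const.sub measurable_id)),
          lintegral_sub_left_eq_self (fun z => L.indicator (1 : ℝ × ℝ → ℝ≥0∞) z) y,
          lintegral_indicator_one hLm]
      simp_rw [e2]
      rw [lintegral_mul_const _ hind, lintegral_indicator_one hLm]
    · exact ((hind.comp measurable_snd).mul
        (hind.comp (measurable_snd.sub measurable_fst))).aemeasurable
  -- Translating by half of a difference keeps a quarter of `L`.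
  have hoverlap : ∀ x ∈ (2⁻¹ : ℝ) • (L - L), 4⁻¹ * V ≤ volume (L ∩ {y | y - x ∈ L}) := by
    rintro _ ⟨_, ⟨p, hp, q, hq, rfl⟩, rfl⟩
    rw [← hhalf, ← measure_preimage_add_right volume (-((2⁻¹ : ℝ) • p)) ((2⁻¹ : ℝ) • L)]
    refine measure_mono fun y hy => ?_
    obtain ⟨k, hk, hky⟩ := hy
    have hy' : y = (2⁻¹ : ℝ) • k + (2⁻¹ : ℝ) • p := by
      have h : (2⁻¹ : ℝ) • k = y + -((2⁻¹ : ℝ) • p) := hky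
      rw [h]
      abel
    refine ⟨hy' ▸ hc hk hp (by norm_num) (by norm_num) (by norm_num), ?_⟩
    have : y - (2⁻¹ : ℝ) • (p - q) = (2⁻¹ : ℝ) • k + (2⁻¹ : ℝ) • q := by
      rw [hy', smul_sub]; abel
    simp only [mem_ofPred_eq]
    rw [this]
    exact hc hk hq (by norm_num) (by norm_num) (by norm_num)
  have hle : 4⁻¹ * V * (4⁻¹ * volume (L - L)) ≤ V * V := by
    rw [← hhalf (L - L), ← htotal, ← setLIntegral_const]
    exact (setLIntegral_mono' (hDc.smul _).measurableSet hoverlap).trans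
      (setLIntegral_le_lintegral _ _)
  have hDfin : volume (L - L) ≠ ∞ := hDc.measure_lt_top.ne
  have hreal : 4⁻¹ * volume.real L * (4⁻¹ * volume.real (L - L)) ≤
      volume.real L * volume.real L := by
    have := ENNReal.toReal_mono (ENNReal.mul_ne_top hV hV) hle
    simpa [measureReal_def, ENNReal.toReal_mul] using this
  nlinarith

/-- The area of the sector of `L` swept by the rays with angles in `[0, t]`. -/
def sectorArea (L : Set (ℝ × ℝ)) (t : ℝ) : ℝ := (∫ φ in 0..t, radial L φ ^ 2) / 2

lemma sectorArea_nonneg (L : Set (ℝ × ℝ)) {t : ℝ} (ht : 0 ≤ t) : 0 ≤ sectorArea L t :=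
  div_nonneg (intervalIntegral.integral_nonneg ht fun _ _ => sq_nonneg _) (by norm_num)

/-- A chord of `L` is a difference of two points of `L`, so it is at most as long as the radius of
the difference body in its direction. -/
lemma width_preimage_rot_le_radial_sub {L : Set (ℝ × ℝ)} (hL : IsCompact L) (hc : Convex ℝ L)
    (h0 : (0 : ℝ × ℝ) ∈ interior L) (t h : ℝ) :
    width (rot t ⁻¹' L) h ≤ radial (L - L) t := by
  have hDc : IsCompact (L - L) := by
    rw [sub_eq_add_neg]; exact hL.add hL.neg
  have h0D : (0 : ℝ × ℝ) ∈ interior (L - L) := by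
    refine interior_mono (fun x hx => ?_) h0
    exact ⟨x, hx, 0, interior_subset h0, sub_zero x⟩
  by_cases hne : ∃ x, (x, h) ∈ rot t ⁻¹' L
  · obtain ⟨x, hx⟩ := hne
    obtain ⟨l, r, hlr, h1, h2⟩ := exists_slice_eq_Icc (isCompact_preimage_rot hL t)
      (convex_preimage_rot hc t) hx
    have hl : (l, h) ∈ rot t ⁻¹' L := by
      have : l ∈ Icc l r := ⟨le_rfl, hlr⟩
      rw [← h1] at this; exact this
    have hr : (r, h) ∈ rot t ⁻¹' L := by
      have : r ∈ Icc l r := ⟨hlr, le_rfl⟩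
      rw [← h1] at this; exact this
    rw [h2, ← polar_mem_iff hDc (hc.sub hc) h0D (by linarith)]
    refine ⟨_, hr, _, hl, ?_⟩
    ext <;> simp [rot, planeMap] <;> ring
  · push Not at hne
    have : {x : ℝ | (x, h) ∈ rot t ⁻¹' L} = ∅ := by
      ext x
      simpa using hne x
    rw [width, this]
    simpa using (radial_pos hDc h0D t).le

section chord

variable {L : Set (ℝ × ℝ)} (hL : IsCompact L) (hc : Convex ℝ L) (h0 : (0 : ℝ × ℝ) ∈ interior L)

include hL hc h0

lemma hasDerivAt_sectorArea (t : ℝ) : HasDerivAt (sectorArea L) (radial L t ^ 2 / 2) t := by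
  have hcont := (continuous_radial hL hc h0).pow 2
  exact (hcont.integral_hasStrictDerivAt 0 t).hasDerivAt.div_const 2

lemma sectorArea_mono {s t : ℝ} (hst : s ≤ t) : sectorArea L s ≤ sectorArea L t := by
  have : Monotone (sectorArea L) := monotone_of_deriv_nonneg
    (fun t => (hasDerivAt_sectorArea hL hc h0 t).differentiableAt)
    (fun t => by rw [(hasDerivAt_sectorArea hL hc h0 t).deriv]; positivity)
  exact this hst

lemma areaBelow_rot_le {t : ℝ} (ht : 0 < t) (htπ : t < π) :
    areaBelow (rot t ⁻¹' L) 0 ≤ areaBelow L 0 + sectorArea L t := by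
  rw [areaBelow_preimage_rot hL, sectorArea, ← volume_real_sector_le hL hc h0 ht htπ, areaBelow]
  refine (measureReal_mono (s₂ := (L ∩ {p | p.2 ≤ 0}) ∪
    (L ∩ {p | 0 < p.2 ∧ -sin t * p.1 + cos t * p.2 ≤ 0})) ?_ ?_).trans (measureReal_union_le _ _)
  · intro p hp
    rcases le_or_gt p.2 0 with h | h
    · exact Or.inl ⟨hp.1, h⟩
    · exact Or.inr ⟨hp.1, h, hp.2⟩
  · exact ((measure_mono (union_subset inter_subset_left inter_subset_left)).trans_lt
      hL.measure_lt_top).ne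

lemma sectorArea_le_areaBelow_rot {t : ℝ} (ht : 0 < t) (htπ : t < π) :
    sectorArea L t ≤ areaBelow (rot t ⁻¹' L) 0 := by
  rw [areaBelow_preimage_rot hL, sectorArea, ← volume_real_sector_le hL hc h0 ht htπ]
  refine measureReal_mono (fun p hp => ⟨hp.1, hp.2.2⟩) ?_
  exact ((measure_mono inter_subset_left).trans_lt hL.measure_lt_top).ne

variable {c : ℝ} (hcpos : 0 < c) (hslice : {x : ℝ | (x, (0 : ℝ)) ∈ L} = Icc (-c) c)
  (hsmall : 9 * areaBelow L 0 < volume.real L)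

include hcpos hslice hsmall

/-- The half of the rotating chord which sweeps over the small part of `L` is at most three times as
long as the other half. -/
lemma radial_sub_pi_le {t : ℝ} (ht : 0 ≤ t) (htπ : t ≤ π) :
    radial L (t - π) ≤ 3 * radial L t := by
  have hpos := radial_pos hL h0 (t - π)
  have hmem := (polar_mem_iff hL hc h0 hpos.le (t - π)).2 le_rfl
  rw [cos_sub_pi, sin_sub_pi, mul_neg, mul_neg] at hmem
  have := neg_third_mem hL hc hcpos hslice hsmall
    (mul_nonneg hpos.le (sin_nonneg_of_nonneg_of_le_pi ht htπ)) hmem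
  rw [neg_neg, mul_div_right_comm, mul_div_right_comm,
    polar_mem_iff hL hc h0 (by positivity)] at this
  linarith

lemma areaBelow_le_areaBelow_rot {t : ℝ} (ht : 0 < t) (htπ : t < π) :
    areaBelow L 0 ≤ areaBelow (rot t ⁻¹' L) 0 + 9 * sectorArea L t := by
  have hopp : volume.real (L ∩ {p | p.2 ≤ 0 ∧ 0 < -sin t * p.1 + cos t * p.2}) ≤
      9 * sectorArea L t := by
    have hcont := continuous_radial hL hc h0
    rw [volume_real_opposite_sector hL hc h0 ht htπ, sectorArea, ← mul_div_assoc,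
      ← intervalIntegral.integral_const_mul]
    refine div_le_div_of_nonneg_right (intervalIntegral.integral_mono_on ht.le ?_ ?_ ?_)
      (by norm_num)
    · exact ((hcont.comp (continuous_sub_right π)).pow 2).intervalIntegrable _ _
    · exact ((hcont.pow 2).const_mul 9).intervalIntegrable _ _
    · intro φ hφ
      have h1 := radial_sub_pi_le hL hc h0 hcpos hslice hsmall hφ.1 (hφ.2.trans htπ.le)
      have h2 := radial_pos hL h0 (φ - π)
      nlinarith
  refine le_trans ?_ (add_le_add le_rfl hopp)
  rw [areaBelow_preimage_rot hL, areaBelow]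
  refine (measureReal_mono (s₂ := (L ∩ {p | -sin t * p.1 + cos t * p.2 ≤ 0}) ∪
    (L ∩ {p | p.2 ≤ 0 ∧ 0 < -sin t * p.1 + cos t * p.2})) ?_ ?_).trans (measureReal_union_le _ _)
  · intro p hp
    rcases le_or_gt (-sin t * p.1 + cos t * p.2) 0 with h | h
    · exact Or.inl ⟨hp.1, h⟩
    · exact Or.inr ⟨hp.1, hp.2, h⟩
  · exact ((measure_mono (union_subset inter_subset_left inter_subset_left)).trans_lt
      hL.measure_lt_top).ne

/-- As long as the rotating chord cuts off at most half of the area, the squared length of the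
chord which has the same direction and cuts off area `1` is controlled by the logarithmic derivative
and the derivative of the area swept by the upper half of the rotating chord. -/
lemma width_sq_mul_le {t : ℝ} (ht : 0 < t) (htπ : t < π)
    (hhalf : areaBelow (rot t ⁻¹' L) 0 ≤ volume.real L / 2) (hV : 0 < volume.real L) {h : ℝ}
    (hone : areaBelow (rot t ⁻¹' L) h = 1) :
    width (rot t ⁻¹' L) h ^ 2 * (areaBelow L 0 + sectorArea L t) ≤
      1408 * radial L t ^ 2 * (1 + (areaBelow L 0 + sectorArea L t)) := by
  have a1 := sectorArea_le_areaBelow_rot hL hc h0 ht htπ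
  have a2 := areaBelow_le_areaBelow_rot hL hc h0 hcpos hslice hsmall ht htπ
  have g0 := sectorArea_nonneg L ht.le
  have e0 := areaBelow_nonneg L 0
  have hρ := radial_pos hL h0 t
  have hρ' := radial_pos hL h0 (t - π)
  have hw : width (rot t ⁻¹' L) 0 ≤ 4 * radial L t := by
    rw [width_preimage_rot_zero hL hc h0]
    linarith [radial_sub_pi_le hL hc h0 hcpos hslice hsmall ht.le htπ.le]
  have hw2 : width (rot t ⁻¹' L) 0 ^ 2 ≤ 16 * radial L t ^ 2 := by
    have := pow_le_pow_left₀ (width_nonneg _ _) hw 2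
    linarith [mul_pow 4 (radial L t) 2]
  have hM := isCompact_preimage_rot hL t
  have hMc := convex_preimage_rot hc t
  have hMV := volume_real_preimage_rot hL.measurableSet t
  -- The constant is `1408 = 8 * 16 * 11`, where `8` is the constant in the comparison of chords
  -- with the same direction, `16` comes from `hw2`, and `11` from `hG`.
  set w := width (rot t ⁻¹' L) h
  set a := areaBelow (rot t ⁻¹' L) 0
  set G := areaBelow L 0 + sectorArea L t
  have hG : G ≤ 11 * a := by linarith
  have hG0 : 0 ≤ G := by positivity
  rcases le_total 0 h with hh | hh
  · have := areaBelow_mul_width_sq_le hM hMc hh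
    rw [hone] at this
    have h1 : w ^ 2 * G ≤ w ^ 2 * (11 * a) := mul_le_mul_of_nonneg_left hG (sq_nonneg _)
    have h2 : 0 ≤ 1408 * radial L t ^ 2 * G := by positivity
    nlinarith
  · have := areaAbove_mul_width_sq_le hM hMc hh
    rw [hone, hMV] at this
    have h1 : volume.real L / 2 * w ^ 2 ≤ (volume.real L - a) * w ^ 2 :=
      mul_le_mul_of_nonneg_right (by linarith) (sq_nonneg _)
    have h2 : 8 * width (rot t ⁻¹' L) 0 ^ 2 * (volume.real L - 1) ≤
        128 * radial L t ^ 2 * volume.real L := by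
      have : 8 * width (rot t ⁻¹' L) 0 ^ 2 * (volume.real L - 1) ≤
        8 * width (rot t ⁻¹' L) 0 ^ 2 * volume.real L :=
        mul_le_mul_of_nonneg_left (by linarith) (by positivity)
      nlinarith
    have h3 : volume.real L * w ^ 2 ≤ volume.real L * (256 * radial L t ^ 2) := by linarith
    have h4 : w ^ 2 ≤ 256 * radial L t ^ 2 := le_of_mul_le_mul_left h3 hV
    have h5 : w ^ 2 * G ≤ 256 * radial L t ^ 2 * G := mul_le_mul_of_nonneg_right h4 hG0
    have h6 : 0 ≤ radial L t ^ 2 * G := by positivity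
    nlinarith [sq_nonneg (radial L t)]

/-- The integral of the squared length of the chord cutting off area `1` is controlled by the
logarithm of the growth of the swept area, and by the swept area. The function `F` is not assumed to
be measurable; both bounds go through continuous majorants. -/
lemma lintegral_sq_le {F : ℝ → ℝ} {T : ℝ} (hT : 0 < T) (hTπ : T ≤ π) (hF0 : ∀ t, 0 ≤ F t)
    (hF : ∀ t ∈ Ioo 0 T, ∃ h, areaBelow (rot t ⁻¹' L) h = 1 ∧ F t ≤ width (rot t ⁻¹' L) h)
    (hε : 0 < areaBelow L 0) :
    ∫⁻ t in Ioo 0 T, ENNReal.ofReal (F t ^ 2) ≤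
      ENNReal.ofReal (2816 * (log (1 + sectorArea L T / areaBelow L 0) + sectorArea L T)) := by
  have hV : 0 < volume.real L := by linarith
  have gT := sectorArea_nonneg L hT.le
  set ε := areaBelow L 0
  have majorize : ∀ u : ℝ → ℝ, Continuous u → (∀ t ∈ Ioo 0 T, F t ^ 2 ≤ u t) →
      (∀ t, 0 ≤ u t) → ∫⁻ t in Ioo 0 T, ENNReal.ofReal (F t ^ 2) ≤
        ENNReal.ofReal (∫ t in 0..T, u t) := by
    intro u hu hFu hu0
    rw [intervalIntegral.integral_of_le hT.le, ofReal_integral_eq_lintegral_ofReal]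
    · rw [← setLIntegral_congr Ioo_ae_eq_Ioc]
      exact setLIntegral_mono' measurableSet_Ioo fun t ht => ENNReal.ofReal_le_ofReal (hFu t ht)
    · exact (hu.integrableOn_Icc (a := 0) (b := T)).mono_set Ioc_subset_Icc_self
    · exact Filter.Eventually.of_forall hu0
  by_cases hcase : ∃ t ∈ Ioo 0 T, volume.real L / 2 < areaBelow (rot t ⁻¹' L) 0
  · -- The swept area is at least a quarter of the area of `L`, which bounds the integral of the
    -- squared radius of the difference body.
    obtain ⟨t, ht, hbig⟩ := hcase
    have h1 := areaBelow_rot_le hL hc h0 ht.1 (ht.2.trans_le hTπ)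
    have h2 := sectorArea_mono hL hc h0 ht.2.le
    have hDc : IsCompact (L - L) := by
      rw [sub_eq_add_neg]; exact hL.add hL.neg
    have h0D : (0 : ℝ × ℝ) ∈ interior (L - L) := by
      refine interior_mono (fun x hx => ?_) h0
      exact ⟨x, hx, 0, interior_subset h0, sub_zero x⟩
    have hDconv := hc.sub hc
    refine (majorize (fun t => radial (L - L) t ^ 2)
      ((continuous_radial hDc hDconv h0D).pow 2) ?_ (fun t => sq_nonneg _)).trans ?_
    · intro s hs
      obtain ⟨h, -, hle⟩ := hF s hs
      exact pow_le_pow_left₀ (hF0 s)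
        (hle.trans (width_preimage_rot_le_radial_sub hL hc h0 s h)) 2
    · refine ENNReal.ofReal_le_ofReal ?_
      have h3 := volume_real_sector_lt hDc hDconv h0D hT hTπ
      have h4 : volume.real ((L - L) ∩ {p | 0 < p.2 ∧ -sin T * p.1 + cos T * p.2 < 0}) ≤
          volume.real (L - L) := measureReal_mono inter_subset_left hDc.measure_lt_top.ne
      have h5 := volume_sub_self_le hL hc hV
      have h6 : 0 ≤ log (1 + sectorArea L T / ε) := by
        apply log_nonneg
        have : 0 ≤ sectorArea L T / ε := by positivity
        linarith
      linarith
  · push Not at hcase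
    -- The maximum keeps `G` positive, so that the majorant is continuous on the whole line.
    set G : ℝ → ℝ := fun t => ε + sectorArea L (max t 0) with hGdef
    have hGpos : ∀ t, 0 < G t := fun t => by
      have := sectorArea_nonneg L (le_max_right t 0)
      simp only [hGdef]; linarith
    have hgcont : Continuous (sectorArea L) :=
      continuous_iff_continuousAt.2 fun t => (hasDerivAt_sectorArea hL hc h0 t).continuousAt
    have hGcont : Continuous G :=
      continuous_const.add (hgcont.comp (continuous_id.max continuous_const))
    have hρcont := (continuous_radial hL hc h0).pow 2
    refine (majorize (fun t => 1408 * radial L t ^ 2 * (1 + G t) / G t)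
      (((hρcont.const_mul 1408).mul (continuous_const.add hGcont)).div hGcont
        fun t => (hGpos t).ne') ?_ ?_).trans ?_
    · intro t ht
      obtain ⟨h, hone, hle⟩ := hF t ht
      rw [le_div_iff₀ (hGpos t)]
      have hGt : G t = ε + sectorArea L t := by simp only [hGdef, max_eq_left ht.1.le]
      have := width_sq_mul_le hL hc h0 hcpos hslice hsmall ht.1 (ht.2.trans_le hTπ)
        (hcase t ht) hV hone
      rw [hGt]
      refine le_trans (mul_le_mul_of_nonneg_right (pow_le_pow_left₀ (hF0 t) hle 2) ?_) this
      rw [← hGt]; exact (hGpos t).le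
    · intro t
      have := hGpos t
      positivity
    · apply le_of_eq
      congr 1
      have hderiv : ∀ t ∈ uIcc 0 T, HasDerivAt
          (fun t => 2816 * (log (ε + sectorArea L t) + sectorArea L t))
          (1408 * radial L t ^ 2 * (1 + G t) / G t) t := by
        intro t ht
        rw [uIcc_of_le hT.le] at ht
        have hGt : G t = ε + sectorArea L t := by simp only [hGdef, max_eq_left ht.1]
        have hd := hasDerivAt_sectorArea hL hc h0 t
        have hne : ε + sectorArea L t ≠ 0 := by rw [← hGt]; exact (hGpos t).ne'
        refine ((((hd.const_add ε).log hne).add hd).const_mul 2816).congr_deriv ?_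
        rw [hGt]
        field_simp
        ring
      rw [intervalIntegral.integral_eq_sub_of_hasDerivAt hderiv]
      · have hz : sectorArea L 0 = 0 := by simp [sectorArea]
        have : 1 + sectorArea L T / ε = (ε + sectorArea L T) / ε := by field_simp
        rw [hz, this, log_div (by positivity) hε.ne', add_zero, add_zero]
        ring
      · exact ((((hρcont.const_mul 1408).mul (continuous_const.add hGcont)).div hGcont
          fun t => (hGpos t).ne')).intervalIntegrable _ _

end chord

end

/-! ### Cutting off a cap of given area -/

lemma exists_width_bound {M : Set (ℝ × ℝ)} (hM : IsCompact M) :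
    ∃ R : ℝ, 0 < R ∧ (∀ p ∈ M, p.2 ∈ Icc (-R) R) ∧ ∀ h, width M h ≤ 2 * R := by
  obtain ⟨R, hR, hsub⟩ := hM.isBounded.subset_closedBall_lt 0 0
  have hb : ∀ p ∈ M, |p.1| ≤ R ∧ |p.2| ≤ R := by
    intro p hp
    have := hsub hp
    rw [mem_closedBall_zero_iff, Prod.norm_def, sup_le_iff] at this
    simpa using this
  refine ⟨R, hR, fun p hp => abs_le.1 (hb p hp).2, fun h => ?_⟩
  have hsub : {x : ℝ | (x, h) ∈ M} ⊆ Icc (-R) R := fun x hx => abs_le.1 (hb _ hx).1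
  calc width M h ≤ volume.real (Icc (-R) R) := measureReal_mono hsub (by simp)
    _ = 2 * R := by rw [Real.volume_real_Icc_of_le (by linarith)]; ring

lemma continuous_areaBelow {M : Set (ℝ × ℝ)} (hM : IsCompact M) : Continuous (areaBelow M) := by
  obtain ⟨R, hR, -, hw⟩ := exists_width_bound hM
  have hinc : ∀ s t : ℝ, s ≤ t → areaBelow M t ≤ areaBelow M s + 2 * R * (t - s) := by
    intro s t hst
    have hcomp : IsCompact (M ∩ {p | s ≤ p.2 ∧ p.2 ≤ t}) :=
      hM.inter_right ((isClosed_le continuous_const continuous_snd).inter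
        (isClosed_le continuous_snd continuous_const))
    have h1 : volume.real (M ∩ {p | s ≤ p.2 ∧ p.2 ≤ t}) ≤ 2 * R * (t - s) := by
      refine volume_real_le_of_width_le hcomp hst (by linarith) (fun p hp => hp.2) ?_
      intro h _
      refine le_trans (measureReal_mono (fun x hx => hx.1) ?_) (hw h)
      exact (isCompact_slice hM h).measure_lt_top.ne
    refine le_trans ?_ (add_le_add le_rfl h1)
    refine (measureReal_mono (s₂ := (M ∩ {p | p.2 ≤ s}) ∪ (M ∩ {p | s ≤ p.2 ∧ p.2 ≤ t}))
      ?_ ?_).trans (measureReal_union_le _ _)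
    · intro p hp
      rcases le_total p.2 s with h | h
      · exact Or.inl ⟨hp.1, h⟩
      · exact Or.inr ⟨hp.1, h, hp.2⟩
    · exact ((measure_mono (union_subset inter_subset_left inter_subset_left)).trans_lt
        hM.measure_lt_top).ne
  have hlip : LipschitzWith (Real.toNNReal (2 * R)) (areaBelow M) := by
    refine LipschitzWith.of_le_add_mul _ fun x y => ?_
    rw [Real.coe_toNNReal _ (by linarith), Real.dist_eq]
    rcases le_total x y with h | h
    · have := areaBelow_mono hM h
      have h2 : 0 ≤ 2 * R * |x - y| := by positivity
      linarith
    · rw [abs_of_nonneg (by linarith)]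
      exact hinc y x h
  exact hlip.continuous

lemma areaBelow_sSup {M : Set (ℝ × ℝ)} (hM : IsCompact M) {r : ℝ} (hr : 0 ≤ r)
    (hrV : r < volume.real M) : areaBelow M (sSup {t | areaBelow M t ≤ r}) = r := by
  obtain ⟨R, hR, hb, -⟩ := exists_width_bound hM
  have hcont := continuous_areaBelow hM
  have hne : {t | areaBelow M t ≤ r}.Nonempty := by
    refine ⟨-R - 1, ?_⟩
    have : M ∩ {p | p.2 ≤ -R - 1} = ∅ := by
      ext p
      simp only [mem_inter_iff, mem_ofPred_eq, mem_empty_iff_false, iff_false, not_and, not_le]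
      intro hp
      linarith [(hb p hp).1]
    rw [mem_ofPred_eq, areaBelow, this]
    simpa using hr
  have hbdd : BddAbove {t | areaBelow M t ≤ r} := by
    refine ⟨R, fun t ht => ?_⟩
    by_contra hcon
    push Not at hcon
    have : M ∩ {p | p.2 ≤ t} = M :=
      inter_eq_left.2 fun p hp => (hb p hp).2.trans hcon.le
    rw [mem_ofPred_eq, areaBelow, this] at ht
    linarith
  have hclosed : IsClosed {t | areaBelow M t ≤ r} := isClosed_le hcont continuous_const
  have hle : areaBelow M (sSup {t | areaBelow M t ≤ r}) ≤ r := hclosed.csSup_mem hne hbdd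
  refine le_antisymm hle ?_
  by_contra hcon
  push Not at hcon
  have hopen : IsOpen {t | areaBelow M t < r} := isOpen_lt hcont continuous_const
  obtain ⟨δ, hδ, hball⟩ := Metric.isOpen_iff.1 hopen _ hcon
  have hmem : areaBelow M (sSup {t | areaBelow M t ≤ r} + δ / 2) < r := by
    apply hball
    rw [Metric.mem_ball, Real.dist_eq, add_sub_cancel_left, abs_of_pos (by linarith)]
    linarith
  have := le_csSup hbdd hmem.le
  linarith

/-- A horizontal line which cuts off a proper part of positive area from a convex body meets it in a
chord of positive length, whose midpoint is an interior point of the body. -/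
lemma exists_midpoint_chord {M : Set (ℝ × ℝ)} (hM : IsCompact M) (hc : Convex ℝ M) {h : ℝ}
    (hpos : 0 < areaBelow M h) (hlt : areaBelow M h < volume.real M) :
    ∃ x₀ c : ℝ, 0 < c ∧ {x : ℝ | (x, h) ∈ M} = Icc (x₀ - c) (x₀ + c) ∧ (x₀, h) ∈ interior M := by
  have hfr : volume (frontier M) = 0 := hc.addHaar_frontier _
  have hline : volume (M ∩ {p | p.2 = h}) = 0 := by
    rcases (ENNReal.toReal_eq_zero_iff _).1 (volume_real_horizontal_line hM h) with h1 | h1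
    · exact h1
    · exact absurd h1 ((measure_mono inter_subset_left).trans_lt hM.measure_lt_top).ne
  have hnull : volume (frontier M ∪ (M ∩ {p | p.2 = h})) = 0 := measure_union_null hfr hline
  have hpt : ∀ S : Set (ℝ × ℝ), S ⊆ M → 0 < volume.real S →
      ∃ p ∈ S, p ∈ interior M ∧ p.2 ≠ h := by
    intro S hS hSpos
    by_contra hcon
    push Not at hcon
    have hsub : S ⊆ frontier M ∪ (M ∩ {p | p.2 = h}) := by
      intro p hp
      by_cases hi : p ∈ interior M
      · exact Or.inr ⟨hS hp, hcon p hp hi⟩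
      · exact Or.inl ⟨subset_closure (hS hp), hi⟩
    rw [measureReal_def, measure_mono_null hsub hnull] at hSpos
    simp at hSpos
  obtain ⟨p, hp, hpi, hph⟩ := hpt _ inter_subset_left hpos
  obtain ⟨q, hq, hqi, hqh⟩ := hpt (M ∩ {p | h ≤ p.2}) inter_subset_left
    (by rw [volume_real_inter_ge hM]; linarith)
  obtain ⟨z, hz⟩ := exists_mem_slice_of_mem hc.interior (s := p.2) (t := h) (u := q.2)
    (x := p.1) (y := q.1) hpi hqi hp.2 hq.2
  have hzM := interior_subset hz
  obtain ⟨l, r, hlr, hs, -⟩ := exists_slice_eq_Icc hM hc hzM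
  have hmem : ∀ x, (x, h) ∈ M ↔ l ≤ x ∧ x ≤ r := fun x => by
    rw [← mem_Icc, ← hs]; rfl
  -- The interior point is not an end point of the chord.
  have hcont : Continuous fun x : ℝ => (x, h) := by fun_prop
  obtain ⟨δ, hδ, hball⟩ := Metric.isOpen_iff.1 (isOpen_interior.preimage hcont) z hz
  have hnear : ∀ x, |x - z| < δ → l ≤ x ∧ x ≤ r := fun x hx =>
    (hmem x).1 (interior_subset (hball (by rwa [Metric.mem_ball, Real.dist_eq])))
  have hlz : l < z := by
    have := hnear (z - δ / 2) (by rw [abs_lt]; constructor <;> linarith)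
    linarith [this.1]
  have hzr : z < r := by
    have := hnear (z + δ / 2) (by rw [abs_lt]; constructor <;> linarith)
    linarith [this.2]
  refine ⟨(l + r) / 2, (r - l) / 2, by linarith, by rw [hs]; congr 1 <;> ring, ?_⟩
  have hcomb : ∀ e, (e, h) ∈ M → ∀ s, 0 < s → s ≤ 1 → (s * z + (1 - s) * e, h) ∈ interior M := by
    intro e he s hs hs1
    have := hc.combo_interior_self_mem_interior hz he hs (by linarith : 0 ≤ 1 - s) (by ring)
    convert this using 1
    ext
    · simp
    · simp; ring
  rcases le_total ((l + r) / 2) z with hm | hm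
  · have := hcomb l ((hmem l).2 ⟨le_rfl, hlr⟩) (((r - l) / 2) / (z - l))
      (div_pos (by linarith) (by linarith)) (by rw [div_le_one (by linarith)]; linarith)
    convert this using 2
    have : z - l ≠ 0 := by linarith
    field_simp
    ring
  · have := hcomb r ((hmem r).2 ⟨hlr, le_rfl⟩) (((r - l) / 2) / (r - z))
      (div_pos (by linarith) (by linarith)) (by rw [div_le_one (by linarith)]; linarith)
    convert this using 2
    have : r - z ≠ 0 := by linarith
    field_simp
    ring

/-! ### Frames of the Euclidean plane -/

lemma inner_leftNormal (p : Plane) (θ : ℝ) :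
    inner ℝ p (leftNormal θ) = -sin θ * p 0 + cos θ * p 1 := by
  simp [leftNormal, PiLp.inner_apply, Fin.sum_univ_two]

lemma leftNormal_apply_zero (θ : ℝ) : leftNormal (θ : Real.Angle) 0 = -sin θ := by
  simp [leftNormal]

lemma leftNormal_apply_one (θ : ℝ) : leftNormal (θ : Real.Angle) 1 = cos θ := by
  simp [leftNormal]

lemma direction_apply_zero (θ : ℝ) : direction (θ : Real.Angle) 0 = cos θ := by
  simp [direction]

lemma direction_apply_one (θ : ℝ) : direction (θ : Real.Angle) 1 = sin θ := by
  simp [direction]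

/-- The affine frame with origin `b` whose axes are `σ • direction γ` and `leftNormal γ`; it is
orthonormal if `σ = 1` or `σ = -1`. -/
def frame (b : Plane) (γ σ : ℝ) (p : ℝ × ℝ) : Plane :=
  !₂[b 0 + σ * cos γ * p.1 - sin γ * p.2, b 1 + σ * sin γ * p.1 + cos γ * p.2]

/-- The inverse of the frame `frame b γ σ`. -/
def coframe (b : Plane) (γ σ : ℝ) (q : Plane) : ℝ × ℝ :=
  (σ * (cos γ * (q 0 - b 0) + sin γ * (q 1 - b 1)),
    -sin γ * (q 0 - b 0) + cos γ * (q 1 - b 1))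

section frame

variable {σ : ℝ} (hσ : σ ^ 2 = 1) (b : Plane) (γ : ℝ)

include hσ in
lemma sin_add_sign_mul (γ t : ℝ) : sin (γ + σ * t) = sin γ * cos t + σ * cos γ * sin t := by
  rcases sq_eq_one_iff.1 hσ with h | h <;> subst h
  · rw [one_mul, sin_add]; ring
  · rw [neg_one_mul, ← sub_eq_add_neg, sin_sub]; ring

include hσ in
lemma cos_add_sign_mul (γ t : ℝ) : cos (γ + σ * t) = cos γ * cos t - σ * sin γ * sin t := by
  rcases sq_eq_one_iff.1 hσ with h | h <;> subst h
  · rw [one_mul, cos_add]; ring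
  · rw [neg_one_mul, ← sub_eq_add_neg, cos_sub]; ring

lemma continuous_frame (b : Plane) (γ σ : ℝ) : Continuous (frame b γ σ) := by
  unfold frame
  refine (PiLp.continuous_toLp 2 _).comp (continuous_pi fun i => ?_)
  fin_cases i <;> simp <;> fun_prop

lemma continuous_coframe (b : Plane) (γ σ : ℝ) : Continuous (coframe b γ σ) := by
  unfold coframe; fun_prop

include hσ in
lemma frame_coframe (q : Plane) : frame b γ σ (coframe b γ σ q) = q := by
  have h := sin_sq_add_cos_sq γ
  ext i
  fin_cases i
  · simp [frame, coframe]
    linear_combination (cos γ ^ 2 * (q 0 - b 0) + cos γ * sin γ * (q 1 - b 1)) * hσ +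
      (q 0 - b 0) * h
  · simp [frame, coframe]
    linear_combination (cos γ * sin γ * (q 0 - b 0) + sin γ ^ 2 * (q 1 - b 1)) * hσ +
      (q 1 - b 1) * h

include hσ in
lemma coframe_frame (p : ℝ × ℝ) : coframe b γ σ (frame b γ σ p) = p := by
  have h := sin_sq_add_cos_sq γ
  ext
  · simp [frame, coframe]
    linear_combination p.1 * hσ + σ ^ 2 * p.1 * h
  · simp [frame, coframe]
    linear_combination p.2 * h

include hσ in
lemma measurePreserving_frame : MeasurePreserving (frame b γ σ) := by
  have h1 : MeasurePreserving (planeMap (σ * cos γ) (-sin γ) (σ * sin γ) (cos γ)) := by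
    refine measurePreserving_planeMap ?_
    have : σ * cos γ * cos γ - -sin γ * (σ * sin γ) = σ := by
      linear_combination σ * sin_sq_add_cos_sq γ
    rw [this]
    rcases sq_eq_one_iff.1 hσ with h | h <;> simp [h]
  have h2 := ((PiLp.volume_preserving_toLp (Fin 2)).comp
    (volume_preserving_finTwoArrow ℝ).symm).comp h1
  have h3 := (measurePreserving_add_left (volume : Measure Plane) b).comp h2
  have e : frame b γ σ = (fun x => b + x) ∘ (WithLp.toLp 2 ∘ MeasurableEquiv.finTwoArrow.symm) ∘
      planeMap (σ * cos γ) (-sin γ) (σ * sin γ) (cos γ) := by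
    funext p
    ext i
    fin_cases i <;>
      simp [frame, planeMap, MeasurableEquiv.finTwoArrow] <;> ring
  rw [e]
  exact h3

include hσ in
lemma inner_frame (p : ℝ × ℝ) (t : ℝ) :
    inner ℝ (frame b γ σ p) (leftNormal ((γ + σ * t : ℝ) : Real.Angle)) =
      inner ℝ b (leftNormal ((γ + σ * t : ℝ) : Real.Angle)) + (-sin t * p.1 + cos t * p.2) := by
  rw [inner_leftNormal, inner_leftNormal]
  have h := sin_sq_add_cos_sq γ
  have hs := sin_add_sign_mul hσ γ t
  have hc := cos_add_sign_mul hσ γ t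
  simp only [frame, hs, hc]
  simp
  linear_combination (-sin t * p.1 * (sin γ ^ 2 + cos γ ^ 2)) * hσ +
    (-sin t * p.1 + cos t * p.2) * h

variable {K : Set Plane}

include hσ in
lemma volume_real_preimage_frame {S : Set Plane} (hS : MeasurableSet S) :
    volume.real (frame b γ σ ⁻¹' S) = volume.real S := by
  rw [measureReal_def, (measurePreserving_frame hσ b γ).measure_preimage hS.nullMeasurableSet,
    measureReal_def]

include hσ in
lemma isCompact_preimage_frame (hK : IsCompact K) : IsCompact (frame b γ σ ⁻¹' K) := by
  have : frame b γ σ ⁻¹' K = coframe b γ σ '' K := by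
    ext p
    constructor
    · intro hp
      exact ⟨_, hp, coframe_frame hσ b γ p⟩
    · rintro ⟨q, hq, rfl⟩
      rwa [mem_preimage, frame_coframe hσ b γ]
  rw [this]
  exact hK.image (continuous_coframe _ _ _)

lemma convex_preimage_frame (hc : Convex ℝ K) : Convex ℝ (frame b γ σ ⁻¹' K) := by
  intro x hx y hy s t hs ht hst
  have := hc hx hy hs ht hst
  rw [mem_preimage]
  convert this using 1
  obtain rfl : t = 1 - s := by linarith
  ext i
  fin_cases i <;> simp [frame] <;> ring

lemma measurableSet_halfPlane (θ : Real.Angle) (t : ℝ) : MeasurableSet (halfPlane θ t) :=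
  (isClosed_le (by fun_prop) continuous_const).measurableSet

include hσ in
lemma areaBelow_frame (hK : IsCompact K) (t h : ℝ) :
    areaBelow (rot t ⁻¹' (frame b γ σ ⁻¹' K)) h =
      volume.real (cap K (γ + σ * t : ℝ)
        (inner ℝ b (leftNormal ((γ + σ * t : ℝ) : Real.Angle)) + h)) := by
  rw [areaBelow_preimage_rot (isCompact_preimage_frame hσ b γ hK),
    cap, ← volume_real_preimage_frame hσ b γ (hK.measurableSet.inter (measurableSet_halfPlane _ _))]
  congr 1
  ext p
  simp only [mem_inter_iff, mem_preimage, mem_ofPred_eq, halfPlane, inner_frame hσ,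
    add_le_add_iff_left]

include hσ in
lemma frame_rot (s h t : ℝ) :
    frame b γ σ (rot t (s, h)) =
      (inner ℝ b (leftNormal ((γ + σ * t : ℝ) : Real.Angle)) + h) •
          leftNormal ((γ + σ * t : ℝ) : Real.Angle) +
        (σ * s + (cos (γ + σ * t) * b 0 + sin (γ + σ * t) * b 1)) •
          direction ((γ + σ * t : ℝ) : Real.Angle) := by
  rw [inner_leftNormal]
  have h' := sin_sq_add_cos_sq (γ + σ * t)
  have hs := sin_add_sign_mul hσ γ t
  have hc := cos_add_sign_mul hσ γ t
  ext i
  fin_cases i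
  · simp only [frame, rot, planeMap, Fin.zero_eta, PiLp.add_apply, PiLp.smul_apply,
      leftNormal_apply_zero, direction_apply_zero]
    simp
    rw [show b 0 + σ * cos γ * (cos t * s + -(sin t * h)) - sin γ * (sin t * s + cos t * h) =
      b 0 + (σ * s) * (cos γ * cos t - σ * sin γ * sin t) - h * (sin γ * cos t + σ * cos γ * sin t)
        + (σ ^ 2 - 1) * s * sin γ * sin t by ring, ← hs, ← hc, hσ]
    linear_combination -b 0 * h'
  · simp only [frame, rot, planeMap, Fin.mk_one, PiLp.add_apply, PiLp.smul_apply,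
      leftNormal_apply_one, direction_apply_one]
    simp
    rw [show b 1 + σ * sin γ * (cos t * s + -(sin t * h)) + cos γ * (sin t * s + cos t * h) =
      b 1 + (σ * s) * (sin γ * cos t + σ * cos γ * sin t) + h * (cos γ * cos t - σ * sin γ * sin t)
        - (σ ^ 2 - 1) * s * cos γ * sin t by ring, ← hs, ← hc, hσ]
    linear_combination -b 1 * h'

include hσ in
lemma width_frame (t h : ℝ) :
    width (rot t ⁻¹' (frame b γ σ ⁻¹' K)) h =
      chordLength K (γ + σ * t : ℝ)
        (inner ℝ b (leftNormal ((γ + σ * t : ℝ) : Real.Angle)) + h) := by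
  unfold width chordLength
  set c := cos (γ + σ * t) * b 0 + sin (γ + σ * t) * b 1
  set S : Set ℝ := {s | (inner ℝ b (leftNormal ((γ + σ * t : ℝ) : Real.Angle)) + h) •
    leftNormal ((γ + σ * t : ℝ) : Real.Angle) + s • direction ((γ + σ * t : ℝ) : Real.Angle) ∈ K}
  have : {x : ℝ | (x, h) ∈ rot t ⁻¹' (frame b γ σ ⁻¹' K)} =
      (fun s => σ * s) ⁻¹' ((fun s => s + c) ⁻¹' S) := by
    ext s
    simp only [mem_ofPred_eq, mem_preimage, frame_rot hσ, S, c]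
  have hσ0 : σ ≠ 0 := by rintro rfl; norm_num at hσ
  rw [this, measureReal_def, Real.volume_preimage_mul_left hσ0, measure_preimage_add_right]
  have : |σ⁻¹| = 1 := by
    rcases sq_eq_one_iff.1 hσ with h | h <;> subst h <;> norm_num
  rw [this, ENNReal.ofReal_one, one_mul, measureReal_def]

end frame

/-! ### Turning a line around the midpoint of a chord -/

section body

variable {K : Set Plane} (hK : IsCompact K) (hc : Convex ℝ K)

lemma rot_zero : rot 0 = id := by
  ext p <;> simp [rot, planeMap]

include hK in
lemma areaBelow_frame_zero {σ : ℝ} (hσ : σ ^ 2 = 1) (b : Plane) (γ h : ℝ) :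
    areaBelow (frame b γ σ ⁻¹' K) h = volume.real (cap K γ (inner ℝ b (leftNormal γ) + h)) := by
  have := areaBelow_frame hσ b γ hK 0 h
  rwa [rot_zero, preimage_id, mul_zero, add_zero] at this

include hK in
lemma volume_real_cap_capHeight {r : ℝ} (hr : 0 ≤ r) (hrV : r < volume.real K) (θ : ℝ) :
    volume.real (cap K θ (capHeight K r θ)) = r := by
  have h1 : ∀ t, volume.real (cap K θ t) = areaBelow (frame 0 θ 1 ⁻¹' K) t := fun t => by
    rw [areaBelow_frame_zero hK (one_pow 2), inner_zero_left, zero_add]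
  unfold capHeight
  simp_rw [h1]
  refine areaBelow_sSup (isCompact_preimage_frame (one_pow 2) 0 θ hK) hr ?_
  rwa [volume_real_preimage_frame (one_pow 2) 0 θ hK.measurableSet]

include hK hc in
/-- The midpoint `b` of a chord cutting off a cap of area `ε`. -/
lemma exists_midpoint_cap_chord {ε : ℝ} (hε : 0 < ε) (hεV : ε < volume.real K) (γ : ℝ) :
    ∃ b ∈ interior K, ∃ c : ℝ, 0 < c ∧ volume.real (cap K γ (inner ℝ b (leftNormal γ))) = ε ∧
      ∀ σ : ℝ, σ ^ 2 = 1 → {x : ℝ | (x, (0 : ℝ)) ∈ frame b γ σ ⁻¹' K} = Icc (-c) c := by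
  have h1 : (1 : ℝ) ^ 2 = 1 := one_pow 2
  have hM := isCompact_preimage_frame h1 0 γ hK
  have harea : areaBelow (frame 0 γ 1 ⁻¹' K) (capHeight K ε γ) = ε := by
    rw [areaBelow_frame_zero hK h1, inner_zero_left, zero_add,
      volume_real_cap_capHeight hK hε.le hεV]
  have hMV : volume.real (frame 0 γ 1 ⁻¹' K) = volume.real K :=
    volume_real_preimage_frame h1 0 γ hK.measurableSet
  obtain ⟨x₀, c, hcpos, hs, hi⟩ := exists_midpoint_chord hM (convex_preimage_frame 0 γ hc)
    (h := capHeight K ε γ) (by rw [harea]; exact hε) (by rw [harea, hMV]; exact hεV)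
  set h := capHeight K ε γ
  have hmem : ∀ x, frame 0 γ 1 (x, h) ∈ K ↔ x₀ - c ≤ x ∧ x ≤ x₀ + c := fun x => by
    rw [← mem_Icc, ← hs]; rfl
  refine ⟨frame 0 γ 1 (x₀, h), ?_, c, hcpos, ?_, ?_⟩
  · have hco : coframe 0 γ 1 ⁻¹' (frame 0 γ 1 ⁻¹' K) = K := by
      ext q
      rw [mem_preimage, mem_preimage, frame_coframe h1]
    have := preimage_interior_subset_interior_preimage (continuous_coframe 0 γ 1)
      (t := frame 0 γ 1 ⁻¹' K)
    rw [hco] at this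
    apply this
    rw [mem_preimage, coframe_frame h1]
    exact hi
  · have := inner_frame h1 0 γ (x₀, h) 0
    rw [mul_zero, add_zero, inner_zero_left, zero_add] at this
    rw [this]
    simp only [sin_zero, neg_zero, zero_mul, cos_zero, one_mul, zero_add]
    exact volume_real_cap_capHeight hK hε.le hεV γ
  · intro σ hσ
    ext x
    have e : frame (frame 0 γ 1 (x₀, h)) γ σ (x, 0) = frame 0 γ 1 (x₀ + σ * x, h) := by
      ext i
      fin_cases i <;> simp [frame] <;> ring
    rw [mem_ofPred_eq, mem_preimage, e, hmem, mem_Icc]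
    rcases sq_eq_one_iff.1 hσ with h | h <;> subst h
    · constructor <;> rintro ⟨h1, h2⟩ <;> constructor <;> linarith
    · constructor <;> rintro ⟨h1, h2⟩ <;> constructor <;> linarith

include hK hc in
/-- At the midpoint `b` of a chord with angle `γ` which cuts off a cap of small area `ε`, turn the
line by an angle `T`, counterclockwise (`σ = 1`) or clockwise (`σ = -1`). Then the area swept above
the chord controls the affine invariant measure of the angles run through. -/
lemma lintegral_chordLength_sq_le (hV : 1 < volume.real K) {b : Plane} (hb : b ∈ interior K)
    {γ σ c : ℝ} (hσ : σ ^ 2 = 1) (hcpos : 0 < c)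
    (hchord : {x : ℝ | (x, (0 : ℝ)) ∈ frame b γ σ ⁻¹' K} = Icc (-c) c)
    (hε : 0 < volume.real (cap K γ (inner ℝ b (leftNormal γ))))
    (hsmall : 9 * volume.real (cap K γ (inner ℝ b (leftNormal γ))) < volume.real K)
    {T : ℝ} (hT : 0 < T) (hTπ : T ≤ π) :
    ∫⁻ t in Ioo 0 T, ENNReal.ofReal
      (chordLength K (γ + σ * t : ℝ) (capHeight K 1 (γ + σ * t : ℝ)) ^ 2) ≤
    ENNReal.ofReal (2816 * (log (1 + volume.real (K ∩ {q | inner ℝ b (leftNormal γ) <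
        inner ℝ q (leftNormal γ) ∧ inner ℝ q (leftNormal (γ + σ * T : ℝ)) <
          inner ℝ b (leftNormal (γ + σ * T : ℝ))}) /
          volume.real (cap K γ (inner ℝ b (leftNormal γ)))) +
      volume.real (K ∩ {q | inner ℝ b (leftNormal γ) <
        inner ℝ q (leftNormal γ) ∧ inner ℝ q (leftNormal (γ + σ * T : ℝ)) <
          inner ℝ b (leftNormal (γ + σ * T : ℝ))}))) := by
  have hL := isCompact_preimage_frame hσ b γ hK
  have hLc : Convex ℝ (frame b γ σ ⁻¹' K) := convex_preimage_frame b γ hc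
  have h0 : (0 : ℝ × ℝ) ∈ interior (frame b γ σ ⁻¹' K) := by
    apply preimage_interior_subset_interior_preimage (continuous_frame b γ σ)
    have : frame b γ σ 0 = b := by
      ext i
      fin_cases i <;> simp [frame]
    rwa [mem_preimage, this]
  have hLV : volume.real (frame b γ σ ⁻¹' K) = volume.real K :=
    volume_real_preimage_frame hσ b γ hK.measurableSet
  have hLε := areaBelow_frame_zero hK hσ b γ 0
  rw [add_zero] at hLε
  have hsector : sectorArea (frame b γ σ ⁻¹' K) T = volume.real (K ∩
      {q | inner ℝ b (leftNormal γ) < inner ℝ q (leftNormal γ) ∧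
        inner ℝ q (leftNormal (γ + σ * T : ℝ)) < inner ℝ b (leftNormal (γ + σ * T : ℝ))}) := by
    rw [sectorArea, ← volume_real_sector_lt hL hLc h0 hT hTπ, ← volume_real_preimage_frame hσ b γ]
    · congr 1
      ext p
      have e0 := inner_frame hσ b γ p 0
      rw [mul_zero, add_zero] at e0
      simp only [mem_inter_iff, mem_preimage, mem_ofPred_eq, inner_frame hσ b γ p T, e0]
      simp
    · refine hK.measurableSet.inter (MeasurableSet.inter ?_ ?_)
      · exact (isOpen_lt (by fun_prop) (by fun_prop :
          Continuous fun q : Plane => inner ℝ q (leftNormal γ))).measurableSet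
      · exact (isOpen_lt (by fun_prop : Continuous fun q : Plane =>
          inner ℝ q (leftNormal (γ + σ * T : ℝ))) (by fun_prop)).measurableSet
  rw [← hLε, ← hsector]
  refine lintegral_sq_le hL hLc h0 hcpos hchord (by rw [hLε, hLV]; exact hsmall) hT hTπ
    (F := fun t => chordLength K (γ + σ * t : ℝ) (capHeight K 1 (γ + σ * t : ℝ)))
    (fun t => measureReal_nonneg) ?_ (by rw [hLε]; exact hε)
  intro t _
  refine ⟨capHeight K 1 (γ + σ * t : ℝ) - inner ℝ b (leftNormal (γ + σ * t : ℝ)), ?_, ?_⟩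
  · rw [areaBelow_frame hσ b γ hK, add_sub_cancel]
    exact volume_real_cap_capHeight hK zero_le_one hV _
  · rw [width_frame hσ b γ, add_sub_cancel]

end body

/-! ### The separating point of a gap -/

/-- A median of the density `F` on `[α, β]`. -/
lemma exists_median (F : ℝ → ℝ≥0∞) {α β : ℝ} (hαβ : α ≤ β) (hfin : ∫⁻ t in Icc α β, F t ≠ ∞) :
    ∃ γ ∈ Icc α β, (∫⁻ t in Icc α β, F t) / 2 ≤ ∫⁻ t in Icc α γ, F t ∧
      (∫⁻ t in Icc α β, F t) / 2 ≤ ∫⁻ t in Icc γ β, F t := by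
  set m := ∫⁻ t in Icc α β, F t with hm
  rcases eq_or_ne m 0 with h0 | h0
  · refine ⟨α, ⟨le_rfl, hαβ⟩, ?_, ?_⟩ <;> simp [h0]
  set ν := (volume.withDensity F).restrict (Icc α β)
  have hν : ∀ s, MeasurableSet s → ν s = ∫⁻ t in s ∩ Icc α β, F t := fun s hs => by
    rw [Measure.restrict_apply hs, withDensity_apply _ (hs.inter measurableSet_Icc)]
  have hνuniv : ν univ = m := by rw [hν _ MeasurableSet.univ, univ_inter]
  have : IsFiniteMeasure ν := ⟨by rw [hνuniv]; exact hfin.lt_top⟩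
  have hhalf : m / 2 < m := ENNReal.half_lt_self h0 hfin
  have hhalf0 : 0 < m / 2 := ENNReal.half_pos h0
  set S := {t : ℝ | ν (Iic t) < m / 2}
  have hlow : ∀ t < α, t ∈ S := by
    intro t ht
    have : Iic t ∩ Icc α β = ∅ := by
      ext x
      simp only [mem_inter_iff, mem_Iic, mem_Icc, mem_empty_iff_false, iff_false]
      rintro ⟨h1, h2, -⟩
      linarith
    simp only [S, mem_ofPred_eq]
    rw [hν _ measurableSet_Iic, this]
    simpa using hhalf0
  have hne : S.Nonempty := ⟨α - 1, hlow _ (by linarith)⟩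
  have hup : ∀ t ∈ S, t ≤ β := by
    intro t ht
    by_contra hcon
    push Not at hcon
    have : Iic t ∩ Icc α β = Icc α β :=
      inter_eq_right.2 fun x hx => hx.2.trans hcon.le
    simp only [S, mem_ofPred_eq] at ht
    rw [hν _ measurableSet_Iic, this] at ht
    exact absurd (ht.trans hhalf) (lt_irrefl _)
  have hbdd : BddAbove S := ⟨β, hup⟩
  set γ := sSup S
  have hγβ : γ ≤ β := csSup_le hne hup
  have hαγ : α ≤ γ := le_of_forall_lt fun t ht => by
    obtain ⟨u, htu, huα⟩ := exists_between ht
    exact htu.trans_le (le_csSup hbdd (hlow u huα))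
  have hIic : m / 2 ≤ ν (Iic γ) := by
    have hInter : Iic γ = ⋂ n : ℕ, Iic (γ + 1 / ((n : ℝ) + 1)) := by
      ext x
      simp only [mem_Iic, mem_iInter]
      constructor
      · intro h n
        have : 0 < 1 / ((n : ℝ) + 1) := Nat.one_div_pos_of_nat
        linarith
      · intro h
        by_contra hcon
        push Not at hcon
        obtain ⟨n, hn⟩ := exists_nat_one_div_lt (sub_pos.2 hcon)
        linarith [h n]
    have hanti : Antitone fun n : ℕ => Iic (γ + 1 / ((n : ℝ) + 1)) := by
      intro i j hij
      exact Iic_subset_Iic.2 (add_le_add le_rfl (Nat.one_div_le_one_div hij))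
    rw [hInter, hanti.measure_iInter (fun n => measurableSet_Iic.nullMeasurableSet)
      ⟨0, measure_ne_top _ _⟩]
    refine le_iInf fun n => ?_
    by_contra hcon
    push Not at hcon
    have : 0 < 1 / ((n : ℝ) + 1) := Nat.one_div_pos_of_nat
    linarith [le_csSup hbdd (show γ + 1 / ((n : ℝ) + 1) ∈ S from hcon)]
  have hIio : ν (Iio γ) ≤ m / 2 := by
    have hUnion : Iio γ = ⋃ n : ℕ, Iic (γ - 1 / ((n : ℝ) + 1)) := by
      ext x
      simp only [mem_Iic, mem_iUnion, mem_Iio]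
      constructor
      · intro h
        obtain ⟨n, hn⟩ := exists_nat_one_div_lt (sub_pos.2 h)
        exact ⟨n, by linarith⟩
      · rintro ⟨n, hn⟩
        have : 0 < 1 / ((n : ℝ) + 1) := Nat.one_div_pos_of_nat
        linarith
    have hmono : Monotone fun n : ℕ => Iic (γ - 1 / ((n : ℝ) + 1)) := by
      intro i j hij
      exact Iic_subset_Iic.2 (sub_le_sub le_rfl (Nat.one_div_le_one_div hij))
    rw [hUnion, hmono.measure_iUnion]
    refine iSup_le fun n => ?_
    have : 0 < 1 / ((n : ℝ) + 1) := Nat.one_div_pos_of_nat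
    obtain ⟨s, hs, hlt⟩ := exists_lt_of_lt_csSup hne
      (show γ - 1 / ((n : ℝ) + 1) < sSup S by change _ < γ; linarith)
    exact (measure_mono (Iic_subset_Iic.2 hlt.le)).trans (le_of_lt hs)
  have hIci : m / 2 ≤ ν (Ici γ) := by
    have h1 : m ≤ ν (Iio γ) + ν (Ici γ) := by
      rw [← hνuniv, ← Iio_union_Ici (a := γ)]
      exact measure_union_le _ _
    have h2 : m / 2 + m / 2 ≤ m / 2 + ν (Ici γ) := by
      rw [ENNReal.add_halves]
      exact h1.trans (add_le_add hIio le_rfl)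
    exact (ENNReal.add_le_add_iff_left (ne_top_of_lt hhalf)).1 h2
  refine ⟨γ, ⟨hαγ, hγβ⟩, ?_, ?_⟩
  · rw [hν _ measurableSet_Iic] at hIic
    refine hIic.trans (lintegral_mono_set fun x hx => ⟨hx.2.1, hx.1⟩)
  · rw [hν _ measurableSet_Ici] at hIci
    refine hIci.trans (lintegral_mono_set fun x hx => ⟨hx.1, hx.2.2⟩)

lemma setLIntegral_Icc_eq_right (F : ℝ → ℝ≥0∞) (γ β : ℝ) :
    ∫⁻ t in Icc γ β, F t = ∫⁻ t in Ioo 0 (β - γ), F (γ + 1 * t) := by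
  rw [← setLIntegral_congr Ioo_ae_eq_Icc]
  have h := (measurePreserving_add_left (volume : Measure ℝ) γ).setLIntegral_comp_preimage_emb
    (MeasurableEquiv.addLeft γ).measurableEmbedding F (Ioo γ β)
  rw [← h]
  simp

lemma setLIntegral_Icc_eq_left (F : ℝ → ℝ≥0∞) (α γ : ℝ) :
    ∫⁻ t in Icc α γ, F t = ∫⁻ t in Ioo 0 (γ - α), F (γ + -1 * t) := by
  rw [← setLIntegral_congr Ioo_ae_eq_Icc]
  have h := (Measure.measurePreserving_sub_left (volume : Measure ℝ)
    γ).setLIntegral_comp_preimage_emb (MeasurableEquiv.subLeft γ).measurableEmbedding F (Ioo α γ)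
  rw [← h, preimage_const_sub_Ioo, sub_self]
  simp only [neg_one_mul, ← sub_eq_add_neg]

/-- The frontier of a convex set is negligible, so `K` may be replaced by its closure, which is
compact if `K` is bounded. -/
lemma volume_inter_closure {K : Set Plane} (hc : Convex ℝ K) (s : Set Plane) :
    volume (closure K ∩ s) = volume (K ∩ s) := by
  refine le_antisymm ?_ (measure_mono (inter_subset_inter_left s subset_closure))
  have hsub : closure K ∩ s ⊆ (K ∩ s) ∪ frontier K := by
    intro x hx
    by_cases h : x ∈ K
    · exact Or.inl ⟨h, hx.2⟩
    · exact Or.inr ⟨hx.1, fun h' => h (interior_subset h')⟩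
  refine (measure_mono hsub).trans ((measure_union_le _ _).trans ?_)
  rw [hc.addHaar_frontier volume, add_zero]

lemma volume_real_inter_closure {K : Set Plane} (hc : Convex ℝ K) (s : Set Plane) :
    volume.real (closure K ∩ s) = volume.real (K ∩ s) := by
  rw [measureReal_def, measureReal_def, volume_inter_closure hc]

lemma volume_real_closure {K : Set Plane} (hc : Convex ℝ K) :
    volume.real (closure K) = volume.real K := by
  simpa using volume_real_inter_closure hc univ

lemma capChord_le_closure {K : Set Plane} (hc : Convex ℝ K) (hb : Bornology.IsBounded K) (θ : ℝ) :
    capChord K (exp (-1)) θ ≤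
      chordLength (closure K) θ (capHeight (closure K) 1 θ) := by
  unfold capChord
  split_ifs
  · have h1 : log (1 / exp (-1)) = 1 := by rw [one_div, ← exp_neg, neg_neg, log_exp]
    have h2 : capHeight (closure K) 1 θ = capHeight K 1 θ := by
      unfold capHeight cap
      simp_rw [volume_real_inter_closure hc]
    rw [h1, h2]
    refine measureReal_mono (fun s hs => subset_closure hs) ?_
    have hw := width_frame (K := closure K) (one_pow 2) 0 θ 0 (capHeight K 1 θ)
    have hcomp := isCompact_preimage_rot
      (isCompact_preimage_frame (one_pow 2) 0 θ hb.isCompact_closure) 0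
    have := (isCompact_slice hcomp (capHeight K 1 θ)).measure_lt_top (μ := volume)
    have e : {x : ℝ | (x, capHeight K 1 θ) ∈ rot 0 ⁻¹' (frame 0 θ 1 ⁻¹' closure K)} =
        {s : ℝ | capHeight K 1 θ • leftNormal θ + s • direction θ ∈ closure K} := by
      ext s
      simp only [mem_ofPred_eq, mem_preimage, frame_rot (one_pow 2)]
      simp
    rw [← e]
    exact this.ne
  · exact measureReal_nonneg

lemma capChord_nonneg (K : Set Plane) (x : ℝ) (θ : Real.Angle) : 0 ≤ capChord K x θ := by
  unfold capChord
  split_ifs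
  · exact measureReal_nonneg
  · exact le_rfl

lemma capChord_eq_zero {K : Set Plane} (hV : volume.real K ≤ 1) (θ : Real.Angle) :
    capChord K (exp (-1)) θ = 0 := by
  unfold capChord
  rw [if_neg]
  rw [exp_lt_exp]
  linarith

lemma log_one_add_div_exp_neg_le {g a : ℝ} (hg : 0 ≤ g) (ha : 0 ≤ a) :
    log (1 + g / exp (-a)) ≤ a + g := by
  have h1 : 1 + g / exp (-a) ≤ exp a * (1 + g) := by
    rw [exp_neg, div_inv_eq_mul]
    nlinarith [one_le_exp ha]
  have h2 : 0 < 1 + g / exp (-a) := by positivity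
  calc log (1 + g / exp (-a)) ≤ log (exp a * (1 + g)) := log_le_log h2 h1
    _ = a + log (1 + g) := by rw [log_mul (exp_pos a).ne' (by linarith), log_exp]
    _ ≤ a + g := by
      have := log_le_sub_one_of_pos (x := 1 + g) (by linarith)
      linarith

/-- The integral of `f_K(e⁻¹, ·)²` over an interval of real lifts. -/
def chordMass (K : Set Plane) (α β : ℝ) : ℝ≥0∞ :=
  ∫⁻ t in Icc α β, ENNReal.ofReal (capChord K (exp (-1)) (t : Real.Angle) ^ 2)

/-- An interval of angles of large affine invariant measure contains an angle `γ` with a chord which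
cuts off a very small cap of `K`, such that the midpoint `b` of the chord sees a large area of `K`
both in the angular sector left out by the half-planes at the angles `α` and `γ`, and in the sector
left out by those at `γ` and `β`. The constants are `11264 = 4 * 2816` and `22528 = 8 * 2816`, where
`2816` is the constant of `lintegral_chordLength_sq_le`, and `33792 = 3 * 11264`, which makes the
area of the cap at most `exp (-3) < 1 / 9`. -/
lemma exists_separating_point {K : Set Plane} (hc : Convex ℝ K) (hb : Bornology.IsBounded K)
    {α β : ℝ} (hαβ : α ≤ β) (hβα : β ≤ α + π) (hm : 33792 ≤ (chordMass K α β).toReal) :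
    ∃ γ : ℝ, ∃ b : Plane, α < γ ∧ γ < β ∧
      volume.real (K ∩ {q | inner ℝ q (leftNormal γ) ≤ inner ℝ b (leftNormal γ)}) ≤
        exp (-((chordMass K α β).toReal / 11264)) ∧
      (chordMass K α β).toReal / 22528 ≤ volume.real (K ∩ {q | inner ℝ b (leftNormal γ) <
        inner ℝ q (leftNormal γ) ∧ inner ℝ q (leftNormal α) < inner ℝ b (leftNormal α)}) ∧
      (chordMass K α β).toReal / 22528 ≤ volume.real (K ∩ {q | inner ℝ b (leftNormal γ) <
        inner ℝ q (leftNormal γ) ∧ inner ℝ q (leftNormal β) < inner ℝ b (leftNormal β)}) := by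
  set m := (chordMass K α β).toReal with hmdef
  have hKc : IsCompact (closure K) := hb.isCompact_closure
  have hKconv : Convex ℝ (closure K) := hc.closure
  have hfin : chordMass K α β ≠ ∞ := by
    intro h
    rw [hmdef, h] at hm
    norm_num at hm
  have hm0 : m ≠ 0 := by linarith
  -- The affine invariant measure vanishes if the area of `K` is at most `1`.
  have hV : 1 < volume.real K := by
    by_contra hcon
    push Not at hcon
    apply hm0
    simp [hmdef, chordMass, capChord_eq_zero hcon]
  have hVc : 1 < volume.real (closure K) := by rwa [volume_real_closure hc]
  set ε := exp (-(m / 11264)) with hε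
  have hεpos : 0 < ε := exp_pos _
  have hεsmall : 9 * ε < 1 := by
    have h1 : ε ≤ exp (-3) := exp_le_exp.2 (by linarith)
    have h2 : (9 : ℝ) < exp 3 := by
      have h3 : exp 3 = exp 1 ^ 3 := by rw [← exp_nat_mul]; norm_num
      have h4 : (2.7 : ℝ) ^ 3 ≤ exp 1 ^ 3 :=
        pow_le_pow_left₀ (by norm_num) (by linarith [exp_one_gt_d9]) 3
      rw [h3]
      norm_num at h4 ⊢
      linarith
    have h5 : exp (-3) * exp 3 = 1 := by rw [← exp_add]; norm_num
    have h6 : 0 < exp (-3 : ℝ) := exp_pos _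
    nlinarith
  obtain ⟨γ, hγ, hleft, hright⟩ := exists_median
    (fun t => ENNReal.ofReal (capChord K (exp (-1)) (t : Real.Angle) ^ 2)) hαβ hfin
  have hhalf : 0 < chordMass K α β / 2 := by
    refine ENNReal.half_pos fun h => ?_
    rw [hmdef, h] at hm0
    simp at hm0
  have hαγ : α < γ := by
    rcases hγ.1.eq_or_lt with h | h
    · rw [← h] at hleft
      simp only [Icc_self, Measure.restrict_singleton, Real.volume_singleton, zero_smul,
        lintegral_zero_measure] at hleft
      exact absurd (hhalf.trans_le hleft) (lt_irrefl _)
    · exact h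
  have hγβ : γ < β := by
    rcases hγ.2.eq_or_lt with h | h
    · rw [h] at hright
      simp only [Icc_self, Measure.restrict_singleton, Real.volume_singleton, zero_smul,
        lintegral_zero_measure] at hright
      exact absurd (hhalf.trans_le hright) (lt_irrefl _)
    · exact h
  obtain ⟨b, hbi, c, hcpos, hcap, hchord⟩ :=
    exists_midpoint_cap_chord hKc hKconv hεpos (by linarith : ε < volume.real (closure K)) γ
  -- The common conclusion for both directions of rotation.
  have side : ∀ σ T : ℝ, σ ^ 2 = 1 → 0 < T → T ≤ π →
      chordMass K α β / 2 ≤ ∫⁻ t in Ioo 0 T,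
        ENNReal.ofReal (capChord K (exp (-1)) ((γ + σ * t : ℝ) : Real.Angle) ^ 2) →
      m / 22528 ≤ volume.real (K ∩ {q | inner ℝ b (leftNormal γ) < inner ℝ q (leftNormal γ) ∧
        inner ℝ q (leftNormal (γ + σ * T : ℝ)) < inner ℝ b (leftNormal (γ + σ * T : ℝ))}) := by
    intro σ T hσ hT hTπ hle
    have h1 := lintegral_chordLength_sq_le hKc hKconv hVc hbi hσ hcpos (hchord σ hσ)
      (by rw [hcap]; exact hεpos) (by rw [hcap]; linarith) hT hTπ
    rw [hcap, volume_real_inter_closure hc] at h1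
    set g := volume.real (K ∩ {q | inner ℝ b (leftNormal γ) < inner ℝ q (leftNormal γ) ∧
        inner ℝ q (leftNormal (γ + σ * T : ℝ)) < inner ℝ b (leftNormal (γ + σ * T : ℝ))})
    have hg : 0 ≤ g := measureReal_nonneg
    have h2 : ∫⁻ t in Ioo 0 T,
        ENNReal.ofReal (capChord K (exp (-1)) ((γ + σ * t : ℝ) : Real.Angle) ^ 2) ≤
        ∫⁻ t in Ioo 0 T, ENNReal.ofReal (chordLength (closure K) (γ + σ * t : ℝ)
          (capHeight (closure K) 1 (γ + σ * t : ℝ)) ^ 2) :=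
      lintegral_mono fun t => ENNReal.ofReal_le_ofReal
        (pow_le_pow_left₀ (capChord_nonneg _ _ _) (capChord_le_closure hc hb _) 2)
    have h3 := log_one_add_div_exp_neg_le hg (by linarith : 0 ≤ m / 11264)
    have h4 := (hle.trans h2).trans h1
    have h5 := ENNReal.toReal_mono ENNReal.ofReal_ne_top h4
    have h6 : 0 ≤ log (1 + g / ε) := log_nonneg (by
      have : 0 ≤ g / ε := by positivity
      linarith)
    rw [ENNReal.toReal_div, ENNReal.toReal_ofReal (by positivity)] at h5
    change m / 2 ≤ _ at h5
    linarith
  refine ⟨γ, b, hαγ, hγβ, ?_, ?_, ?_⟩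
  · rw [← volume_real_inter_closure hc]
    exact hcap.le
  · have := side (-1) (γ - α) (by norm_num) (by linarith) (by linarith [hγ.2])
      (by rw [← setLIntegral_Icc_eq_left
        (fun t => ENNReal.ofReal (capChord K (exp (-1)) (t : Real.Angle) ^ 2))]; exact hleft)
    rwa [show γ + -1 * (γ - α) = α by ring] at this
  · have := side 1 (β - γ) (by norm_num) (by linarith) (by linarith [hγ.1])
      (by rw [← setLIntegral_Icc_eq_right
        (fun t => ENNReal.ofReal (capChord K (exp (-1)) (t : Real.Angle) ^ 2))]; exact hright)
    rwa [show γ + 1 * (β - γ) = β by ring] at this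

/-! ### Support vertices of a random configuration -/

lemma eq_of_inner_eq {p q : Plane} {θ : Real.Angle}
    (h1 : inner ℝ p (leftNormal θ) = inner ℝ q (leftNormal θ))
    (h2 : inner ℝ p (direction θ) = inner ℝ q (direction θ)) : p = q := by
  simp only [leftNormal, direction, PiLp.inner_apply, Fin.sum_univ_two] at h1 h2
  simp at h1 h2
  have h3 := Real.Angle.cos_sq_add_sin_sq θ
  ext i
  fin_cases i
  · simp only [Fin.zero_eta]
    linear_combination (-θ.sin) * h1 + θ.cos * h2 - (p 0 - q 0) * h3
  · simp only [Fin.mk_one]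
    linear_combination θ.cos * h1 + θ.sin * h2 - (p 1 - q 1) * h3

/-- The vertex with an oriented tangent line at angle `θ` is the lexicographically first point of
the configuration. -/
lemma supportVertex_eq_some_iff {Y : Finset Plane} {θ : Real.Angle} {p : Plane} :
    supportVertex (polygon Y) θ = some p ↔ p ∈ Y ∧ ∀ q ∈ Y,
      inner ℝ p (leftNormal θ) ≤ inner ℝ q (leftNormal θ) ∧
      (inner ℝ q (leftNormal θ) = inner ℝ p (leftNormal θ) →
        inner ℝ q (direction θ) ≤ inner ℝ p (direction θ)) := by
  have hsub : (Y : Set Plane) ⊆ polygon Y := subset_convexHull ℝ _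
  have key : ∀ p, IsSupportVertex (polygon Y) θ p → p ∈ Y ∧ ∀ q ∈ Y,
      inner ℝ p (leftNormal θ) ≤ inner ℝ q (leftNormal θ) ∧
      (inner ℝ q (leftNormal θ) = inner ℝ p (leftNormal θ) →
        inner ℝ q (direction θ) ≤ inner ℝ p (direction θ)) := fun p hp =>
    ⟨extremePoints_convexHull_subset hp.vertex,
      fun q hq => ⟨hp.tangent q (hsub hq), hp.last q (hsub hq)⟩⟩
  constructor
  · intro h
    unfold supportVertex at h
    split_ifs at h with hex
    obtain rfl := Option.some.inj h
    exact key _ hex.choose_spec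
  · rintro ⟨hp, hmin⟩
    have hex : ∃ p, IsSupportVertex (polygon Y) θ p := exists_isSupportVertex ⟨p, hp⟩ θ
    unfold supportVertex
    rw [dif_pos hex]
    obtain ⟨h1, h2⟩ := key _ hex.choose_spec
    have e1 := le_antisymm (hmin _ h1).1 (h2 _ hp).1
    congr 1
    exact eq_of_inner_eq e1.symm
      (le_antisymm ((hmin _ h1).2 e1.symm) ((h2 _ hp).2 e1))

lemma exists_supportVertex_eq_some {Y : Finset Plane} (hY : Y.Nonempty) (θ : Real.Angle) :
    ∃ p, supportVertex (polygon Y) θ = some p := by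
  have hex : ∃ p, IsSupportVertex (polygon Y) θ p := exists_isSupportVertex hY θ
  exact ⟨hex.choose, by unfold supportVertex; rw [dif_pos hex]⟩

lemma supportVertex_empty (θ : Real.Angle) : supportVertex (polygon ∅) θ = none := by
  rcases h : supportVertex (polygon ∅) θ with _ | p
  · rfl
  · simp [supportVertex_eq_some_iff] at h

open scoped Classical in
/-- Points which are not minimal in the direction of the normal can be removed. -/
lemma supportVertex_filter {Y : Finset Plane} {θ : Real.Angle} {S : Set Plane}
    (h : ∀ q ∈ Y, q ∉ S → ∃ p ∈ Y, p ∈ S ∧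
      inner ℝ p (leftNormal θ) < inner ℝ q (leftNormal θ)) :
    supportVertex (polygon (Y.filter (· ∈ S))) θ = supportVertex (polygon Y) θ := by
  by_cases hne : (Y.filter (· ∈ S)).Nonempty
  · obtain ⟨p, hp⟩ := exists_supportVertex_eq_some hne θ
    rw [hp, eq_comm, supportVertex_eq_some_iff]
    obtain ⟨hpY, hmin⟩ := supportVertex_eq_some_iff.1 hp
    refine ⟨(Finset.mem_filter.1 hpY).1, fun q hq => ?_⟩
    by_cases hqS : q ∈ S
    · exact hmin q (Finset.mem_filter.2 ⟨hq, hqS⟩)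
    · obtain ⟨p', hp', hp'S, hlt⟩ := h q hq hqS
      have := (hmin p' (Finset.mem_filter.2 ⟨hp', hp'S⟩)).1
      exact ⟨by linarith, fun heq => by linarith⟩
  · have hY : Y = ∅ := by
      rw [Finset.not_nonempty_iff_eq_empty, Finset.filter_eq_empty_iff] at hne
      rw [Finset.eq_empty_iff_forall_notMem]
      intro q hq
      obtain ⟨p, hp, hpS, -⟩ := h q hq (hne hq)
      exact hne hp hpS
    simp [hY]

section process

variable {Ω : Type*} (X : Ω → Finset Plane)

open scoped Classical in
/-- The points of the configuration which lie in `S`. -/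
def restrictTo (S : Set Plane) (ω : Ω) : Finset Plane := (X ω).filter (· ∈ S)

/-- The number of points of the configuration in `s`. -/
def count (s : Set Plane) (ω : Ω) : ℕ := ((X ω : Set Plane) ∩ s).ncard

/-- The `σ`-algebra of the events which depend on the points in `S` only: it is generated by the
numbers of points in the Borel subsets of `S`. -/
@[reducible] def countSigma (S : Set Plane) : MeasurableSpace Ω :=
  ⨆ s : {s : Set Plane // MeasurableSet s ∧ s ⊆ S}, MeasurableSpace.comap (count X s) ⊤

variable {X}

lemma measurableSet_exists_mem {S s : Set Plane} (hs : MeasurableSet s) (hsS : s ⊆ S) :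
    MeasurableSet[countSigma X S] {ω | ∃ p ∈ X ω, p ∈ s} := by
  have h : MeasurableSet[MeasurableSpace.comap (count X s) ⊤] {ω | ∃ p ∈ X ω, p ∈ s} := by
    refine ⟨{0}ᶜ, trivial, ?_⟩
    ext ω
    simp only [count, preimage_compl, mem_compl_iff, mem_preimage, mem_singleton_iff,
      mem_ofPred_eq]
    rw [Set.ncard_eq_zero ((X ω).finite_toSet.inter_of_left s), ← ne_eq,
      ← Set.nonempty_iff_ne_empty]
    rfl
  exact (le_iSup (fun s : {s : Set Plane // MeasurableSet s ∧ s ⊆ S} =>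
    MeasurableSpace.comap (count X s) ⊤) ⟨s, hs, hsS⟩) _ h

lemma exists_rat_between (x : ℝ) (F : Finset ℝ) (h : ∀ y ∈ F, x < y) :
    ∃ a : ℚ, x < a ∧ ∀ y ∈ F, (a : ℝ) < y := by
  obtain ⟨b, hb, hF⟩ := Order.exists_between_finsets (lo := {x}) (hi := F)
    (by simpa using h)
  obtain ⟨a, ha, hab⟩ := exists_rat_btwn (hb x (Finset.mem_singleton_self x))
  exact ⟨a, ha, fun y hy => hab.trans (hF y hy)⟩

lemma exists_rat_between' (x : ℝ) (F : Finset ℝ) (h : ∀ y ∈ F, y < x) :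
    ∃ a : ℚ, (a : ℝ) < x ∧ ∀ y ∈ F, y < a := by
  obtain ⟨b, hF, hb⟩ := Order.exists_between_finsets (lo := F) (hi := {x})
    (by simpa using h)
  obtain ⟨a, ha, hab⟩ := exists_rat_btwn (hb x (Finset.mem_singleton_self x))
  exact ⟨a, hab, fun y hy => (hF y hy).trans ha⟩

/-- A description of the event that the lexicographically first point lies in `D` by means of
countably many events which tell whether there are points in certain Borel sets. -/
lemma exists_supportVertex_mem_iff (Y : Finset Plane) (θ : Real.Angle) (D : Set Plane) :
    (∃ p ∈ D, supportVertex (polygon Y) θ = some p) ↔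
    ∃ c : ℚ, (∀ a : ℚ, (∃ q ∈ Y, inner ℝ q (leftNormal θ) < a) →
        ∃ q ∈ Y, q ∈ D ∧ c < inner ℝ q (direction θ) ∧ inner ℝ q (leftNormal θ) < a) ∧
      ∃ a : ℚ, (∃ q ∈ Y, q ∈ D ∧ c < inner ℝ q (direction θ) ∧ inner ℝ q (leftNormal θ) < a) ∧
        ¬ ∃ q ∈ Y, q ∉ D ∧ c < inner ℝ q (direction θ) ∧ inner ℝ q (leftNormal θ) < a := by
  classical
  constructor
  · rintro ⟨p, hpD, hp⟩
    obtain ⟨hpY, hmin⟩ := supportVertex_eq_some_iff.1 hp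
    obtain ⟨c, hcp, hc⟩ := exists_rat_between' (inner ℝ p (direction θ))
      ((Y.filter fun q => q ∉ D ∧ inner ℝ q (leftNormal θ) = inner ℝ p (leftNormal θ)).image
        fun q => inner ℝ q (direction θ)) (by
        intro y hy
        obtain ⟨q, hq, rfl⟩ := Finset.mem_image.1 hy
        obtain ⟨hqY, hqD, heq⟩ := Finset.mem_filter.1 hq
        refine lt_of_le_of_ne ((hmin q hqY).2 heq) fun h => hqD ?_
        rw [eq_of_inner_eq heq h]
        exact hpD)
    obtain ⟨a, hap, ha⟩ := exists_rat_between (inner ℝ p (leftNormal θ))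
      ((Y.filter fun q => q ∉ D ∧ c < inner ℝ q (direction θ)).image
        fun q => inner ℝ q (leftNormal θ)) (by
        intro y hy
        obtain ⟨q, hq, rfl⟩ := Finset.mem_image.1 hy
        obtain ⟨hqY, hqD, hqc⟩ := Finset.mem_filter.1 hq
        refine lt_of_le_of_ne (hmin q hqY).1 fun h => ?_
        have := hc _ (Finset.mem_image_of_mem _ (Finset.mem_filter.2 ⟨hqY, hqD, h.symm⟩))
        linarith)
    refine ⟨c, ?_, a, ⟨p, hpY, hpD, hcp, hap⟩, ?_⟩
    · rintro a' ⟨q, hq, hqa⟩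
      exact ⟨p, hpY, hpD, hcp, (hmin q hq).1.trans_lt hqa⟩
    · rintro ⟨q, hq, hqD, hqc, hqa⟩
      have := ha _ (Finset.mem_image_of_mem _ (Finset.mem_filter.2 ⟨hq, hqD, hqc⟩))
      linarith
  · rintro ⟨c, h1, a, ⟨p₁, hp₁, -, -, hp₁a⟩, h2⟩
    obtain ⟨p, hp⟩ := exists_supportVertex_eq_some ⟨p₁, hp₁⟩ θ
    obtain ⟨hpY, hmin⟩ := supportVertex_eq_some_iff.1 hp
    refine ⟨p, ?_, hp⟩
    by_contra hpD
    obtain ⟨p₀, hp₀, hp₀c, hle⟩ : ∃ q ∈ Y, c < inner ℝ q (direction θ) ∧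
        inner ℝ q (leftNormal θ) ≤ inner ℝ p (leftNormal θ) := by
      by_contra hcon
      push Not at hcon
      obtain ⟨a', ha'p, ha'⟩ := exists_rat_between (inner ℝ p (leftNormal θ))
        ((Y.filter fun q => c < inner ℝ q (direction θ)).image
          fun q => inner ℝ q (leftNormal θ)) (by
          intro y hy
          obtain ⟨q, hq, rfl⟩ := Finset.mem_image.1 hy
          obtain ⟨hqY, hqc⟩ := Finset.mem_filter.1 hq
          exact hcon q hqY hqc)
      obtain ⟨q, hq, -, hqc, hqa⟩ := h1 a' ⟨p, hpY, ha'p⟩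
      have := ha' _ (Finset.mem_image_of_mem _ (Finset.mem_filter.2 ⟨hq, hqc⟩))
      linarith
    have heq := le_antisymm hle (hmin p₀ hp₀).1
    exact h2 ⟨p, hpY, hpD, hp₀c.trans_le ((hmin p₀ hp₀).2 heq),
      (hmin p₁ hp₁).1.trans_lt hp₁a⟩

/-- The support vertices of the points in `S` depend measurably on the points in `S`. -/
lemma supportSigmaAlgebra_restrictTo_le {S : Set Plane} (hS : MeasurableSet S)
    (Θ : Set Real.Angle) : supportSigmaAlgebra (restrictTo X S) Θ ≤ countSigma X S := by
  refine iSup₂_le fun θ _ => ?_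
  rintro _ ⟨E, hE, rfl⟩
  set D : Set Plane := some ⁻¹' E
  have hD : MeasurableSet D := hE
  have hN : ∀ a : ℚ, MeasurableSet {q : Plane | inner ℝ q (leftNormal θ) < a} := fun a =>
    (isOpen_lt (by fun_prop) continuous_const).measurableSet
  have hT : ∀ c : ℚ, MeasurableSet {q : Plane | c < inner ℝ q (direction θ)} := fun c =>
    (isOpen_lt continuous_const (by fun_prop)).measurableSet
  -- The events that there are points in certain subsets of `S`.
  have hocc : ∀ s : Set Plane, MeasurableSet s →
      MeasurableSet[countSigma X S] {ω | ∃ q ∈ restrictTo X S ω, q ∈ s} := by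
    intro s hs
    have := measurableSet_exists_mem (X := X) (hS.inter hs) inter_subset_left
    convert this using 1
    ext ω
    simp only [restrictTo, mem_ofPred_eq, Finset.mem_filter, mem_inter_iff, and_assoc]
  have hsome : MeasurableSet[countSigma X S]
      {ω | ∃ p ∈ D, W (restrictTo X S) θ ω = some p} := by
    simp only [W, exists_supportVertex_mem_iff]
    have e : {ω | ∃ c : ℚ,
        (∀ a : ℚ, (∃ q ∈ restrictTo X S ω, inner ℝ q (leftNormal θ) < a) →
          ∃ q ∈ restrictTo X S ω, q ∈ D ∧ c < inner ℝ q (direction θ) ∧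
            inner ℝ q (leftNormal θ) < a) ∧
        ∃ a : ℚ, (∃ q ∈ restrictTo X S ω, q ∈ D ∧ c < inner ℝ q (direction θ) ∧
            inner ℝ q (leftNormal θ) < a) ∧
          ¬ ∃ q ∈ restrictTo X S ω, q ∉ D ∧ c < inner ℝ q (direction θ) ∧
            inner ℝ q (leftNormal θ) < a} =
        ⋃ c : ℚ, (⋂ a : ℚ, ({ω | ∃ q ∈ restrictTo X S ω,
            q ∈ {q : Plane | inner ℝ q (leftNormal θ) < a}}ᶜ ∪
          {ω | ∃ q ∈ restrictTo X S ω, q ∈ D ∩ ({q : Plane | c < inner ℝ q (direction θ)} ∩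
            {q : Plane | inner ℝ q (leftNormal θ) < a})})) ∩
        ⋃ a : ℚ, ({ω | ∃ q ∈ restrictTo X S ω, q ∈ D ∩ ({q : Plane | c < inner ℝ q (direction θ)} ∩
            {q : Plane | inner ℝ q (leftNormal θ) < a})} ∩
          {ω | ∃ q ∈ restrictTo X S ω, q ∈ Dᶜ ∩ ({q : Plane | c < inner ℝ q (direction θ)} ∩
            {q : Plane | inner ℝ q (leftNormal θ) < a})}ᶜ) := by
      ext ω
      simp only [mem_ofPred_eq, mem_iUnion, mem_inter_iff, mem_iInter, mem_union, mem_compl_iff,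
        imp_iff_not_or]
    rw [e]
    exact MeasurableSet.iUnion fun c => MeasurableSet.inter
      (MeasurableSet.iInter fun a => MeasurableSet.union (hocc _ (hN a)).compl
        (hocc _ (hD.inter ((hT c).inter (hN a)))))
      (MeasurableSet.iUnion fun a => MeasurableSet.inter
        (hocc _ (hD.inter ((hT c).inter (hN a))))
        (hocc _ (hD.compl.inter ((hT c).inter (hN a)))).compl)
  by_cases hnone : none ∈ E
  · have e : W (restrictTo X S) θ ⁻¹' E = {ω | ∃ p ∈ D, W (restrictTo X S) θ ω = some p} ∪
        {ω | ∃ q ∈ restrictTo X S ω, q ∈ (univ : Set Plane)}ᶜ := by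
      ext ω
      simp only [mem_preimage, mem_union, mem_ofPred_eq, mem_compl_iff, mem_univ, and_true]
      constructor
      · intro h
        rcases hW : W (restrictTo X S) θ ω with _ | p
        · right
          rintro ⟨q, hq⟩
          obtain ⟨p, hp⟩ := exists_supportVertex_eq_some ⟨q, hq⟩ θ
          rw [W, hp] at hW
          cases hW
        · rw [hW] at h
          exact Or.inl ⟨p, h, rfl⟩
      · rintro (⟨p, hp, hW⟩ | h)
        · rw [hW]; exact hp
        · have : restrictTo X S ω = ∅ := by
            rw [Finset.eq_empty_iff_forall_notMem]
            exact fun q hq => h ⟨q, hq⟩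
          rw [W, this, supportVertex_empty]
          exact hnone
    rw [e]
    exact MeasurableSet.union hsome (hocc _ MeasurableSet.univ).compl
  · have e : W (restrictTo X S) θ ⁻¹' E = {ω | ∃ p ∈ D, W (restrictTo X S) θ ω = some p} := by
      ext ω
      simp only [mem_preimage, mem_ofPred_eq]
      constructor
      · intro h
        rcases hW : W (restrictTo X S) θ ω with _ | p
        · rw [hW] at h; exact absurd h hnone
        · rw [hW] at h
          exact ⟨p, h, rfl⟩
      · rintro ⟨p, hp, hW⟩
        rw [hW]; exact hp
    rw [e]
    exact hsome

end process

/-! ### Independence of the configurations in disjoint regions -/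

section process

variable {Ω : Type*} {X : Ω → Finset Plane}

open scoped Classical in
/-- The cell of the partition of `S` generated by the sets in the family `I` which consists of the
points that lie in the members of `v` and in no other member of `I`. -/
def cell {S : Set Plane} (I v : Finset {s : Set Plane // MeasurableSet s ∧ s ⊆ S}) : Set Plane :=
  {x | x ∈ S ∧ I.filter (fun s => x ∈ s.1) = v}

lemma measurableSet_cell {S : Set Plane} (hS : MeasurableSet S)
    (I v : Finset {s : Set Plane // MeasurableSet s ∧ s ⊆ S}) : MeasurableSet (cell I v) := by
  classical
  by_cases hv : v ⊆ I
  · have e : cell I v = S ∩ ⋂ s ∈ I, {x | x ∈ s.1 ↔ s ∈ v} := by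
      ext x
      simp only [cell, mem_ofPred_eq, mem_inter_iff, mem_iInter]
      refine and_congr_right fun _ => ?_
      constructor
      · rintro rfl s hs
        simp [hs]
      · intro h
        ext s
        rw [Finset.mem_filter]
        exact ⟨fun hs => (h s hs.1).1 hs.2, fun hs => ⟨hv hs, (h s (hv hs)).2 hs⟩⟩
    rw [e]
    refine hS.inter (Finset.measurableSet_biInter I fun s _ => ?_)
    by_cases hsv : s ∈ v
    · simpa [hsv] using s.2.1
    · have e' : {x | x ∈ s.1 ↔ s ∈ v} = s.1ᶜ := by
        ext x
        simp [hsv]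
      rw [e']
      exact s.2.1.compl
  · have e : cell I v = ∅ := by
      ext x
      simp only [cell, mem_ofPred_eq, mem_empty_iff_false, iff_false, not_and]
      rintro - rfl
      exact hv (Finset.filter_subset _ _)
    rw [e]
    exact MeasurableSet.empty

lemma disjoint_cell {S : Set Plane} {I v w : Finset {s : Set Plane // MeasurableSet s ∧ s ⊆ S}}
    (h : v ≠ w) : Disjoint (cell I v) (cell I w) :=
  Set.disjoint_left.2 fun _ hx hy => h (hx.2.symm.trans hy.2)

open scoped Classical in
lemma count_eq_sum_cell {S : Set Plane} (I : Finset {s : Set Plane // MeasurableSet s ∧ s ⊆ S})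
    {s : {s : Set Plane // MeasurableSet s ∧ s ⊆ S}} (hs : s ∈ I) (ω : Ω) :
    count X s ω = ∑ v ∈ I.powerset.filter (fun v => s ∈ v), count X (cell I v) ω := by
  have hcard : ∀ t : Set Plane, count X t ω = ((X ω).filter (· ∈ t)).card := by
    intro t
    rw [count, ← Set.ncard_coe_finset]
    congr 1
    ext x
    simp
  simp only [hcard]
  rw [Finset.card_eq_sum_card_fiberwise (f := fun x => I.filter (fun s => x ∈ s.1))
    (t := I.powerset.filter (fun v => s ∈ v))]
  · refine Finset.sum_congr rfl fun v hv => ?_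
    congr 1
    ext x
    rw [Finset.mem_filter, Finset.mem_filter, Finset.mem_filter, cell, mem_ofPred_eq]
    obtain ⟨-, hsv⟩ := Finset.mem_filter.1 hv
    constructor
    · rintro ⟨⟨h1, h2⟩, h3⟩
      exact ⟨h1, s.2.2 h2, h3⟩
    · rintro ⟨h1, -, h3⟩
      refine ⟨⟨h1, ?_⟩, h3⟩
      rw [← h3] at hsv
      exact (Finset.mem_filter.1 hsv).2
  · intro x hx
    simp only [Finset.coe_filter, mem_ofPred_eq] at hx
    simp [hs, hx.2]

/-- An event generated by the support vertices at the angles in `Θ` agrees outside of `bad` with the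
same event for the points in `S` only, if the support vertices do. -/
lemma exists_event_restrictTo {Θ : Set Real.Angle} {S : Set Plane} {bad A : Set Ω}
    (h : ∀ ω ∉ bad, ∀ θ ∈ Θ, W X θ ω = W (restrictTo X S) θ ω)
    (hA : MeasurableSet[supportSigmaAlgebra X Θ] A) :
    ∃ A', MeasurableSet[supportSigmaAlgebra (restrictTo X S) Θ] A' ∧
      ∀ ω ∉ bad, (ω ∈ A ↔ ω ∈ A') := by
  let M : MeasurableSpace Ω :=
    { MeasurableSet' := fun A => ∃ A', MeasurableSet[supportSigmaAlgebra (restrictTo X S) Θ] A' ∧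
        ∀ ω ∉ bad, (ω ∈ A ↔ ω ∈ A')
      measurableSet_empty := ⟨∅, @MeasurableSet.empty _ (_), fun _ _ => Iff.rfl⟩
      measurableSet_compl := by
        rintro A ⟨A', hA', hAA⟩
        exact ⟨A'ᶜ, @MeasurableSet.compl _ _ (_) hA', fun ω hω => not_congr (hAA ω hω)⟩
      measurableSet_iUnion := by
        intro f hf
        choose g hg hfg using hf
        refine ⟨⋃ i, g i, @MeasurableSet.iUnion _ _ (_) _ _ hg, fun ω hω => ?_⟩
        simp only [mem_iUnion]
        exact exists_congr fun i => hfg i ω hω }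
  have hle : supportSigmaAlgebra X Θ ≤ M := by
    refine iSup₂_le fun θ hθ => ?_
    rintro _ ⟨E, hE, rfl⟩
    refine ⟨W (restrictTo X S) θ ⁻¹' E, ?_, fun ω hω => ?_⟩
    · have hgen : MeasurableSpace.comap (W (restrictTo X S) θ)
          (MeasurableSpace.map (some : Plane → Option Plane) inferInstance) ≤
          supportSigmaAlgebra (restrictTo X S) Θ :=
        le_iSup₂_of_le θ hθ le_rfl
      exact hgen _ ⟨E, hE, rfl⟩
    · rw [mem_preimage, mem_preimage, h ω hω θ hθ]
  exact hle A hA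

variable [MeasurableSpace Ω] {P : Measure Ω} {K : Set Plane}

lemma IsPoissonProcess.measurable_count' (hX : IsPoissonProcess P K X) {s : Set Plane}
    (hs : MeasurableSet s) : Measurable (count X s) := hX.measurable_count s hs

lemma countSigma_le (hX : IsPoissonProcess P K X) (S : Set Plane) :
    countSigma X S ≤ ‹MeasurableSpace Ω› :=
  iSup_le fun s => (hX.measurable_count' s.2.1).comap_le

/-- Two finite families of counting variables in disjoint regions are independent. -/
lemma indep_iSup_finset (hX : IsPoissonProcess P K X) {S T : Set Plane} (hS : MeasurableSet S)
    (hT : MeasurableSet T) (hST : Disjoint S T)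
    (I : Finset {s : Set Plane // MeasurableSet s ∧ s ⊆ S})
    (J : Finset {s : Set Plane // MeasurableSet s ∧ s ⊆ T}) :
    Indep (⨆ s ∈ I, MeasurableSpace.comap (count X s) ⊤)
      (⨆ s ∈ J, MeasurableSpace.comap (count X s) ⊤) P := by
  classical
  let ι := {v // v ∈ I.powerset} ⊕ {v // v ∈ J.powerset}
  let C : ι → Set Plane := Sum.elim (fun v => cell I v) (fun v => cell J v)
  have hC : ∀ i, MeasurableSet (C i) := by
    rintro (v | v)
    · exact measurableSet_cell hS I v
    · exact measurableSet_cell hT J v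
  have hdisj : ∀ i j, i ≠ j → Disjoint (C i) (C j) := by
    rintro (v | v) (w | w) hne
    · exact disjoint_cell fun h => hne (by rw [Subtype.ext h])
    · exact hST.mono (fun x hx => hx.1) (fun x hx => hx.1)
    · exact hST.symm.mono (fun x hx => hx.1) (fun x hx => hx.1)
    · exact disjoint_cell fun h => hne (by rw [Subtype.ext h])
  have hind : iIndepFun (fun (i : ι) => count X (C i)) P := by
    let e := Fintype.equivFin ι
    have h := hX.indep_count (Fintype.card ι) (fun k => C (e.symm k)) (fun k => hC _)
      (fun k l hkl => hdisj _ _ fun h => hkl (e.symm.injective h))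
    have h2 := h.precomp (g := e) e.injective
    simp only [Equiv.symm_apply_apply] at h2
    exact h2
  have hpair := hind.indepFun_finset (Finset.univ.map ⟨Sum.inl, Sum.inl_injective⟩)
    (Finset.univ.map ⟨Sum.inr, Sum.inr_injective⟩)
    (by
      rw [Finset.disjoint_left]
      intro i hi hj
      simp only [Finset.mem_map, Finset.mem_univ, true_and, Function.Embedding.coeFn_mk] at hi hj
      obtain ⟨a, rfl⟩ := hi
      obtain ⟨b, hb⟩ := hj
      cases hb)
    (fun i => hX.measurable_count' (hC i))
  rw [IndepFun_iff_Indep] at hpair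
  refine indep_of_indep_of_le_left (indep_of_indep_of_le_right hpair ?_) ?_
  · refine iSup₂_le fun s hs => ?_
    set F : Finset {v // v ∈ J.powerset} := Finset.univ.filter fun v => s ∈ v.1
    have e : count X s = (fun t : ((Finset.univ.map ⟨Sum.inr, Sum.inr_injective⟩ : Finset ι) → ℕ) =>
        ∑ v ∈ F, t ⟨Sum.inr v, by simp⟩) ∘
        (fun ω (i : (Finset.univ.map ⟨Sum.inr, Sum.inr_injective⟩ : Finset ι)) =>
          count X (C i) ω) := by
      funext ω
      rw [count_eq_sum_cell J hs]
      refine Finset.sum_bij' (fun v hv => ⟨v, (Finset.mem_filter.1 hv).1⟩) (fun v _ => v.1)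
        ?_ ?_ ?_ ?_ ?_
      · intro v hv
        simpa [F] using (Finset.mem_filter.1 hv).2
      · intro v hv
        exact Finset.mem_filter.2 ⟨v.2, (Finset.mem_filter.1 hv).2⟩
      · intro v hv; rfl
      · intro v hv; rfl
      · intro v hv; rfl
    rw [e, ← MeasurableSpace.comap_comp]
    refine MeasurableSpace.comap_mono (Measurable.comap_le ?_)
    exact Finset.measurable_sum _ fun v _ => measurable_pi_apply _
  · refine iSup₂_le fun s hs => ?_
    set F : Finset {v // v ∈ I.powerset} := Finset.univ.filter fun v => s ∈ v.1
    have e : count X s = (fun t : ((Finset.univ.map ⟨Sum.inl, Sum.inl_injective⟩ : Finset ι) → ℕ) =>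
        ∑ v ∈ F, t ⟨Sum.inl v, by simp⟩) ∘
        (fun ω (i : (Finset.univ.map ⟨Sum.inl, Sum.inl_injective⟩ : Finset ι)) =>
          count X (C i) ω) := by
      funext ω
      rw [count_eq_sum_cell I hs]
      refine Finset.sum_bij' (fun v hv => ⟨v, (Finset.mem_filter.1 hv).1⟩) (fun v _ => v.1)
        ?_ ?_ ?_ ?_ ?_
      · intro v hv
        simpa [F] using (Finset.mem_filter.1 hv).2
      · intro v hv
        exact Finset.mem_filter.2 ⟨v.2, (Finset.mem_filter.1 hv).2⟩
      · intro v hv; rfl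
      · intro v hv; rfl
      · intro v hv; rfl
    rw [e, ← MeasurableSpace.comap_comp]
    refine MeasurableSpace.comap_mono (Measurable.comap_le ?_)
    exact Finset.measurable_sum _ fun v _ => measurable_pi_apply _

/-- The configurations in two disjoint regions are independent. -/
lemma indep_countSigma [IsProbabilityMeasure P] (hX : IsPoissonProcess P K X) {S T : Set Plane}
    (hS : MeasurableSet S) (hT : MeasurableSet T) (hST : Disjoint S T) :
    Indep (countSigma X S) (countSigma X T) P := by
  have hle : ∀ {S : Set Plane} (I : Finset {s : Set Plane // MeasurableSet s ∧ s ⊆ S}),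
      (⨆ s ∈ I, MeasurableSpace.comap (count X s) ⊤) ≤ ‹MeasurableSpace Ω› := fun I =>
    iSup₂_le fun s _ => (hX.measurable_count' s.2.1).comap_le
  have hdir : ∀ {S : Set Plane}, Directed (· ≤ ·)
      (fun I : Finset {s : Set Plane // MeasurableSet s ∧ s ⊆ S} =>
        ⨆ s ∈ I, MeasurableSpace.comap (count X s) ⊤) := fun {S} =>
    Monotone.directed_le fun I J hIJ =>
      biSup_mono fun s hs => Finset.mem_of_subset hIJ hs
  rw [countSigma, countSigma, iSup_eq_iSup_finset, iSup_eq_iSup_finset (ι := {s : Set Plane // _})]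
  refine indep_iSup_of_directed_le (fun I => ?_) hle (iSup_le hle) hdir
  exact (indep_iSup_of_directed_le (fun J => (indep_iSup_finset hX hS hT hST I J).symm)
    hle (hle I) hdir).symm

/-- If, outside of an event of small probability, the support vertices at the angles in `Θ` depend
only on the points in `S`, and those at the angles in `Ψ` only on the points in a disjoint set `T`,
then the two families are almost independent. -/
lemma abs_measureReal_inter_sub_le [IsProbabilityMeasure P] (hX : IsPoissonProcess P K X)
    {S T : Set Plane} (hS : MeasurableSet S) (hT : MeasurableSet T) (hST : Disjoint S T)
    {Θ Ψ : Set Real.Angle} {bad : Set Ω}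
    (hΘ : ∀ ω ∉ bad, ∀ θ ∈ Θ, W X θ ω = W (restrictTo X S) θ ω)
    (hΨ : ∀ ω ∉ bad, ∀ ψ ∈ Ψ, W X ψ ω = W (restrictTo X T) ψ ω) {A B : Set Ω}
    (hA : MeasurableSet[supportSigmaAlgebra X Θ] A)
    (hB : MeasurableSet[supportSigmaAlgebra X Ψ] B) :
    |P.real (A ∩ B) - P.real A * P.real B| ≤ 3 * P.real bad := by
  obtain ⟨A', hA', hAA⟩ := exists_event_restrictTo hΘ hA
  obtain ⟨B', hB', hBB⟩ := exists_event_restrictTo hΨ hB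
  have hprod : P.real (A' ∩ B') = P.real A' * P.real B' := by
    have := (Indep_iff _ _ P).1 (indep_countSigma hX hS hT hST) A' B'
      (supportSigmaAlgebra_restrictTo_le hS Θ _ hA') (supportSigmaAlgebra_restrictTo_le hT Ψ _ hB')
    rw [measureReal_def, this, ENNReal.toReal_mul, measureReal_def, measureReal_def]
  have close : ∀ E F : Set Ω, (∀ ω ∉ bad, (ω ∈ E ↔ ω ∈ F)) →
      |P.real E - P.real F| ≤ P.real bad := by
    have half : ∀ E F : Set Ω, (∀ ω ∉ bad, (ω ∈ E ↔ ω ∈ F)) →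
        P.real E ≤ P.real F + P.real bad := by
      intro E F h
      refine (measureReal_mono (s₂ := F ∪ bad) fun ω hω => ?_).trans (measureReal_union_le _ _)
      by_cases hb : ω ∈ bad
      · exact Or.inr hb
      · exact Or.inl ((h ω hb).1 hω)
    intro E F h
    rw [abs_le]
    constructor
    · linarith [half F E fun ω hω => (h ω hω).symm]
    · linarith [half E F h]
  have h1 := abs_le.1 (close (A ∩ B) (A' ∩ B') fun ω hω => and_congr (hAA ω hω) (hBB ω hω))
  have h2 := abs_le.1 (close A A' hAA)
  have h3 := abs_le.1 (close B B' hBB)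
  have a0 : 0 ≤ P.real A := measureReal_nonneg
  have a1 : P.real A ≤ 1 := measureReal_le_one
  have b0 : 0 ≤ P.real B' := measureReal_nonneg
  have b1 : P.real B' ≤ 1 := measureReal_le_one
  have η0 : 0 ≤ P.real bad := measureReal_nonneg
  rw [hprod] at h1
  rw [abs_le]
  constructor <;> nlinarith

/-! ### Probabilities of empty regions -/

lemma measureReal_forall_notMem (hX : IsPoissonProcess P K X)
    {s : Set Plane} (hs : MeasurableSet s) :
    P.real {ω | ∀ p ∈ X ω, p ∉ s} = exp (-volume.real (K ∩ s)) := by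
  have hset : {ω | ∀ p ∈ X ω, p ∉ s} = count X s ⁻¹' {0} := by
    ext ω
    simp only [count, mem_preimage, mem_singleton_iff, mem_ofPred_eq]
    rw [Set.ncard_eq_zero ((X ω).finite_toSet.inter_of_left s), ← Set.disjoint_iff_inter_eq_empty,
      Set.disjoint_left]
    rfl
  have hlaw : P.map (count X s) = poissonMeasure (volume (K ∩ s)).toNNReal := hX.law_count s hs
  rw [hset, measureReal_def,
    ← Measure.map_apply (hX.measurable_count' hs) (measurableSet_singleton 0),
    hlaw, ← measureReal_def,
    poissonMeasure_real_singleton]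
  simp [measureReal_def, ENNReal.coe_toNNReal_eq_toReal]

lemma measureReal_exists_mem_le [IsProbabilityMeasure P] (hX : IsPoissonProcess P K X)
    {s : Set Plane} (hs : MeasurableSet s) :
    P.real {ω | ∃ p ∈ X ω, p ∈ s} ≤ volume.real (K ∩ s) := by
  have hmeas : MeasurableSet {ω | ∃ p ∈ X ω, p ∈ s} :=
    countSigma_le hX univ _ (measurableSet_exists_mem hs (subset_univ s))
  have hcompl : {ω | ∀ p ∈ X ω, p ∉ s} = {ω | ∃ p ∈ X ω, p ∈ s}ᶜ := by
    ext ω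
    simp
  have h := measureReal_forall_notMem hX hs
  rw [hcompl, probReal_compl_eq_one_sub hmeas] at h
  linarith [add_one_le_exp (-volume.real (K ∩ s))]

end process

/-! ### Separating two families of half-planes -/

/-- The signed height of the point `q` over the line through the origin at angle `θ`. -/
def height (θ : ℝ) (q : Plane) : ℝ := inner ℝ q (leftNormal θ)

lemma height_eq (θ : ℝ) (q : Plane) : height θ q = -sin θ * q 0 + cos θ * q 1 :=
  inner_leftNormal q θ

lemma height_add_pi (θ : ℝ) (q : Plane) : height (θ + π) q = -height θ q := by
  rw [height_eq, height_eq, sin_add_pi, cos_add_pi]; ring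

lemma height_sub_pi (θ : ℝ) (q : Plane) : height (θ - π) q = -height θ q := by
  rw [height_eq, height_eq, sin_sub_pi, cos_sub_pi]; ring

lemma height_add_two_pi (θ : ℝ) (q : Plane) : height (θ + 2 * π) q = height θ q := by
  rw [height_eq, height_eq, sin_add_two_pi, cos_add_two_pi]

lemma height_sub_two_pi (θ : ℝ) (q : Plane) : height (θ - 2 * π) q = height θ q := by
  rw [height_eq, height_eq, sin_sub_two_pi, cos_sub_two_pi]

/-- The linear relation between the heights over three lines. -/
lemma sin_mul_height_sub (x y z : ℝ) (p q : Plane) :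
    sin (z - x) * (height y p - height y q) =
      sin (z - y) * (height x p - height x q) + sin (y - x) * (height z p - height z q) := by
  simp only [height_eq, sin_sub]
  ring

lemma measurable_height (θ : ℝ) : Measurable (height θ) := by
  have : Continuous (height θ) := by unfold height; fun_prop
  exact this.measurable

/-- A point `q` to the left of the line through `b` at angle `γ` and to the right of the one at
angle `l`, that is, to the left of the one at angle `l - π`, is not lower than `b` at the angles
between `l - π` and `γ`. -/
lemma height_le_of_clockwise {γ l θ : ℝ} {b q : Plane} (h1 : γ < l) (h2 : l < γ + π)
    (h3 : l - π ≤ θ) (h4 : θ ≤ γ) (hγ : height γ b ≤ height γ q) (hl : height l q ≤ height l b) :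
    height θ b ≤ height θ q := by
  have h := sin_mul_height_sub (l - π) θ γ q b
  rw [height_sub_pi, height_sub_pi] at h
  have s1 : 0 < sin (γ - (l - π)) := sin_pos_of_pos_of_lt_pi (by linarith) (by linarith)
  have s2 : 0 ≤ sin (γ - θ) := sin_nonneg_of_nonneg_of_le_pi (by linarith) (by linarith)
  have s3 : 0 ≤ sin (θ - (l - π)) := sin_nonneg_of_nonneg_of_le_pi (by linarith) (by linarith)
  have e1 := mul_nonneg s2 (by linarith : 0 ≤ -height l q - -height l b)
  have e2 := mul_nonneg s3 (by linarith : 0 ≤ height γ q - height γ b)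
  by_contra hcon
  push Not at hcon
  linarith [mul_neg_of_pos_of_neg s1 (by linarith : height θ q - height θ b < 0)]

/-- A point `p` to the left of the line through `b` at angle `γ` and to the right of the one at an
earlier angle `α` lies lower than `b` at the angles between `γ - π` and `α`. -/
lemma height_lt_of_clockwise {γ α θ : ℝ} {b p : Plane} (h1 : γ - π < θ) (h2 : θ ≤ α) (h3 : α ≤ γ)
    (hγ : height γ b < height γ p) (hα : height α p < height α b) : height θ p < height θ b := by
  rcases h2.eq_or_lt with rfl | h2
  · exact hα
  have h := sin_mul_height_sub θ α γ p b
  have s1 : 0 < sin (γ - θ) := sin_pos_of_pos_of_lt_pi (by linarith) (by linarith)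
  have s2 : 0 ≤ sin (γ - α) := sin_nonneg_of_nonneg_of_le_pi (by linarith) (by linarith)
  have s3 : 0 ≤ sin (α - θ) := sin_nonneg_of_nonneg_of_le_pi (by linarith) (by linarith)
  have e1 := mul_neg_of_pos_of_neg s1 (by linarith : height α p - height α b < 0)
  have e2 := mul_nonneg s3 (by linarith : 0 ≤ height γ p - height γ b)
  by_contra hcon
  push Not at hcon
  linarith [mul_nonneg s2 (by linarith : 0 ≤ height θ p - height θ b)]

/-- A point `q` to the left of the lines through `b` at the angles `γ` and `l` is not lower than `b`
at the angles in between. -/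
lemma height_le_of_counterclockwise {γ l θ : ℝ} {b q : Plane} (h1 : γ < l) (h2 : l < γ + π)
    (h3 : γ ≤ θ) (h4 : θ ≤ l) (hγ : height γ b ≤ height γ q) (hl : height l b ≤ height l q) :
    height θ b ≤ height θ q := by
  have h := sin_mul_height_sub γ θ l q b
  have s1 : 0 < sin (l - γ) := sin_pos_of_pos_of_lt_pi (by linarith) (by linarith)
  have s2 : 0 ≤ sin (l - θ) := sin_nonneg_of_nonneg_of_le_pi (by linarith) (by linarith)
  have s3 : 0 ≤ sin (θ - γ) := sin_nonneg_of_nonneg_of_le_pi (by linarith) (by linarith)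
  have e1 := mul_nonneg s2 (by linarith : 0 ≤ height γ q - height γ b)
  have e2 := mul_nonneg s3 (by linarith : 0 ≤ height l q - height l b)
  by_contra hcon
  push Not at hcon
  linarith [mul_neg_of_pos_of_neg s1 (by linarith : height θ q - height θ b < 0)]

/-- A point `p` to the left of the line through `b` at angle `γ` and to the right of the one at a
later angle `β` lies lower than `b` at the angles between `β` and `γ + π`. -/
lemma height_lt_of_counterclockwise {γ β θ : ℝ} {b p : Plane} (h1 : γ ≤ β) (h2 : β ≤ θ)
    (h3 : θ < γ + π) (hγ : height γ b < height γ p) (hβ : height β p < height β b) :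
    height θ p < height θ b := by
  rcases h2.eq_or_lt with rfl | h2
  · exact hβ
  have h := sin_mul_height_sub γ β θ p b
  have s1 : 0 < sin (θ - γ) := sin_pos_of_pos_of_lt_pi (by linarith) (by linarith)
  have s2 : 0 ≤ sin (θ - β) := sin_nonneg_of_nonneg_of_le_pi (by linarith) (by linarith)
  have s3 : 0 ≤ sin (β - γ) := sin_nonneg_of_nonneg_of_le_pi (by linarith) (by linarith)
  have e1 := mul_neg_of_pos_of_neg s1 (by linarith : height β p - height β b < 0)
  have e2 := mul_nonneg s2 (by linarith : 0 ≤ height γ p - height γ b)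
  by_contra hcon
  push Not at hcon
  linarith [mul_nonneg s3 (by linarith : 0 ≤ height θ p - height θ b)]

/-- The half-plane to the right of the oriented line at angle `γ` through `b`. -/
def rightOf (γ : ℝ) (b : Plane) : Set Plane := {q | height γ q ≤ height γ b}

/-- The angular sector with vertex `b` to the left of the line at angle `γ` and to the right of the
line at angle `α`. -/
def sector (γ α : ℝ) (b : Plane) : Set Plane :=
  {q | height γ b < height γ q ∧ height α q < height α b}

lemma measurableSet_rightOf (γ : ℝ) (b : Plane) : MeasurableSet (rightOf γ b) :=
  measurableSet_le (measurable_height γ) measurable_const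

lemma measurableSet_sector (γ α : ℝ) (b : Plane) : MeasurableSet (sector γ α b) :=
  (measurableSet_lt measurable_const (measurable_height γ)).inter
    (measurableSet_lt (measurable_height α) measurable_const)

/-- The cap at one of the two separating points does not contain the other one, as it would contain
one of the two large sectors at that point. -/
lemma height_lt_height_of_volume_lt {K : Set Plane} (hK : Bornology.IsBounded K) {γ γ' α β : ℝ}
    {b b' : Plane}
    (h1 : γ' - 2 * π ≤ α) (h2 : α < γ) (h3 : γ < β) (h4 : β ≤ γ')
    (hA : volume.real (K ∩ rightOf γ' b') < volume.real (K ∩ sector γ α b))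
    (hB : volume.real (K ∩ rightOf γ' b') < volume.real (K ∩ sector γ β b)) :
    height γ' b' < height γ' b := by
  by_contra hcon
  push Not at hcon
  have hfin : volume (K ∩ rightOf γ' b') ≠ ∞ :=
    ((measure_mono inter_subset_left).trans_lt hK.measure_lt_top).ne
  rcases lt_trichotomy γ' (γ + π) with h | h | h
  · refine hB.not_ge (measureReal_mono (fun q hq => ⟨hq.1, ?_⟩) hfin)
    exact ((height_lt_of_counterclockwise h3.le h4 h hq.2.1 hq.2.2).trans_le hcon).le
  · refine hB.not_ge (measureReal_mono (fun q hq => ⟨hq.1, ?_⟩) hfin)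
    have h5 := hq.2.1
    have : height γ' q < height γ' b := by
      rw [h, height_add_pi, height_add_pi]; linarith
    exact (this.trans_le hcon).le
  · refine hA.not_ge (measureReal_mono (fun q hq => ⟨hq.1, ?_⟩) hfin)
    have := height_lt_of_clockwise (θ := γ' - 2 * π) (by linarith) h1 h2.le hq.2.1 hq.2.2
    rw [height_sub_two_pi, height_sub_two_pi] at this
    exact (this.trans_le hcon).le

/-- The direction angle of a vector which points to the left of a line at angle `γ`. -/
lemma exists_direction_angle {γ : ℝ} {p q : Plane} (h : height γ p < height γ q) :
    ∃ l r : ℝ, γ < l ∧ l < γ + π ∧ 0 < r ∧ ∀ θ, height θ q - height θ p = r * sin (l - θ) := by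
  set x := cos γ * (q 0 - p 0) + sin γ * (q 1 - p 1) with hx
  set y := height γ q - height γ p with hy
  have hy0 : 0 < y := sub_pos.2 h
  set z : ℂ := ⟨x, y⟩
  have hz : z ≠ 0 := fun h0 => hy0.ne' (congrArg Complex.im h0)
  have hr : 0 < ‖z‖ := norm_pos_iff.2 hz
  have hre : ‖z‖ * cos z.arg = x := by rw [Complex.norm_mul_cos_arg]
  have him : ‖z‖ * sin z.arg = y := by rw [Complex.norm_mul_sin_arg]
  have hs : 0 < sin z.arg := pos_of_mul_pos_right (by rw [him]; exact hy0) hr.le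
  have harg0 : 0 < z.arg := by
    by_contra hcon
    push Not at hcon
    linarith [sin_nonpos_of_nonpos_of_neg_pi_le hcon (Complex.neg_pi_lt_arg z).le]
  have hargπ : z.arg < π := by
    refine lt_of_le_of_ne (Complex.arg_le_pi z) fun h => ?_
    rw [h, sin_pi] at hs
    exact lt_irrefl _ hs
  refine ⟨γ + z.arg, ‖z‖, by linarith, by linarith, hr, fun θ => ?_⟩
  have e : ‖z‖ * sin (γ + z.arg - θ) =
      (‖z‖ * sin z.arg) * cos (γ - θ) + (‖z‖ * cos z.arg) * sin (γ - θ) := by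
    rw [show γ + z.arg - θ = (γ - θ) + z.arg by ring, sin_add]; ring
  rw [e, hre, him, hx, hy]
  simp only [height_eq, sin_sub, cos_sub]
  linear_combination (sin θ * (q 0 - p 0) - cos θ * (q 1 - p 1)) * sin_sq_add_cos_sq γ

section process

variable {Ω : Type*} {X : Ω → Finset Plane}

lemma W_eq_restrictTo {S : Set Plane} {ω : Ω} {s t : ℝ}
    (h : ∀ θ ∈ Icc s t, ∀ q ∈ X ω, q ∉ S → ∃ p ∈ X ω, p ∈ S ∧ height θ p < height θ q) :
    ∀ θ ∈ arc s t, W X θ ω = W (restrictTo X S) θ ω := by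
  rintro _ ⟨θ, hθ, rfl⟩
  exact (supportVertex_filter (h θ hθ)).symm

variable [MeasurableSpace Ω] {P : Measure Ω} {K : Set Plane}
  (hX : IsPoissonProcess P K X)

include hX

lemma measureReal_notMem_sector_le {γ α m : ℝ} {b : Plane}
    (h : m ≤ volume.real (K ∩ sector γ α b)) :
    P.real {ω | ∀ p ∈ X ω, p ∉ sector γ α b} ≤ exp (-m) := by
  rw [measureReal_forall_notMem hX (measurableSet_sector γ α b)]
  exact exp_le_exp.2 (by linarith)

variable [IsProbabilityMeasure P]

/-- Almost independence for two families of angles in a half-circle: a single point `b` with a line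
at an angle `γ` between the two families separates the families of half-planes. -/
lemma decorrelation_of_one_point {θ₀ θ₁ ψ₀ ψ₁ γ m : ℝ} {b : Plane} (h1 : θ₀ ≤ θ₁) (h2 : θ₁ < γ)
    (h3 : γ < ψ₀) (h4 : ψ₀ ≤ ψ₁) (h5 : ψ₁ ≤ θ₀ + π)
    (hN : volume.real (K ∩ rightOf γ b) ≤ exp (-m))
    (hA : m ≤ volume.real (K ∩ sector γ θ₁ b)) (hB : m ≤ volume.real (K ∩ sector γ ψ₀ b))
    {A B : Set Ω} (hAm : MeasurableSet[supportSigmaAlgebra X (arc θ₀ θ₁)] A)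
    (hBm : MeasurableSet[supportSigmaAlgebra X (arc ψ₀ ψ₁)] B) :
    |P.real (A ∩ B) - P.real A * P.real B| ≤ 9 * exp (-m) := by
  -- the family `[θ₀, θ₁]` depends on the points to the left of the line at angle `ψ₁` through `b`
  set S : Set Plane := {q | height ψ₁ b < height ψ₁ q}
  have hS : MeasurableSet S := measurableSet_lt measurable_const (measurable_height ψ₁)
  set bad : Set Ω := {ω | ∃ p ∈ X ω, p ∈ rightOf γ b} ∪ {ω | ∀ p ∈ X ω, p ∉ sector γ θ₁ b} ∪
    {ω | ∀ p ∈ X ω, p ∉ sector γ ψ₀ b}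
  have hbad : P.real bad ≤ 3 * exp (-m) := by
    have e1 := measureReal_exists_mem_le hX (measurableSet_rightOf γ b)
    have e2 := measureReal_notMem_sector_le hX hA
    have e3 := measureReal_notMem_sector_le hX hB
    have e4 := measureReal_union_le (μ := P)
      ({ω | ∃ p ∈ X ω, p ∈ rightOf γ b} ∪ {ω | ∀ p ∈ X ω, p ∉ sector γ θ₁ b})
      {ω | ∀ p ∈ X ω, p ∉ sector γ ψ₀ b}
    have e5 := measureReal_union_le (μ := P)
      {ω | ∃ p ∈ X ω, p ∈ rightOf γ b} {ω | ∀ p ∈ X ω, p ∉ sector γ θ₁ b}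
    linarith
  have hgood : ∀ ω ∉ bad, (∀ p ∈ X ω, height γ b < height γ p) ∧
      (∃ p ∈ X ω, p ∈ sector γ θ₁ b) ∧ ∃ p ∈ X ω, p ∈ sector γ ψ₀ b := by
    intro ω hω
    simp only [bad, mem_union, mem_ofPred_eq, not_or, not_exists, not_and, not_forall,
      not_not] at hω
    obtain ⟨⟨g1, p, hp, hpA⟩, q, hq, hqB⟩ := hω
    exact ⟨fun p hp => not_le.1 (g1 p hp), ⟨p, hp, hpA⟩, ⟨q, hq, hqB⟩⟩
  refine (abs_measureReal_inter_sub_le hX hS hS.compl disjoint_compl_right (bad := bad)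
    (fun ω hω => W_eq_restrictTo ?_) (fun ω hω => W_eq_restrictTo ?_) hAm hBm).trans (by linarith)
  · intro θ hθ q hq hqS
    obtain ⟨g1, ⟨p, hp, hpγ, hpα⟩, -⟩ := hgood ω hω
    refine ⟨p, hp, ?_, ?_⟩
    · have := height_lt_of_clockwise (θ := ψ₁ - π) (by linarith) (by linarith) h2.le hpγ hpα
      rw [height_sub_pi, height_sub_pi] at this
      exact neg_lt_neg_iff.1 this
    · refine (height_lt_of_clockwise (by linarith [hθ.1]) hθ.2 h2.le hpγ hpα).trans_le ?_
      exact height_le_of_clockwise (l := ψ₁) (by linarith) (by linarith) (by linarith [hθ.1])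
        (by linarith [hθ.2]) (g1 q hq).le (not_lt.1 hqS)
  · intro ψ hψ q hq hqS
    obtain ⟨g1, -, p, hp, hpγ, hpβ⟩ := hgood ω hω
    refine ⟨p, hp, ?_, ?_⟩
    · exact not_lt.2 (height_lt_of_counterclockwise h3.le h4 (by linarith) hpγ hpβ).le
    · refine (height_lt_of_counterclockwise h3.le hψ.1 (by linarith [hψ.2]) hpγ hpβ).trans_le ?_
      exact height_le_of_counterclockwise (l := ψ₁) (by linarith) (by linarith)
        (by linarith [hψ.1]) hψ.2 (g1 q hq).le (not_not.1 hqS).le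

/-- Almost independence for two families of angles, with points `b₁` and `b₂` in the two gaps
between them: the line through the two points separates the regions which determine the two
families of support vertices. -/
lemma decorrelation_of_two_points (hK : Bornology.IsBounded K)
    {θ₀ θ₁ ψ₀ ψ₁ γ₁ γ₂ m₁ m₂ : ℝ} {b₁ b₂ : Plane} (h1 : θ₀ ≤ θ₁) (h2 : θ₁ < γ₁)
    (h3 : γ₁ < ψ₀) (h4 : ψ₀ ≤ ψ₁) (h5 : ψ₁ < γ₂) (h6 : γ₂ < θ₀ + 2 * π)
    (hN₁ : volume.real (K ∩ rightOf γ₁ b₁) ≤ exp (-m₁))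
    (hN₂ : volume.real (K ∩ rightOf γ₂ b₂) ≤ exp (-m₂))
    (hm₁ : 1 < m₁) (hm₂ : 1 < m₂)
    (hA₁ : m₁ ≤ volume.real (K ∩ sector γ₁ θ₁ b₁)) (hB₁ : m₁ ≤ volume.real (K ∩ sector γ₁ ψ₀ b₁))
    (hB₂ : m₂ ≤ volume.real (K ∩ sector γ₂ ψ₁ b₂))
    (hA₂ : m₂ ≤ volume.real (K ∩ sector γ₂ (θ₀ + 2 * π) b₂))
    {A B : Set Ω} (hAm : MeasurableSet[supportSigmaAlgebra X (arc θ₀ θ₁)] A)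
    (hBm : MeasurableSet[supportSigmaAlgebra X (arc ψ₀ ψ₁)] B) :
    |P.real (A ∩ B) - P.real A * P.real B| ≤ 9 * (exp (-m₁) + exp (-m₂)) := by
  have l₁ : exp (-m₁) < 1 := exp_lt_one_iff.2 (by linarith)
  have l₂ : exp (-m₂) < 1 := exp_lt_one_iff.2 (by linarith)
  have hlow₂ : height γ₂ b₂ < height γ₂ b₁ :=
    height_lt_height_of_volume_lt hK (by linarith) h2 h3 (by linarith) (by linarith) (by linarith)
  have hlow₁ : height γ₁ b₁ < height γ₁ b₂ := by
    have := height_lt_height_of_volume_lt (γ := γ₂) (γ' := γ₁ + 2 * π) (α := ψ₁)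
      (β := θ₀ + 2 * π) (b := b₂) (b' := b₁) hK (by linarith) h5 h6 (by linarith)
      (by simp only [rightOf, height_add_two_pi] at hN₁ ⊢; linarith)
      (by simp only [rightOf, height_add_two_pi] at hN₁ ⊢; linarith)
    rwa [height_add_two_pi, height_add_two_pi] at this
  obtain ⟨l, r, hl1, hl2, hr, hdiff⟩ := exists_direction_angle hlow₁
  have hsin : sin (l - γ₂) < 0 := by
    have := hdiff γ₂
    by_contra hcon
    push Not at hcon
    linarith [mul_nonneg hr.le hcon]
  have hl3 : l < γ₂ := by
    by_contra hcon
    push Not at hcon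
    linarith [sin_nonneg_of_nonneg_of_le_pi (x := l - γ₂) (by linarith) (by linarith)]
  have hl4 : γ₂ - π < l := by
    by_contra hcon
    push Not at hcon
    have := sin_nonneg_of_nonneg_of_le_pi (x := l - γ₂ + 2 * π) (by linarith) (by linarith)
    rw [sin_add_two_pi] at this
    linarith
  have heq : height l b₁ = height l b₂ := by
    have := hdiff l
    rw [sub_self, sin_zero, mul_zero] at this
    linarith
  -- the family `[θ₀, θ₁]` depends on the points to the left of the line from `b₁` to `b₂`
  set S : Set Plane := {q | height l b₁ < height l q}
  have hS : MeasurableSet S := measurableSet_lt measurable_const (measurable_height l)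
  let hits : ℝ → Plane → Set Ω := fun γ b => {ω | ∃ p ∈ X ω, p ∈ rightOf γ b}
  let misses : ℝ → ℝ → Plane → Set Ω := fun γ α b => {ω | ∀ p ∈ X ω, p ∉ sector γ α b}
  set bad : Set Ω := (hits γ₁ b₁ ∪ (misses γ₁ θ₁ b₁ ∪ misses γ₁ ψ₀ b₁)) ∪
    (hits γ₂ b₂ ∪ (misses γ₂ ψ₁ b₂ ∪ misses γ₂ (θ₀ + 2 * π) b₂))
  have hunion : ∀ s t u : Set Ω, P.real (s ∪ (t ∪ u)) ≤ P.real s + (P.real t + P.real u) :=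
    fun s t u => (measureReal_union_le _ _).trans (add_le_add le_rfl (measureReal_union_le _ _))
  have hbad : P.real bad ≤ 3 * (exp (-m₁) + exp (-m₂)) := by
    have e0 : P.real bad ≤ _ := measureReal_union_le _ _
    have e1 := hunion (hits γ₁ b₁) (misses γ₁ θ₁ b₁) (misses γ₁ ψ₀ b₁)
    have e2 := hunion (hits γ₂ b₂) (misses γ₂ ψ₁ b₂) (misses γ₂ (θ₀ + 2 * π) b₂)
    have n1 : P.real (hits γ₁ b₁) ≤ _ := measureReal_exists_mem_le hX (measurableSet_rightOf γ₁ b₁)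
    have n2 : P.real (hits γ₂ b₂) ≤ _ := measureReal_exists_mem_le hX (measurableSet_rightOf γ₂ b₂)
    have a1 : P.real (misses γ₁ θ₁ b₁) ≤ _ := measureReal_notMem_sector_le hX hA₁
    have a2 : P.real (misses γ₁ ψ₀ b₁) ≤ _ := measureReal_notMem_sector_le hX hB₁
    have a3 : P.real (misses γ₂ ψ₁ b₂) ≤ _ := measureReal_notMem_sector_le hX hB₂
    have a4 : P.real (misses γ₂ (θ₀ + 2 * π) b₂) ≤ _ := measureReal_notMem_sector_le hX hA₂
    linarith
  have hgood : ∀ ω ∉ bad, ((∀ p ∈ X ω, height γ₁ b₁ < height γ₁ p) ∧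
      (∃ p ∈ X ω, p ∈ sector γ₁ θ₁ b₁) ∧ ∃ p ∈ X ω, p ∈ sector γ₁ ψ₀ b₁) ∧
      (∀ p ∈ X ω, height γ₂ b₂ < height γ₂ p) ∧
      (∃ p ∈ X ω, p ∈ sector γ₂ ψ₁ b₂) ∧ ∃ p ∈ X ω, p ∈ sector γ₂ (θ₀ + 2 * π) b₂ := by
    intro ω hω
    simp only [bad, hits, misses, mem_union, mem_ofPred_eq, not_or, not_exists, not_and,
      not_forall, not_not] at hω
    obtain ⟨⟨g1, ⟨p, hp, hp'⟩, q, hq, hq'⟩, g2, ⟨u, hu, hu'⟩, v, hv, hv'⟩ := hω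
    exact ⟨⟨fun p hp => not_le.1 (g1 p hp), ⟨p, hp, hp'⟩, ⟨q, hq, hq'⟩⟩,
      fun p hp => not_le.1 (g2 p hp), ⟨u, hu, hu'⟩, ⟨v, hv, hv'⟩⟩
  refine (abs_measureReal_inter_sub_le hX hS hS.compl disjoint_compl_right (bad := bad)
    (fun ω hω => W_eq_restrictTo ?_) (fun ω hω => W_eq_restrictTo ?_) hAm hBm).trans (by linarith)
  · intro θ hθ q hq hqS
    have hqS' : height l q ≤ height l b₁ := not_lt.1 hqS
    obtain ⟨⟨g1, ⟨p, hp, hp1, hp2⟩, -⟩, g2, -, u, hu, hu1, hu2⟩ := hgood ω hω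
    -- for angles beyond the direction opposite to `l`, the other gap is the nearer one
    rcases le_or_gt (l - π) θ with h | h
    · refine ⟨p, hp, ?_, ?_⟩
      · have := height_lt_of_clockwise (θ := l - π) (by linarith) (h.trans hθ.2) h2.le hp1 hp2
        rw [height_sub_pi, height_sub_pi] at this
        exact neg_lt_neg_iff.1 this
      · refine (height_lt_of_clockwise (by linarith) hθ.2 h2.le hp1 hp2).trans_le ?_
        exact height_le_of_clockwise hl1 hl2 h (by linarith [hθ.2]) (g1 q hq).le hqS'
    · refine ⟨u, hu, ?_, ?_⟩
      · have := height_lt_of_counterclockwise (θ := l + π) h6.le (by linarith [hθ.1])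
          (by linarith) hu1 hu2
        rw [height_add_pi, height_add_pi] at this
        exact heq.trans_lt (neg_lt_neg_iff.1 this)
      · rw [← height_add_two_pi θ u, ← height_add_two_pi θ q]
        refine (height_lt_of_counterclockwise (θ := θ + 2 * π) h6.le (by linarith [hθ.1])
          (by linarith) hu1 hu2).trans_le ?_
        refine height_le_of_counterclockwise (l := l + π) (by linarith) (by linarith)
          (by linarith [hθ.1]) (by linarith) (g2 q hq).le ?_
        rw [height_add_pi, height_add_pi]
        linarith
  · intro ψ hψ q hq hqS
    have hqS' : height l b₁ < height l q := not_not.1 hqS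
    obtain ⟨⟨g1, -, p, hp, hp1, hp2⟩, g2, ⟨u, hu, hu1, hu2⟩, -⟩ := hgood ω hω
    rcases le_or_gt ψ l with h | h
    · refine ⟨p, hp, ?_, ?_⟩
      · exact not_lt.2 (height_lt_of_counterclockwise h3.le (hψ.1.trans h) hl2 hp1 hp2).le
      · refine (height_lt_of_counterclockwise h3.le hψ.1 (by linarith) hp1 hp2).trans_le ?_
        exact height_le_of_counterclockwise hl1 hl2 (by linarith [hψ.1]) h (g1 q hq).le hqS'.le
    · refine ⟨u, hu, ?_, ?_⟩
      · have := height_lt_of_clockwise hl4 (h.le.trans hψ.2) h5.le hu1 hu2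
        exact not_lt.2 (this.trans_eq heq.symm).le
      · refine (height_lt_of_clockwise (by linarith) hψ.2 h5.le hu1 hu2).trans_le ?_
        refine height_le_of_clockwise (l := l + π) (by linarith) (by linarith) (by linarith)
          (by linarith [hψ.2]) (g2 q hq).le ?_
        rw [height_add_pi, height_add_pi]
        linarith

end process

/-! ### The affine invariant measure of an arc -/

lemma arc_add_intCast_mul (a b : ℝ) (k : ℤ) :
    arc (a + k * (2 * π)) (b + k * (2 * π)) = arc a b := by
  have h : ∀ t : ℝ, ((t + k * (2 * π) : ℝ) : Real.Angle) = t := fun t =>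
    Real.Angle.angle_eq_iff_two_pi_dvd_sub.2 ⟨k, by ring⟩
  rw [arc, ← image_add_const_Icc, image_image]
  simp only [h]
  rfl

lemma arc_congr {a b a' b' : ℝ} (ha : (a : Real.Angle) = a') (h : b - a = b' - a') :
    arc a b = arc a' b' := by
  obtain ⟨k, hk⟩ := Real.Angle.angle_eq_iff_two_pi_dvd_sub.1 ha
  rw [← arc_add_intCast_mul a' b' k]
  congr 1 <;> linarith

lemma measurableSet_arc (a b : ℝ) : MeasurableSet (arc a b) :=
  (isCompact_Icc.image Real.Angle.continuous_coe).isClosed.measurableSet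

/-- Only an inequality, as no measurability of the density on the circle is used. -/
lemma affineMeasure_arc_le (K : Set Plane) {α β : ℝ} (h : β ≤ α + π) :
    affineMeasure K (arc α β) ≤ chordMass K α β := by
  set f : Real.Angle → ℝ≥0∞ := fun θ => ENNReal.ofReal (capChord K (exp (-1)) θ ^ 2)
  set F : ℝ → ℝ≥0∞ := fun t => (arc α β).indicator f t
  have hF : ∀ (g : AddSubgroup.zmultiples (2 * π)) (t : ℝ), F (g +ᵥ t) = F t := by
    rintro ⟨_, k, rfl⟩ t
    have : ((k • (2 * π) + t : ℝ) : Real.Angle) = t :=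
      Real.Angle.angle_eq_iff_two_pi_dvd_sub.2 ⟨k, by rw [zsmul_eq_mul]; ring⟩
    change (arc α β).indicator f ((k • (2 * π) + t : ℝ) : Real.Angle) = _
    rw [this]
  have e := (isAddFundamentalDomain_Ioc two_pi_pos 0).setLIntegral_eq
    (isAddFundamentalDomain_Ioc two_pi_pos α) F hF
  rw [zero_add] at e
  calc affineMeasure K (arc α β) = ∫⁻ θ, (arc α β).indicator f θ ∂angleMeasure := by
        rw [affineMeasure, withDensity_apply _ (measurableSet_arc α β),
          lintegral_indicator (measurableSet_arc α β)]
    _ ≤ ∫⁻ t in Ioc 0 (2 * π), F t := lintegral_map_le _ _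
    _ = ∫⁻ t in Ioo α (α + 2 * π), F t := by rw [e, setLIntegral_congr Ioo_ae_eq_Ioc]
    _ ≤ ∫⁻ t in Ioo α (α + 2 * π), (Icc α β).indicator (fun t : ℝ => f t) t := by
        refine setLIntegral_mono' measurableSet_Ioo fun t ht => ?_
        by_cases hmem : (t : Real.Angle) ∈ arc α β
        · obtain ⟨s, hs, hst⟩ := hmem
          obtain ⟨k, hk⟩ := Real.Angle.angle_eq_iff_two_pi_dvd_sub.1 hst
          have hk0 : k = 0 := by
            have h1 : (k : ℝ) < 1 := by
              by_contra hcon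
              push Not at hcon
              nlinarith [hs.2, ht.1, pi_pos]
            have h2 : (-1 : ℝ) < k := by
              by_contra hcon
              push Not at hcon
              nlinarith [hs.1, ht.2, pi_pos]
            have h3 : k < 1 := by exact_mod_cast h1
            have h4 : -1 < k := by exact_mod_cast h2
            omega
          obtain rfl : s = t := by
            rw [hk0] at hk
            simp only [Int.cast_zero, mul_zero] at hk
            linarith
          rw [indicator_of_mem hs]
          exact indicator_le_self _ _ _
        · simp only [F, indicator_of_notMem hmem, zero_le]
    _ ≤ ∫⁻ t, (Icc α β).indicator (fun t : ℝ => f t) t := setLIntegral_le_lintegral _ _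
    _ = chordMass K α β := lintegral_indicator measurableSet_Icc _

lemma chordMass_ne_top {K : Set Plane} (hc : Convex ℝ K) (hb : Bornology.IsBounded K)
    {α β : ℝ} (h : β ≤ α + π) : chordMass K α β ≠ ∞ := by
  rcases le_or_gt (volume.real K) 1 with hV | hV
  · simp [chordMass, capChord_eq_zero hV]
  rcases le_or_gt β α with hβ | hβ
  · have : volume.restrict (Icc α β) = 0 :=
      Measure.restrict_eq_zero.2 (by rw [Real.volume_Icc, ENNReal.ofReal_eq_zero]; linarith)
    simp [chordMass, this]
  have hVc : 1 < volume.real (closure K) := by rwa [volume_real_closure hc]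
  obtain ⟨b, hbi, c, hcpos, hcap, hchord⟩ := exists_midpoint_cap_chord hb.isCompact_closure
    hc.closure (ε := 1 / 10) (by norm_num) (by linarith) α
  have h1 := lintegral_chordLength_sq_le hb.isCompact_closure hc.closure hVc hbi (one_pow 2)
    hcpos (hchord 1 (one_pow 2)) (by rw [hcap]; norm_num) (by rw [hcap]; linarith)
    (by linarith : 0 < β - α) (by linarith)
  refine ne_top_of_le_ne_top ENNReal.ofReal_ne_top (le_trans ?_ h1)
  rw [chordMass, setLIntegral_Icc_eq_right
    (fun t => ENNReal.ofReal (capChord K (exp (-1)) (t : Real.Angle) ^ 2))]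
  exact lintegral_mono fun t => ENNReal.ofReal_le_ofReal
    (pow_le_pow_left₀ (capChord_nonneg _ _ _) (capChord_le_closure hc hb _) 2)

lemma affineMeasure_real_arc_le {K : Set Plane} (hc : Convex ℝ K) (hb : Bornology.IsBounded K)
    {α β : ℝ} (h : β ≤ α + π) : (affineMeasure K).real (arc α β) ≤ (chordMass K α β).toReal :=
  ENNReal.toReal_mono (chordMass_ne_top hc hb h) (affineMeasure_arc_le K h)

/-- The arc in the definition of `𝔡_K(α, β)` for lifts with `α < β ≤ α + π`. -/
lemma affineGap_le_of_le {K : Set Plane} (hc : Convex ℝ K) (hb : Bornology.IsBounded K)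
    {α β : ℝ} (h1 : α < β) (h2 : β ≤ α + π) :
    affineGap K α β ≤ (chordMass K α β).toReal := by
  have e : ((β : Real.Angle) - α).toReal = β - α := by
    rw [← Real.Angle.coe_sub, Real.Angle.toReal_coe_eq_self_iff]
    constructor <;> linarith [pi_pos]
  rw [affineGap, e, if_pos (by linarith), arc_congr (a' := α) (b' := β) (by simp) (by ring)]
  exact affineMeasure_real_arc_le hc hb h2

/-- The arc in the definition of `𝔡_K(α, β)` for lifts with `α + π < β < α + 2π`. -/
lemma affineGap_le_of_lt {K : Set Plane} (hc : Convex ℝ K) (hb : Bornology.IsBounded K)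
    {α β : ℝ} (h1 : α + π < β) (h2 : β < α + 2 * π) :
    affineGap K α β ≤ (chordMass K β (α + 2 * π)).toReal := by
  have e : ((β : Real.Angle) - α).toReal = β - α - 2 * π := by
    rw [← Real.Angle.coe_sub, Real.Angle.toReal_coe_eq_self_sub_two_pi_iff]
    constructor <;> linarith [pi_pos]
  rw [affineGap, e, if_neg (by linarith),
    arc_congr (a' := β) (b' := α + 2 * π) (by simp) (by ring)]
  exact affineMeasure_real_arc_le hc hb (by linarith)

/-! ### Almost independence for disjoint intervals of angles -/

section process

variable {Ω : Type*} {X : Ω → Finset Plane} [MeasurableSpace Ω] {P : Measure Ω} {K : Set Plane}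
  [IsProbabilityMeasure P]

/-- The trivial bound, which covers gaps of small affine invariant measure. -/
lemma abs_measureReal_inter_sub_le_of_lt (P : Measure Ω) [IsProbabilityMeasure P] (A B : Set Ω)
    {M : ℝ} (hM : M < 33792) :
    |P.real (A ∩ B) - P.real A * P.real B| ≤ 9 * exp (-(M / 22528)) := by
  have h0 : ∀ s : Set Ω, 0 ≤ P.real s := fun s => measureReal_nonneg
  have h1 : ∀ s : Set Ω, P.real s ≤ 1 := fun s => measureReal_le_one
  have h2 : |P.real (A ∩ B) - P.real A * P.real B| ≤ 1 := by
    rw [abs_le]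
    constructor
    · nlinarith [h0 (A ∩ B), h0 A, h0 B, h1 A, h1 B]
    · nlinarith [h1 (A ∩ B), mul_nonneg (h0 A) (h0 B)]
  have h3 : exp (-(3 / 2)) ≤ exp (-(M / 22528)) := exp_le_exp.2 (by linarith)
  have h4 : 1 ≤ 9 * exp (-(3 / 2)) := by
    have e1 : exp (3 / 2) ≤ 9 := by
      have e2 : exp (3 / 2) ≤ exp 2 := exp_le_exp.2 (by norm_num)
      have e3 : exp 2 = exp 1 ^ 2 := by rw [← exp_nat_mul]; norm_num
      nlinarith [exp_one_lt_d9, exp_pos 1]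
    have e4 : exp (-(3 / 2)) * exp (3 / 2) = 1 := by rw [← exp_add]; norm_num
    nlinarith [exp_pos (-(3 / 2) : ℝ)]
  linarith

variable (hX : IsPoissonProcess P K X) (hc : Convex ℝ K) (hb : Bornology.IsBounded K)

include hX hc hb

/-- Almost independence for two families of angles in a half-circle, in terms of the gap between
them. -/
lemma decorrelation_of_le_add_pi {θ₀ θ₁ ψ₀ ψ₁ : ℝ} (h1 : θ₀ ≤ θ₁) (h2 : θ₁ < ψ₀) (h3 : ψ₀ ≤ ψ₁)
    (h4 : ψ₁ ≤ θ₀ + π) {A B : Set Ω} (hAm : MeasurableSet[supportSigmaAlgebra X (arc θ₀ θ₁)] A)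
    (hBm : MeasurableSet[supportSigmaAlgebra X (arc ψ₀ ψ₁)] B) :
    |P.real (A ∩ B) - P.real A * P.real B| ≤
      9 * exp (-((chordMass K θ₁ ψ₀).toReal / 22528)) := by
  rcases lt_or_ge (chordMass K θ₁ ψ₀).toReal 33792 with h | h
  · exact abs_measureReal_inter_sub_le_of_lt P A B h
  obtain ⟨γ, b, hγ1, hγ2, hN, hA, hB⟩ := exists_separating_point hc hb h2.le (by linarith) h
  refine decorrelation_of_one_point hX h1 hγ1 hγ2 h3 h4 (hN.trans (exp_le_exp.2 ?_)) hA hB hAm hBm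
  linarith

/-- Almost independence for two families of angles which do not lie in a half-circle, in terms of
both gaps between them. -/
lemma decorrelation_of_gaps_le_pi {θ₀ θ₁ ψ₀ ψ₁ : ℝ} (h1 : θ₀ ≤ θ₁) (h2 : θ₁ < ψ₀) (h3 : ψ₀ ≤ ψ₁)
    (h4 : ψ₁ < θ₀ + 2 * π) (h5 : ψ₀ ≤ θ₁ + π) (h6 : θ₀ + π ≤ ψ₁) {A B : Set Ω}
    (hAm : MeasurableSet[supportSigmaAlgebra X (arc θ₀ θ₁)] A)
    (hBm : MeasurableSet[supportSigmaAlgebra X (arc ψ₀ ψ₁)] B) :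
    |P.real (A ∩ B) - P.real A * P.real B| ≤
      9 * (exp (-((chordMass K θ₁ ψ₀).toReal / 22528)) +
        exp (-((chordMass K ψ₁ (θ₀ + 2 * π)).toReal / 22528))) := by
  have p1 := exp_pos (-((chordMass K θ₁ ψ₀).toReal / 22528))
  have p2 := exp_pos (-((chordMass K ψ₁ (θ₀ + 2 * π)).toReal / 22528))
  rcases lt_or_ge (chordMass K θ₁ ψ₀).toReal 33792 with h | h
  · linarith [abs_measureReal_inter_sub_le_of_lt P A B h]
  rcases lt_or_ge (chordMass K ψ₁ (θ₀ + 2 * π)).toReal 33792 with h' | h'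
  · linarith [abs_measureReal_inter_sub_le_of_lt P A B h']
  obtain ⟨γ₁, b₁, hγ1, hγ2, hN₁, hA₁, hB₁⟩ := exists_separating_point hc hb h2.le h5 h
  obtain ⟨γ₂, b₂, hγ3, hγ4, hN₂, hB₂, hA₂⟩ :=
    exists_separating_point hc hb h4.le (by linarith) h'
  exact decorrelation_of_two_points hX hb h1 hγ1 hγ2 h3 hγ3 hγ4
    (hN₁.trans (exp_le_exp.2 (by linarith))) (hN₂.trans (exp_le_exp.2 (by linarith)))
    (by linarith) (by linarith) hA₁ hB₁ hB₂ hA₂ hAm hBm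

lemma decorrelation_of_lt_add_two_pi {θ ψ : Fin 2 → ℝ} (h1 : θ 0 ≤ θ 1) (h2 : θ 1 < ψ 0)
    (h3 : ψ 0 ≤ ψ 1) (h4 : ψ 1 < θ 0 + 2 * π) {A B : Set Ω}
    (hAm : MeasurableSet[supportSigmaAlgebra X (arc (θ 0) (θ 1))] A)
    (hBm : MeasurableSet[supportSigmaAlgebra X (arc (ψ 0) (ψ 1))] B) :
    |P.real (A ∩ B) - P.real A * P.real B| ≤
      9 * ∑ i : Fin 2, ∑ j : Fin 2, exp (-(1 / 22528) * affineGap K (θ i) (ψ j)) := by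
  simp only [Fin.sum_univ_two]
  have p : ∀ i j, 0 < exp (-(1 / 22528) * affineGap K (θ i) (ψ j)) := fun i j => exp_pos _
  have hexp : ∀ {i j : Fin 2} {M : ℝ}, affineGap K (θ i) (ψ j) ≤ M →
      exp (-(M / 22528)) ≤ exp (-(1 / 22528) * affineGap K (θ i) (ψ j)) :=
    fun h => exp_le_exp.2 (by linarith)
  rcases le_or_gt (ψ 1) (θ 0 + π) with h | h
  · have e := decorrelation_of_le_add_pi hX hc hb h1 h2 h3 h hAm hBm
    have g := hexp (affineGap_le_of_le hc hb h2 (by linarith))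
    linarith [p 0 0, p 0 1, p 1 1]
  have g := hexp (affineGap_le_of_lt hc hb h h4)
  rcases le_or_gt (θ 1 + π) (ψ 0) with h' | h'
  · -- the two families lie in a half-circle, with the family of `A` after the one of `B`
    have e := decorrelation_of_le_add_pi hX hc hb (θ₀ := ψ 0) (θ₁ := ψ 1) (ψ₀ := θ 0 + 2 * π)
      (ψ₁ := θ 1 + 2 * π) h3 h4 (by linarith) (by linarith) hBm
      (by rwa [arc_congr (a' := θ 0) (b' := θ 1) (by simp) (by ring)])
    rw [inter_comm, mul_comm (P.real B)] at e
    linarith [p 0 0, p 1 0, p 1 1]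
  · have e := decorrelation_of_gaps_le_pi hX hc hb h1 h2 h3 h4 h'.le h.le hAm hBm
    have g' := hexp (affineGap_le_of_le hc hb h2 h'.le)
    linarith [p 0 0, p 1 1]

lemma decorrelation_of_disjoint_arc {θ ψ : Fin 2 → ℝ} (h1 : θ 0 ≤ θ 1) (h2 : ψ 0 ≤ ψ 1)
    (hdisj : Disjoint (arc (θ 0) (θ 1)) (arc (ψ 0) (ψ 1))) {A B : Set Ω}
    (hAm : MeasurableSet[supportSigmaAlgebra X (arc (θ 0) (θ 1))] A)
    (hBm : MeasurableSet[supportSigmaAlgebra X (arc (ψ 0) (ψ 1))] B) :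
    |P.real (A ∩ B) - P.real A * P.real B| ≤
      9 * ∑ i : Fin 2, ∑ j : Fin 2, exp (-(1 / 22528) * affineGap K (θ i) (ψ j)) := by
  -- move the second interval of lifts behind the first one
  set k : ℤ := toIcoDiv two_pi_pos (θ 0) (ψ 0)
  set ψ' : Fin 2 → ℝ := fun j => ψ j - k * (2 * π) with hψ'
  have hcoe : ∀ j, ((ψ' j : ℝ) : Real.Angle) = ψ j := fun j =>
    Real.Angle.angle_eq_iff_two_pi_dvd_sub.2 ⟨-k, by simp only [hψ']; push_cast; ring⟩
  have harc : arc (ψ 0) (ψ 1) = arc (ψ' 0) (ψ' 1) :=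
    arc_congr (hcoe 0).symm (by simp only [hψ']; ring)
  have hmem : ψ' 0 ∈ Ico (θ 0) (θ 0 + 2 * π) := by
    have := toIcoMod_mem_Ico two_pi_pos (θ 0) (ψ 0)
    rwa [toIcoMod, zsmul_eq_mul] at this
  rw [harc] at hdisj hBm
  have h12 : ψ' 0 ≤ ψ' 1 := by simp only [hψ']; linarith
  have hlow : θ 1 < ψ' 0 := by
    by_contra hcon
    push Not at hcon
    exact disjoint_left.1 hdisj ⟨ψ' 0, ⟨hmem.1, hcon⟩, rfl⟩ ⟨ψ' 0, ⟨le_rfl, h12⟩, rfl⟩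
  have hhigh : ψ' 1 < θ 0 + 2 * π := by
    by_contra hcon
    push Not at hcon
    exact disjoint_left.1 hdisj ⟨θ 0, ⟨le_rfl, h1⟩, rfl⟩
      ⟨θ 0 + 2 * π, ⟨hmem.2.le, hcon⟩, by simp⟩
  have := decorrelation_of_lt_add_two_pi hX hc hb h1 hlow h12 hhigh hAm hBm
  simpa only [hcoe] using this

end process

end RandomPolygon

end

theorem proposition7p5 :
    ∃ δ : ℝ, 0 < δ ∧ ∃ C : ℝ,
      ∀ (Ω : Type*) [MeasurableSpace Ω] (P : MeasureTheory.Measure Ω)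
        [MeasureTheory.IsProbabilityMeasure P]
        (K : Set RandomPolygon.Plane) (X : Ω → Finset RandomPolygon.Plane),
        Convex ℝ K → Bornology.IsBounded K → RandomPolygon.IsPoissonProcess P K X →
        ∀ θ ψ : Fin 2 → ℝ, θ 0 ≤ θ 1 → ψ 0 ≤ ψ 1 →
          Disjoint (RandomPolygon.arc (θ 0) (θ 1)) (RandomPolygon.arc (ψ 0) (ψ 1)) →
          ∀ A B : Set Ω,
            @MeasurableSet Ω (RandomPolygon.supportSigmaAlgebra X
              (RandomPolygon.arc (θ 0) (θ 1))) A →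
            @MeasurableSet Ω (RandomPolygon.supportSigmaAlgebra X
              (RandomPolygon.arc (ψ 0) (ψ 1))) B →
            |P.real (A ∩ B) - P.real A * P.real B| ≤
              C * ∑ i : Fin 2, ∑ j : Fin 2,
                Real.exp (-δ * RandomPolygon.affineGap K (θ i) (ψ j)) := by
  refine ⟨1 / 22528, by norm_num, 9, ?_⟩
  intro Ω _ P _ K X hc hb hX θ ψ h1 h2 hdisj A B hA hB
  exact RandomPolygon.decorrelation_of_disjoint_arc hX hc hb h1 h2 hdisj hA hB
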